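/- Let $\mathcal H$ be a complex Hilbert space, $\mathcal A\subseteq B(\mathcal H)$ a von Neumann algebra and $\tau:\mathcal A\to\mathcal A$ a normal unital completely positive map. Notation. For a subgroup $G$ of the unit circle $\mathbb T$ let $$\mathcal P_G(\tau)=\overline{\operatorname{span}}^{\|\cdot\|}\{x\in\mathcal A:\ \tau(x)=\lambda x\ \text{for some } \lambda\in G\},\qquad \mathcal P(\tau)=\mathcal P_{\mathbb T}(\tau).$$ A minimal dilation of $\tau$ is a triple $(\mathcal K,\mathcal B,\theta)$, where $\mathcal K\supseteq\mathcal H$ is a Hilbert space with orthogonal projection $p$ onto $\mathcal H$ (operators $x$ on $\mathcal H$ are identified with $pxp$ on $\mathcal K$), $\mathcal B\subseteq B(\mathcal K)$ is a von Neumann algebra with $\mathcal A=p\mathcal Bp$, $\theta:\mathcal B\to\mathcal B$ is a normal unital $*$-endomorphism with $\tau^n(x)=p\theta^n(x)p$ for all $x\in\mathcal A$, $n\ge 0$, $\mathcal K$ is the closed linear span of the vectors $\theta^n(x_n)\theta^{n-1}(x_{n-1})\cdots\theta(x_1)h$ with $n\ge 0$, $x_i\in\mathcal A$, $h\in\mathcal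 H$, and $\mathcal B$ is the von Neumann algebra generated by $\{\theta^n(x): n\ge0,\ x\in\mathcal A\}$. A minimal dilation exists, the compression $T(z)=pzp$ restricts to an isometric bijection of the $C^*$-algebra $\mathcal P(\theta)$ onto $\mathcal P(\tau)$, and the product $$x\circ_\tau y=T\big(T^{-1}(x)\,T^{-1}(y)\big)\qquad(x,y\in\mathcal P(\tau)),$$ with the norm, involution and unit of $\mathcal A$, makes $\mathcal P(\tau)$ a $C^*$-algebra, the peripheral Poisson boundary of $\tau$. Its $C^*$-subalgebra $\mathcal P_{\{1\}}(\tau)$ is the Poisson boundary of $\tau$, and, for $G_k=\{e^{2\pi i j/k}:0\le j<k\}$, its $C^*$-subalgebra $\mathcal P_{G_k}(\tau)$ is the $k$-cyclic Poisson boundary. Theorem. The minimal dilations and products above exist and are well defined as described for $\tau$ and for $\tau^k$, and for every natural number $k\ge 1$: 1. $\mathcal P(\tau^k)=\mathcal P(\tau)$, with the same product: $x\circ_{\tau^k}y=x\circ_\tau y$ for all $x,y\in\mathcal P(\tau)$, whichever minimal dilations of $\tau^k$ and of $\tau$ are used; 2. $\mathcal P_{\{1\}}(\tau^k)=\mathcal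 P_{G_k}(\tau)$, again with the same product; 3. in particular $(\mathcal P_{G_k}(\tau),\circ_\tau)$ is a von Neumann algebra, i.e. it is isometrically $*$-isomorphic to a von Neumann algebra of operators on a Hilbert space. -/

import Mathlib

open scoped InnerProductSpace CStarAlgebra
open ContinuousLinearMap (adjoint)

universe u

noncomputable section

/-! ### A von Neumann algebra, with the structure inherited from `B(H)`, as a C⋆-algebra -/

section VonNeumann

variable {H : Type u} [NormedAddCommGroup H] [InnerProductSpace ℂ H] [CompleteSpace H]

instance VonNeumannAlgebra.instSMulMemClass :
    SMulMemClass (VonNeumannAlgebra H) ℂ (H →L[ℂ] H) where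
  smul_mem {s} c _ hx := s.toStarSubalgebra.smul_mem hx c

theorem VonNeumannAlgebra.isClosed_coe (A : VonNeumannAlgebra H) :
    IsClosed (A : Set (H →L[ℂ] H)) := by
  rw [← A.centralizer_centralizer]
  exact Set.isClosed_centralizer _

/-- Norm, product and involution are those of `B(H)`. -/
instance VonNeumannAlgebra.instCStarAlgebra (A : VonNeumannAlgebra H) : CStarAlgebra A :=
  StarSubalgebra.cstarAlgebra A (h_closed := A.isClosed_coe)

/-- The order on a von Neumann algebra, inherited from the Loewner order of `B(H)`, is the
order given by its elements `star s * s`. -/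
instance VonNeumannAlgebra.instStarOrderedRing (A : VonNeumannAlgebra H) : StarOrderedRing A := by
  have hcl := A.isClosed_coe
  refine StarOrderedRing.of_nonneg_iff' (fun h z => add_le_add_right (α := H →L[ℂ] H) h z) ?_
  intro x
  constructor
  · intro hx
    have hx' : (0 : H →L[ℂ] H) ≤ (x : H →L[ℂ] H) := hx
    have hsa : IsSelfAdjoint x := Subtype.ext (IsSelfAdjoint.of_nonneg hx')
    have hsp : ∀ r ∈ spectrum ℝ x, 0 ≤ r := by
      intro r hr
      have h1 : (algebraMap ℝ ℂ r) ∈ spectrum ℂ x := by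
        rwa [spectrum.algebraMap_mem_iff]
      have h2 : spectrum ℂ x = spectrum ℂ (x : H →L[ℂ] H) :=
        StarSubalgebra.spectrum_eq A.toStarSubalgebra (hS := hcl) (a := x)
      rw [h2, spectrum.algebraMap_mem_iff] at h1
      exact spectrum_nonneg_of_nonneg hx' h1
    obtain ⟨p, hp, -, hpp⟩ := CFC.exists_sqrt_of_isSelfAdjoint_of_quasispectrumRestricts hsa
      (QuasispectrumRestricts.nnreal_iff.mpr (by
        intro r hr
        rw [quasispectrum_eq_spectrum_union_zero] at hr
        rcases hr with hr | hr
        · exact hsp r hr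
        · exact (Set.mem_singleton_iff.mp hr).ge))
    exact ⟨p, by rw [hp.star_eq, ← hpp]⟩
  · rintro ⟨s, rfl⟩
    exact star_mul_self_nonneg (s : H →L[ℂ] H)

/-- A linear functional on the von Neumann algebra `A ⊆ B(H)` is ultraweakly (σ-weakly)
continuous if it has the form `x ↦ ∑ₙ ⟪ξₙ, x ηₙ⟫` with `∑ₙ ‖ξₙ‖² < ∞` and `∑ₙ ‖ηₙ‖² < ∞`. -/
def IsUltraweaklyContinuous (A : VonNeumannAlgebra H) (f : A →ₗ[ℂ] ℂ) : Prop :=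
  ∃ ξ η : ℕ → H, (Summable fun n => ‖ξ n‖ ^ 2) ∧ (Summable fun n => ‖η n‖ ^ 2) ∧
    ∀ x : A, f x = ∑' n, ⟪ξ n, (x : H →L[ℂ] H) (η n)⟫_ℂ

/-- A linear map of a von Neumann algebra into itself is normal if it is ultraweakly continuous,
that is, if it pulls back ultraweakly continuous functionals to ultraweakly continuous ones. -/
def IsNormalMap (A : VonNeumannAlgebra H) (τ : Module.End ℂ A) : Prop :=
  ∀ f : A →ₗ[ℂ] ℂ, IsUltraweaklyContinuous A f → IsUltraweaklyContinuous A (f ∘ₗ τ)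

end VonNeumann

/-! ### Peripheral eigenvectors -/

section Peripheral

variable {M : Type u} [NormedAddCommGroup M] [NormedSpace ℂ M]

/-- `E_G(τ)`: the linear span of the eigenvectors of `τ` with eigenvalue in the subgroup `G` of
the unit circle. -/
def peripheralSpan (G : Subgroup Circle) (τ : Module.End ℂ M) : Submodule ℂ M :=
  Submodule.span ℂ {x | ∃ l ∈ G, τ x = (l : ℂ) • x}

/-- The norm closure `P_G(τ)` of `E_G(τ)`. Here `G = ⊤` gives the (underlying space of the)
peripheral Poisson boundary, `G = ⊥` the Poisson boundary, and `G = cyclicGroup k` the `k`-cyclic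
Poisson boundary. -/
def peripheralSpace (G : Subgroup Circle) (τ : Module.End ℂ M) : Submodule ℂ M :=
  (peripheralSpan G τ).topologicalClosure

/-- The group of powers of `exp (2πi/k)`. -/
def cyclicGroup (k : ℕ) : Subgroup Circle :=
  Subgroup.zpowers (Circle.exp (2 * Real.pi / k))

end Peripheral

/-! ### Minimal dilations and the product of the peripheral Poisson boundary -/

section Dilation

variable {H : Type u} [NormedAddCommGroup H] [InnerProductSpace ℂ H] [CompleteSpace H]

/-- For an isometric embedding `V : H → K`, the operator `x` on `H` seen as the operator `p x p`
on `K`, where `p = V V†` is the projection onto (the copy of) `H`. -/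
def extendOp {K : Type u} [NormedAddCommGroup K] [InnerProductSpace ℂ K] [CompleteSpace K]
    (V : H →ₗᵢ[ℂ] K) (x : H →L[ℂ] H) : K →L[ℂ] K :=
  V.toContinuousLinearMap ∘L x ∘L adjoint V.toContinuousLinearMap

/-- For an isometric embedding `V : H → K`, the compression to `H` of an operator on `K`. -/
def compressOp {K : Type u} [NormedAddCommGroup K] [InnerProductSpace ℂ K] [CompleteSpace K]
    (V : H →ₗᵢ[ℂ] K) (z : K →L[ℂ] K) : H →L[ℂ] H :=
  adjoint V.toContinuousLinearMap ∘L z ∘L V.toContinuousLinearMap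

/-- A minimal dilation `(K, B, θ)` of a linear map `τ : A → A` on a von Neumann algebra
`A ⊆ B(H)`. The inclusion `H ⊆ K` is an isometric embedding `V`, and `A` is identified with a
subset of `B(K)` through `extendOp V`. -/
structure MinimalDilation (A : VonNeumannAlgebra H) (τ : Module.End ℂ A) where
  K : Type u
  [normedAddCommGroup : NormedAddCommGroup K]
  [innerProductSpace : InnerProductSpace ℂ K]
  [completeSpace : CompleteSpace K]
  V : H →ₗᵢ[ℂ] K
  B : VonNeumannAlgebra K
  /-- the unital `*`-endomorphism -/
  θ : B →⋆ₐ[ℂ] B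
  normal : IsNormalMap B (θ : B →ₗ[ℂ] B)
  /-- With the next field: `A = p B p`. -/
  extend_mem : ∀ x : A, extendOp V (x : H →L[ℂ] H) ∈ B
  compress_mem : ∀ z : B, compressOp V (z : K →L[ℂ] K) ∈ A
  /-- the dilation property `τⁿ(x) = p θⁿ(x) p` -/
  dilation : ∀ (n : ℕ) (x : A),
    ((τ ^ n) x : H →L[ℂ] H) = compressOp V ((θ^[n] ⟨extendOp V x, extend_mem x⟩ : B) : K →L[ℂ] K)
  /-- `K` is the closed span of the vectors `θⁿ(xₙ) θⁿ⁻¹(xₙ₋₁) ⋯ θ(x₁) h`. -/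
  space_minimal :
    (Submodule.span ℂ {v : K | ∃ (n : ℕ) (x : ℕ → A) (h : H),
      v = ((((List.range n).map fun j =>
        θ^[n - j] ⟨extendOp V (x (n - j)), extend_mem (x (n - j))⟩).prod : B) : K →L[ℂ] K)
          (V h)}).topologicalClosure = ⊤
  /-- `B` is the von Neumann algebra generated by the `θⁿ(x)`. -/
  algebra_minimal :
    (B : Set (K →L[ℂ] K)) = Set.centralizer (Set.centralizer
      {z | ∃ (n : ℕ) (x : A), z = ((θ^[n] ⟨extendOp V x, extend_mem x⟩ : B) : K →L[ℂ] K)})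

namespace MinimalDilation

attribute [instance] normedAddCommGroup innerProductSpace completeSpace

variable {A : VonNeumannAlgebra H} {τ : Module.End ℂ A} (D : MinimalDilation A τ)

/-- `θ` as a linear map. -/
def endo : Module.End ℂ D.B := (D.θ : D.B →ₗ[ℂ] D.B)

/-- The compression map `T : B → A`, `z ↦ p z p`. -/
def compress (z : D.B) : A := ⟨compressOp D.V (z : D.K →L[ℂ] D.K), D.compress_mem z⟩

/-- The inverse of the restriction of the compression map `T` to a map `P(θ) → P(τ)`. -/
def lift (x : A) : D.B :=
  Function.invFunOn D.compress (peripheralSpace ⊤ D.endo : Set D.B) x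

/-- The product `x ∘ y = T (T⁻¹(x) T⁻¹(y))` of the peripheral Poisson boundary `P(τ)`
(only meaningful for `x` and `y` in `P(τ)`). -/
def mul (x y : A) : A := D.compress (D.lift x * D.lift y)

/-- The compression map restricts to an isometric bijection of `P(θ)` onto `P(τ)`. -/
def CompressesIsometrically : Prop :=
  Set.BijOn D.compress (peripheralSpace ⊤ D.endo : Set D.B) (peripheralSpace ⊤ τ : Set A) ∧
    ∀ z ∈ peripheralSpace ⊤ D.endo, ‖D.compress z‖ = ‖z‖

end MinimalDilation

/-- The subspace `S` of `A`, with the norm, the involution and the unit of `A` and with the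
product `m`, is a von Neumann algebra: it is closed under these operations, and it is
isometrically `*`-isomorphic to a von Neumann algebra of operators on some Hilbert space. -/
def IsVonNeumannWithProduct {A : VonNeumannAlgebra H} (S : Submodule ℂ A) (m : A → A → A) :
    Prop :=
  ∃ (L : Type u) (_ : NormedAddCommGroup L) (_ : InnerProductSpace ℂ L) (_ : CompleteSpace L)
    (N : VonNeumannAlgebra L) (φ : S ≃ₗᵢ[ℂ] N),
    (∀ x y : S, ∃ h : m x y ∈ S, φ ⟨m x y, h⟩ = φ x * φ y) ∧
    (∀ x : S, ∃ h : star (x : A) ∈ S, φ ⟨star (x : A), h⟩ = star (φ x)) ∧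
    ∃ h : (1 : A) ∈ S, φ ⟨1, h⟩ = 1

end Dilation

end

/-! The theorem rests on comparing `τ` with an endomorphism `θ` that dilates it. Let `p` be the
projection onto `H` and `T` the compression. Since `τ` is unital, `p ≤ θⁿ(p)`, hence `T ∘ θ = τ ∘ T`
(`compress_θ`); by minimality of `K` the projections `θⁿ(p)` converge strongly to `1`
(`tendsto_proj_apply`). If `θ z = λ z`, then `θⁿ(p) z θⁿ(p) = λ⁻ⁿ θⁿ(T z)`, so `T z` determines all
these corners and therefore `z`. Conversely, if `τ x = λ x`, the operators `λ⁻ⁿ θⁿ(x)` are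
compatible corners, and a weak limit of them is an eigenvector of `θ` over `x`
(`exists_eigenvector`). For finite sums of eigenvectors, recurrence of rotations on a torus shows
that `T` is isometric (`norm_le_norm_compress_of_mem_span`).

The product is intrinsic: inserting `θⁿ(p)` between two lifted eigenvectors shows that, for
eigenvalues `λ` and `μ`, `x ∘ y` is the weak limit of `(λ μ)⁻ⁿ τⁿ(x y)` (`tendsto_inner_mul`). The
sequence for `τ ^ k` is the subsequence with indices `k n`, so both products agree on eigenvectors,
and by linearity and continuity everywhere (`mul_pow_eq`). The subspaces agree because a solution of
`τᵏ x = λᵏ x` is an average of eigenvectors of `τ` whose eigenvalues are `λ` times `k`-th roots of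
unity (`mem_peripheralSpan_of_pow`). Finally, the fixed points of the normal endomorphism dilating
`τ ^ k` form a von Neumann algebra, which is transported to the `k`-cyclic boundary.

Existence of a minimal dilation is proved by Kolmogorov decomposition: complete positivity makes the
prescribed Gram kernel of the vectors `θⁿ(xₙ) ⋯ θ(x₁) x₀ h` positive. On the Hilbert space of this
kernel, `θ` is defined through matrix coefficients. It is multiplicative on operators preserving the
span of the generating maps; normality of `τ`, the Schwarz inequality and ultrastrong density extend
this to the bicommutant (`shiftOp_mul`). -/

noncomputable section

open Filter Topology
open scoped ComplexOrder

/-! ### Amplifications and the double commutant theorem -/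

section Amplification

variable {K : Type*} [NormedAddCommGroup K]

/-- The Hilbert space of square summable sequences in `K`. -/
abbrev Ell2 (K : Type*) [NormedAddCommGroup K] : Type _ := lp (fun _ : ℕ => K) 2

/-- A square summable sequence, as an element of `Ell2 K`. -/
def Ell2.mk (ξ : ℕ → K) (h : Summable fun n => ‖ξ n‖ ^ 2) : Ell2 K :=
  ⟨ξ, memℓp_gen (by simpa using h)⟩

@[simp] theorem Ell2.mk_apply (ξ : ℕ → K) (h : Summable fun n => ‖ξ n‖ ^ 2) (n : ℕ) :
    (Ell2.mk ξ h : ∀ _, K) n = ξ n := rfl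

theorem Ell2.hasSum_norm_sq (ξ : Ell2 K) : HasSum (fun n => ‖ξ n‖ ^ 2) (‖ξ‖ ^ 2) := by
  simpa using lp.hasSum_norm (p := 2) (by simp) ξ

variable [InnerProductSpace ℂ K]

/-- The diagonal action of an operator on square summable sequences. -/
def amplifyCLM (T : K →L[ℂ] K) : Ell2 K →L[ℂ] Ell2 K :=
  lp.mapCLM 2 (fun _ => T) (norm_nonneg T) (fun _ => le_rfl)

@[simp] theorem amplifyCLM_apply (T : K →L[ℂ] K) (ξ : Ell2 K) (n : ℕ) :
    (amplifyCLM T ξ : ∀ _, K) n = T (ξ n) := rfl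

variable [CompleteSpace K]

variable (K) in
/-- The amplification `T ↦ T ⊗ 1` of operators to square summable sequences. -/
def amplify : (K →L[ℂ] K) →⋆ₐ[ℂ] (Ell2 K →L[ℂ] Ell2 K) where
  toFun := amplifyCLM
  map_one' := by ext; simp
  map_mul' S T := by ext; simp
  map_zero' := by ext; simp
  map_add' S T := by ext; simp
  commutes' c := by ext; simp [Algebra.algebraMap_eq_smul_one]
  map_star' T := by
    rw [ContinuousLinearMap.star_eq_adjoint, ContinuousLinearMap.star_eq_adjoint,
      ContinuousLinearMap.eq_adjoint_iff]
    intro ξ η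
    simp [lp.inner_eq_tsum, ContinuousLinearMap.adjoint_inner_left]

@[simp] theorem amplify_apply (T : K →L[ℂ] K) (ξ : Ell2 K) (n : ℕ) :
    (amplify K T ξ : ∀ _, K) n = T (ξ n) := rfl

theorem inner_amplify (T : K →L[ℂ] K) (ξ η : Ell2 K) :
    ⟪ξ, amplify K T η⟫_ℂ = ∑' n, ⟪ξ n, T (η n)⟫_ℂ := by
  simp [lp.inner_eq_tsum]

theorem map_star_inner_left {R : Type*} [Semiring R] [Algebra ℂ R] [Star R]
    {L : Type*} [NormedAddCommGroup L] [InnerProductSpace ℂ L] [CompleteSpace L]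
    (ρ : R →⋆ₐ[ℂ] (L →L[ℂ] L)) (b : R) (x y : L) : ⟪ρ (star b) x, y⟫_ℂ = ⟪x, ρ b y⟫_ℂ := by
  rw [map_star, ContinuousLinearMap.star_eq_adjoint, ContinuousLinearMap.adjoint_inner_left]

theorem map_star_inner_right {R : Type*} [Semiring R] [Algebra ℂ R] [Star R]
    {L : Type*} [NormedAddCommGroup L] [InnerProductSpace ℂ L] [CompleteSpace L]
    (ρ : R →⋆ₐ[ℂ] (L →L[ℂ] L)) (b : R) (x y : L) : ⟪x, ρ (star b) y⟫_ℂ = ⟪ρ b x, y⟫_ℂ := by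
  rw [map_star, ContinuousLinearMap.star_eq_adjoint, ContinuousLinearMap.adjoint_inner_right]

/-- The double commutant theorem: a unital `*`-algebra is ultrastrongly dense in its
bicommutant. -/
theorem exists_norm_amplify_sub_lt (S : StarSubalgebra ℂ (K →L[ℂ] K)) (η : Ell2 K)
    {T : K →L[ℂ] K} (hT : T ∈ Set.centralizer (Set.centralizer (S : Set (K →L[ℂ] K))))
    {ε : ℝ} (hε : 0 < ε) : ∃ s ∈ S, ‖amplify K (T - s) η‖ < ε := by
  let M₀ : Submodule ℂ (Ell2 K) :=
    (Subalgebra.toSubmodule S.toSubalgebra).map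
      ((ContinuousLinearMap.apply ℂ (Ell2 K) η).toLinearMap ∘ₗ
        (amplify K).toAlgHom.toLinearMap)
  have hM₀ : ∀ s ∈ S, amplify K s η ∈ M₀ := fun s hs => ⟨s, hs, rfl⟩
  let M := M₀.topologicalClosure
  have hle : M₀ ≤ M := M₀.le_topologicalClosure
  have : CompleteSpace M := M₀.isClosed_topologicalClosure.completeSpace_coe
  have hinv : ∀ s ∈ S, ∀ x ∈ M, amplify K s x ∈ M := by
    intro s hs
    have : M ≤ M.comap (amplify K s).toLinearMap := by
      refine M₀.topologicalClosure_minimal ?_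
        (M₀.isClosed_topologicalClosure.preimage (amplify K s).continuous)
      rintro _ ⟨t, ht, rfl⟩
      refine hle ⟨s * t, S.mul_mem hs ht, ?_⟩
      simp
    exact this
  have hinv' : ∀ s ∈ S, ∀ x ∈ Mᗮ, amplify K s x ∈ Mᗮ := by
    intro s hs x hx
    rw [Submodule.mem_orthogonal] at hx ⊢
    intro y hy
    rw [← map_star_inner_left]
    exact hx _ (hinv _ (star_mem hs) y hy)
  have hcomm : ∀ s ∈ S, ∀ x, M.starProjection (amplify K s x) = amplify K s (M.starProjection x) := by
    intro s hs x
    refine Submodule.eq_starProjection_of_mem_orthogonal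
      (hinv s hs _ (Submodule.starProjection_apply_mem _ _)) ?_
    rw [← map_sub]
    exact hinv' s hs _ (M.sub_starProjection_mem_orthogonal x)
  -- The matrix entries of the projection onto the closed cyclic subspace generated by `η`. They
  -- commute with `S`, hence with `T`, so the projection commutes with `T ⊗ 1`.
  let Pij : ℕ → ℕ → K →L[ℂ] K := fun i j =>
    (lp.evalCLM ℂ (fun _ : ℕ => K) 2 i) ∘L M.starProjection ∘L
      (lp.singleContinuousLinearMap ℂ (fun _ : ℕ => K) 2 j)
  have hsingle : ∀ (T : K →L[ℂ] K) j (a : K),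
      amplify K T (lp.single 2 j a) = lp.single 2 j (T a) := by
    intro T j a
    ext i
    by_cases hij : i = j
    · subst hij; simp
    · simp [hij]
  have hPij : ∀ i j a, Pij i j a = (M.starProjection (lp.single 2 j a) : ∀ _, K) i :=
    fun _ _ _ => rfl
  have hP : ∀ i j, Pij i j ∈ Set.centralizer (S : Set (K →L[ℂ] K)) := by
    intro i j s hs
    ext a
    simp only [mul_apply_eq_comp, hPij]
    rw [← hsingle, hcomm s hs]
    simp
  have key : amplify K T ∘L M.starProjection = M.starProjection ∘L amplify K T := by
    refine lp.ext_continuousLinearMap (by simp) fun j => ?_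
    ext a i
    have := congrArg (fun R : K →L[ℂ] K => R a) (hT _ (hP i j))
    simp only [mul_apply_eq_comp, hPij] at this
    simp [hsingle, this]
  -- This is where unitality of `S` is needed: it puts `η` itself in the cyclic subspace.
  have hη : M.starProjection η = η :=
    Submodule.starProjection_eq_self_iff.2 (hle (by simpa using hM₀ 1 S.one_mem))
  have hTη : amplify K T η ∈ M := by
    have := congrArg (fun R => R η) key
    simp only [ContinuousLinearMap.comp_apply, hη] at this
    rw [this]
    exact Submodule.starProjection_apply_mem _ _
  obtain ⟨_, ⟨s, hs, rfl⟩, h⟩ := Metric.mem_closure_iff.1 hTη ε hε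
  refine ⟨s, hs, ?_⟩
  rw [dist_eq_norm] at h
  rw [map_sub]
  exact h

/-- An ultraweakly continuous functional that vanishes on a unital `*`-algebra vanishes on its
bicommutant. -/
theorem inner_amplify_eq_zero_of_mem_bicommutant (S : StarSubalgebra ℂ (K →L[ℂ] K))
    (ξ η : Ell2 K) (h : ∀ s ∈ S, ⟪ξ, amplify K s η⟫_ℂ = 0) {T : K →L[ℂ] K}
    (hT : T ∈ Set.centralizer (Set.centralizer (S : Set (K →L[ℂ] K)))) :
    ⟪ξ, amplify K T η⟫_ℂ = 0 := by
  by_contra hne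
  have hξ : 0 < ‖ξ‖ := by
    rw [norm_pos_iff]
    rintro rfl
    simp at hne
  obtain ⟨s, hs, hlt⟩ := exists_norm_amplify_sub_lt S η hT
    (ε := ‖⟪ξ, amplify K T η⟫_ℂ‖ / ‖ξ‖) (by positivity)
  have h1 : ⟪ξ, amplify K T η⟫_ℂ = ⟪ξ, amplify K (T - s) η⟫_ℂ := by
    rw [map_sub, sub_apply, inner_sub_right, h s hs, sub_zero]
  have h2 := norm_inner_le_norm (𝕜 := ℂ) ξ (amplify K (T - s) η)
  rw [← h1] at h2
  rw [lt_div_iff₀ hξ] at hlt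
  linarith [mul_comm ‖ξ‖ ‖amplify K (T - s) η‖]

end Amplification

/-! ### A Radon–Nikodym theorem for vector functionals -/

section RadonNikodym

variable {R : Type*} [Ring R] [Algebra ℂ R] [StarRing R]
  {L : Type*} [NormedAddCommGroup L] [InnerProductSpace ℂ L] [CompleteSpace L]
  {L' : Type*} [NormedAddCommGroup L'] [InnerProductSpace ℂ L'] [CompleteSpace L']

/-- A vector functional of a representation `σ` dominated by a vector functional of `ρ` is a
vector functional of `ρ`. -/
theorem exists_vector_functional_of_dominated (ρ : R →⋆ₐ[ℂ] (L →L[ℂ] L))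
    (σ : R →⋆ₐ[ℂ] (L' →L[ℂ] L')) (Z : L) (v : L') (h : ∀ b, ‖σ b v‖ ≤ ‖ρ b Z‖) :
    ∃ Z' : L, ∀ b, ⟪v, σ b v⟫_ℂ = ⟪Z', ρ b Z'⟫_ℂ := by
  let g : R →ₗ[ℂ] L := (ContinuousLinearMap.apply ℂ L Z).toLinearMap ∘ₗ ρ.toAlgHom.toLinearMap
  let g' : R →ₗ[ℂ] L' := (ContinuousLinearMap.apply ℂ L' v).toLinearMap ∘ₗ σ.toAlgHom.toLinearMap
  have hg : ∀ b, g b = ρ b Z := fun _ => rfl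
  have hg' : ∀ b, g' b = σ b v := fun _ => rfl
  let M := (LinearMap.range g).topologicalClosure
  have : CompleteSpace M := (LinearMap.range g).isClosed_topologicalClosure.completeSpace_coe
  have hmem : ∀ b, g b ∈ M := fun b => Submodule.le_topologicalClosure _ ⟨b, rfl⟩
  let e : R →ₗ[ℂ] M := g.codRestrict M hmem
  have he : DenseRange e := by
    intro x
    rw [Metric.mem_closure_iff]
    intro ε hε
    have hx : (x : L) ∈ closure (LinearMap.range g : Set L) := x.2
    obtain ⟨_, ⟨b, rfl⟩, hb⟩ := Metric.mem_closure_iff.1 hx ε hε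
    exact ⟨e b, ⟨b, rfl⟩, hb⟩
  have hinv : ∀ b, ∀ x ∈ M, ρ b x ∈ M := by
    intro b
    have : M ≤ M.comap (ρ b).toLinearMap := by
      refine Submodule.topologicalClosure_minimal _ ?_
        ((LinearMap.range g).isClosed_topologicalClosure.preimage (ρ b).continuous)
      rintro _ ⟨t, rfl⟩
      refine Submodule.le_topologicalClosure _ ⟨b * t, ?_⟩
      simp [hg]
    exact this
  have hinv' : ∀ b, ∀ x ∈ Mᗮ, ρ b x ∈ Mᗮ := by
    intro b x hx
    rw [Submodule.mem_orthogonal] at hx ⊢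
    intro y hy
    rw [← map_star_inner_left]
    exact hx _ (hinv _ y hy)
  have hcomm : ∀ b x, M.starProjection (ρ b x) = ρ b (M.starProjection x) := by
    intro b x
    refine Submodule.eq_starProjection_of_mem_orthogonal
      (hinv b _ (Submodule.starProjection_apply_mem _ _)) ?_
    rw [← map_sub]
    exact hinv' b _ (M.sub_starProjection_mem_orthogonal x)
  have hbd : ∃ C, ∀ b, ‖g' b‖ ≤ C * ‖e b‖ := ⟨1, fun b => by
    rw [one_mul]; exact h b⟩
  -- Domination makes `ρ b Z ↦ σ b v` a well-defined contraction, and it intertwines `ρ` and `σ`.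
  let W₀ : M →L[ℂ] L' := g'.extendOfNorm e
  have hW₀ : ∀ b, W₀ (e b) = σ b v := fun b => LinearMap.extendOfNorm_eq he hbd b
  have hW₀' : ∀ b (x : M), W₀ ⟨ρ b x, hinv b x x.2⟩ = σ b (W₀ x) := by
    intro b x
    refine he.induction_on (p := fun x : M => W₀ ⟨ρ b x, hinv b x x.2⟩ = σ b (W₀ x)) x ?_ ?_
    · refine isClosed_eq (W₀.continuous.comp ?_) (by fun_prop)
      exact Continuous.subtype_mk (by fun_prop) _
    · intro c
      have : (⟨ρ b (e c), hinv b _ (e c).2⟩ : M) = e (b * c) := by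
        apply Subtype.ext
        simp [e, hg]
      rw [this, hW₀, hW₀]
      simp
  let W : L →L[ℂ] L' := W₀ ∘L M.orthogonalProjectionOnto
  have hWZ : W Z = v := by
    have h1 : M.orthogonalProjectionOnto Z = e 1 := by
      have hZ : Z ∈ M := by simpa [hg] using hmem 1
      have := Submodule.orthogonalProjectionOnto_mem_subspace_eq_self (⟨Z, hZ⟩ : M)
      rw [this]
      apply Subtype.ext
      simp [e, hg]
    have h2 := hW₀ 1
    simp only [map_one, one_apply_eq_self] at h2
    simp [W, h1, h2]
  have hWcomm : ∀ b x, W (ρ b x) = σ b (W x) := by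
    intro b x
    simp only [W, ContinuousLinearMap.comp_apply]
    rw [← hW₀']
    congr 1
    apply Subtype.ext
    exact hcomm b x
  let T : L →L[ℂ] L := adjoint W ∘L W
  have hT0 : 0 ≤ T := by
    rw [ContinuousLinearMap.nonneg_iff_isPositive]
    exact ContinuousLinearMap.isPositive_adjoint_comp_self W
  have hTcomm : ∀ b, Commute T (ρ b) := by
    intro b
    ext x
    refine ext_inner_left ℂ fun y => ?_
    simp only [mul_apply_eq_comp, T, ContinuousLinearMap.comp_apply]
    rw [ContinuousLinearMap.adjoint_inner_right, hWcomm, ← map_star_inner_left σ,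
      ← hWcomm, ← map_star_inner_left ρ, ContinuousLinearMap.adjoint_inner_right]
  -- The positive operator `W* W` commutes with `ρ`, hence so does its square root `Q`. The required
  -- vector is `Q Z`, because `⟪Q Z, ρ b (Q Z)⟫ = ⟪W Z, W (ρ b Z)⟫ = ⟪v, σ b v⟫`.
  let Q := CFC.sqrt T
  have hQ0 : 0 ≤ Q := CFC.sqrt_nonneg T
  have hQQ : Q * Q = T := CFC.sqrt_mul_sqrt_self T hT0
  have hQsa : IsSelfAdjoint Q := IsSelfAdjoint.of_nonneg hQ0
  have hQcomm : ∀ b, Commute Q (ρ b) := by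
    intro b
    rw [show Q = cfcₙ NNReal.sqrt T from rfl]
    exact (hTcomm b).cfcₙ_nnreal _
  refine ⟨Q Z, fun b => ?_⟩
  have h1 : ρ b (Q Z) = Q (ρ b Z) := by
    have := congrArg (fun S : L →L[ℂ] L => S Z) (hQcomm b).eq
    simpa using this.symm
  rw [h1]
  have h2 : ⟪Q Z, Q (ρ b Z)⟫_ℂ = ⟪Z, T (ρ b Z)⟫_ℂ := by
    rw [← hQQ, mul_apply_eq_comp]
    conv_rhs => rw [← hQsa.star_eq, ContinuousLinearMap.star_eq_adjoint,
      ContinuousLinearMap.adjoint_inner_right, ← ContinuousLinearMap.star_eq_adjoint, hQsa.star_eq]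
  rw [h2]
  simp only [T, ContinuousLinearMap.comp_apply]
  rw [ContinuousLinearMap.adjoint_inner_right, hWcomm, hWZ]

end RadonNikodym

/-! ### Iterated amplifications -/

section Flatten

variable {K : Type*} [NormedAddCommGroup K]

/-- Regard a square summable sequence of square summable sequences as a single sequence. -/
def Ell2.flatten (X : Ell2 (Ell2 K)) : Ell2 K :=
  Ell2.mk (fun n => (X (Nat.pairEquiv.symm n).1 : ∀ _, K) (Nat.pairEquiv.symm n).2) <| by
    have h : Summable fun p : ℕ × ℕ => ‖(X p.1 : ∀ _, K) p.2‖ ^ 2 := by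
      rw [summable_prod_of_nonneg (fun _ => by positivity)]
      refine ⟨fun a => (X a).hasSum_norm_sq.summable, ?_⟩
      simp_rw [fun a => (X a).hasSum_norm_sq.tsum_eq]
      exact X.hasSum_norm_sq.summable
    exact h.comp_injective Nat.pairEquiv.symm.injective

theorem Ell2.flatten_apply (X : Ell2 (Ell2 K)) (n : ℕ) :
    (flatten X : ∀ _, K) n = (X (Nat.pairEquiv.symm n).1 : ∀ _, K) (Nat.pairEquiv.symm n).2 := rfl

variable [InnerProductSpace ℂ K]

theorem Ell2.inner_flatten (X Y : Ell2 (Ell2 K)) : ⟪flatten X, flatten Y⟫_ℂ = ⟪X, Y⟫_ℂ := by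
  let f : ℕ × ℕ → ℂ := fun p => ⟪(X p.1 : ∀ _, K) p.2, (Y p.1 : ∀ _, K) p.2⟫_ℂ
  have hf : Summable f :=
    (Nat.pairEquiv.symm.summable_iff (f := f)).1 (lp.summable_inner (flatten X) (flatten Y))
  rw [lp.inner_eq_tsum, lp.inner_eq_tsum]
  simp_rw [lp.inner_eq_tsum (𝕜 := ℂ) (G := fun _ : ℕ => K) (X _) (Y _)]
  rw [← hf.tsum_prod]
  exact Nat.pairEquiv.symm.tsum_eq f

theorem Ell2.norm_flatten (X : Ell2 (Ell2 K)) : ‖flatten X‖ = ‖X‖ := by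
  rw [@norm_eq_sqrt_re_inner ℂ, Ell2.inner_flatten, ← @norm_eq_sqrt_re_inner ℂ]

variable [CompleteSpace K]

theorem Ell2.amplify_flatten (T : K →L[ℂ] K) (X : Ell2 (Ell2 K)) :
    amplify K T (flatten X) = flatten (amplify (Ell2 K) (amplify K T) X) := by
  ext n
  simp [Ell2.flatten_apply]

end Flatten

/-- Iterate `‖a + b‖² ≤ 2‖a‖² + 2‖b‖²`, splitting off the first term each time. The weights do not
depend on `n`, so the estimate passes to infinite sums. -/
theorem norm_sum_range_sq_le {E : Type*} [SeminormedAddCommGroup E] (n : ℕ) (u : ℕ → E) :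
    ‖∑ k ∈ Finset.range n, u k‖ ^ 2 ≤ ∑ k ∈ Finset.range n, 2 ^ (k + 1) * ‖u k‖ ^ 2 := by
  induction n generalizing u with
  | zero => simp
  | succ n ih =>
    rw [Finset.sum_range_succ', Finset.sum_range_succ']
    have h1 := ih fun k => u (k + 1)
    set S := ∑ k ∈ Finset.range n, u (k + 1)
    have h2 : ‖S + u 0‖ ^ 2 ≤ 2 * ‖S‖ ^ 2 + 2 * ‖u 0‖ ^ 2 := by
      have := norm_add_le S (u 0)
      have h0 := norm_nonneg (S + u 0)
      nlinarith [sq_nonneg (‖S‖ - ‖u 0‖)]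
    have h3 : ∑ k ∈ Finset.range n, 2 ^ (k + 1 + 1) * ‖u (k + 1)‖ ^ 2 =
        2 * ∑ k ∈ Finset.range n, 2 ^ (k + 1) * ‖u (k + 1)‖ ^ 2 := by
      rw [Finset.mul_sum]
      exact Finset.sum_congr rfl fun k _ => by ring
    rw [h3]
    simp only [zero_add, pow_one]
    linarith

/-! ### Ultraweakly continuous functionals and matrix coefficients -/

section UltraweakFunctional

variable {R : Type*} [Ring R] [Algebra ℂ R] [StarRing R]
  {K : Type*} [NormedAddCommGroup K] [InnerProductSpace ℂ K] [CompleteSpace K]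

/-- The functional `f` on `R` is ultraweakly continuous in the representation `ρ`. -/
def IsUltraweakFor (ρ : R →⋆ₐ[ℂ] (K →L[ℂ] K)) (f : R → ℂ) : Prop :=
  ∃ ξ η : Ell2 K, ∀ b, f b = ⟪ξ, amplify K (ρ b) η⟫_ℂ

namespace IsUltraweakFor

variable {ρ : R →⋆ₐ[ℂ] (K →L[ℂ] K)} {f g : R → ℂ}

theorem inner (ξ η : K) : IsUltraweakFor ρ fun b => ⟪ξ, ρ b η⟫_ℂ := by
  refine ⟨lp.single 2 0 ξ, lp.single 2 0 η, fun b => ?_⟩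
  simp [lp.inner_single_left]

theorem zero : IsUltraweakFor ρ fun _ => 0 := ⟨0, 0, by simp⟩

theorem add (hf : IsUltraweakFor ρ f) (hg : IsUltraweakFor ρ g) :
    IsUltraweakFor ρ fun b => f b + g b := by
  obtain ⟨ξ, η, h⟩ := hf
  obtain ⟨ξ', η', h'⟩ := hg
  refine ⟨Ell2.flatten (lp.single 2 0 ξ + lp.single 2 1 ξ'),
    Ell2.flatten (lp.single 2 0 η + lp.single 2 1 η'), fun b => ?_⟩
  beta_reduce
  rw [Ell2.amplify_flatten, Ell2.inner_flatten, h, h']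
  simp [lp.inner_single_left]

theorem const_mul (c : ℂ) (hf : IsUltraweakFor ρ f) : IsUltraweakFor ρ fun b => c * f b := by
  obtain ⟨ξ, η, h⟩ := hf
  refine ⟨ξ, c • η, fun b => ?_⟩
  beta_reduce
  rw [h, map_smul, inner_smul_right]

theorem sub (hf : IsUltraweakFor ρ f) (hg : IsUltraweakFor ρ g) :
    IsUltraweakFor ρ fun b => f b - g b := by
  simpa [sub_eq_add_neg] using hf.add (hg.const_mul (-1))

theorem sum {ι : Type*} (s : Finset ι) {f : ι → R → ℂ} (h : ∀ i ∈ s, IsUltraweakFor ρ (f i)) :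
    IsUltraweakFor ρ fun b => ∑ i ∈ s, f i b := by
  classical
  induction s using Finset.induction_on with
  | empty => simpa using zero
  | insert a s ha ih =>
    simp_rw [Finset.sum_insert ha]
    exact (h a (by simp)).add (ih fun i hi => h i (by simp [hi]))

/-- Ultraweakly continuous functionals are continuous for bounded weak operator convergence. -/
theorem tendsto (hf : IsUltraweakFor ρ f) {ι : Type*} {l : Filter ι} {b : ι → R} {c : R} (C : ℝ)
    (hC : ∀ i, ‖ρ (b i)‖ ≤ C)
    (hb : ∀ x y, Tendsto (fun i => ⟪x, ρ (b i) y⟫_ℂ) l (𝓝 ⟪x, ρ c y⟫_ℂ)) :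
    Tendsto (fun i => f (b i)) l (𝓝 (f c)) := by
  obtain ⟨ξ, η, h⟩ := hf
  simp_rw [h, inner_amplify]
  refine tendsto_tsum_of_dominated_convergence (bound := fun n => C * (‖ξ n‖ ^ 2 + ‖η n‖ ^ 2))
    ?_ (fun n => hb _ _) (Eventually.of_forall fun i n => ?_)
  · exact (ξ.hasSum_norm_sq.summable.add η.hasSum_norm_sq.summable).mul_left C
  · calc ‖⟪ξ n, ρ (b i) (η n)⟫_ℂ‖ ≤ ‖ξ n‖ * ‖ρ (b i) (η n)‖ := norm_inner_le_norm _ _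
      _ ≤ ‖ξ n‖ * (C * ‖η n‖) := by
        gcongr
        exact (ρ (b i)).le_of_opNorm_le (hC i) _
      _ = C * (‖ξ n‖ * ‖η n‖) := by ring
      _ ≤ C * (‖ξ n‖ ^ 2 + ‖η n‖ ^ 2) := by
        have hC0 : 0 ≤ C := (norm_nonneg _).trans (hC i)
        gcongr
        nlinarith [sq_nonneg (‖ξ n‖ - ‖η n‖), sq_nonneg (‖ξ n‖), sq_nonneg (‖η n‖)]

variable {L : Type*} [NormedAddCommGroup L] [InnerProductSpace ℂ L] [CompleteSpace L]
  (σ : R →⋆ₐ[ℂ] (L →L[ℂ] L))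

/-- An ultraweakly continuous vector functional of a representation `σ` is a vector functional of
the amplification of `ρ`. -/
theorem exists_vector (u : L) (h : IsUltraweakFor ρ fun b => ⟪u, σ b u⟫_ℂ) :
    ∃ Z : Ell2 K, ∀ b, ⟪u, σ b u⟫_ℂ = ⟪Z, amplify K (ρ b) Z⟫_ℂ := by
  obtain ⟨ξ, η, h⟩ := h
  beta_reduce at h
  -- With `x` and `y` the images of `ξ` and `η`, `‖σ b u‖² = Re ⟪x, y⟫ ≤ ‖(x + y) / 2‖²`, so the
  -- midpoint of `ξ` and `η` dominates.
  refine exists_vector_functional_of_dominated ((amplify K).comp ρ) σ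
    ((1 / 2 : ℂ) • (ξ + η)) u fun b => ?_
  rw [← sq_le_sq₀ (norm_nonneg _) (norm_nonneg _)]
  have h1 : ⟪σ b u, σ b u⟫_ℂ = ⟪amplify K (ρ b) ξ, amplify K (ρ b) η⟫_ℂ := by
    rw [← map_star_inner_right, ← mul_apply_eq_comp (σ (star b)), ← map_mul, h, map_mul, map_mul,
      mul_apply_eq_comp]
    exact map_star_inner_right ((amplify K).comp ρ) b ξ _
  have h2 : ‖σ b u‖ ^ 2 = RCLike.re ⟪amplify K (ρ b) ξ, amplify K (ρ b) η⟫_ℂ := by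
    rw [← h1, @norm_sq_eq_re_inner ℂ]
  set x := amplify K (ρ b) ξ
  set y := amplify K (ρ b) η
  have h3 : ((amplify K).comp ρ) b ((1 / 2 : ℂ) • (ξ + η)) = (1 / 2 : ℂ) • (x + y) := by
    rw [map_smul, map_add]; rfl
  rw [h2, h3, norm_smul, mul_pow, re_inner_eq_norm_add_mul_self_sub_norm_sub_mul_self_div_four]
  norm_num
  nlinarith [sq_nonneg ‖x - y‖]

theorem of_sub_span {s : Set L} (h : ∀ u ∈ s, ∀ w ∈ s, IsUltraweakFor ρ fun b => ⟪u, σ b w⟫_ℂ)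
    {u w : L} (hu : u ∈ Submodule.span ℂ s) (hw : w ∈ Submodule.span ℂ s) :
    IsUltraweakFor ρ fun b => ⟪u, σ b w⟫_ℂ := by
  induction hw using Submodule.span_induction with
  | zero => simpa using zero
  | add x y _ _ hx hy => simpa [inner_add_right] using hx.add hy
  | smul c x _ hx => simpa [inner_smul_right] using hx.const_mul c
  | mem w hw =>
    induction hu using Submodule.span_induction with
    | zero => simpa using zero
    | add x y _ _ hx hy => simpa [inner_add_left] using hx.add hy
    | smul c x _ hx => simpa [inner_smul_left, mul_comm] using hx.const_mul (starRingEnd ℂ c)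
    | mem u hu => exact h u hu w hw

/-- If the matrix coefficients of `σ` at a total set of vectors are ultraweakly continuous, then
so are all of them. -/
theorem of_dense_span {s : Set L} (hs : Dense (Submodule.span ℂ s : Set L))
    (h : ∀ u ∈ s, ∀ w ∈ s, IsUltraweakFor ρ fun b => ⟪u, σ b w⟫_ℂ) (u w : L) :
    IsUltraweakFor ρ fun b => ⟪u, σ b w⟫_ℂ := by
  have key : ∀ v : L, IsUltraweakFor ρ fun b => ⟪v, σ b v⟫_ℂ := by
    intro v
    -- Write `v` as a rapidly convergent series of vectors in the span. Representing vectors for the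
    -- terms, scaled by `√(2 ^ (k + 1))`, are assembled into one vector that dominates `v`.
    obtain ⟨x, hx, hxs, -, hxb⟩ := controlled_sum_of_mem_closure
      (s := (Submodule.span ℂ s).toAddSubgroup) (a := v) (hs v)
      (b := fun n => (1 / 2 : ℝ) ^ n) (fun n => by positivity)
    choose Z hZ using fun k => exists_vector σ (x k) (of_sub_span σ h (hxs k) (hxs k))
    have hnorm : ∀ k b, ‖amplify K (ρ b) (Z k)‖ ^ 2 = ‖σ b (x k)‖ ^ 2 := by
      intro k b
      have h1 := hZ k (star b * b)
      rw [map_mul, map_mul, map_mul, mul_apply_eq_comp, mul_apply_eq_comp,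
        map_star_inner_right, ← StarAlgHom.comp_apply, map_star_inner_right] at h1
      rw [@norm_sq_eq_re_inner ℂ, @norm_sq_eq_re_inner ℂ, h1]
      rfl
    have hsum : Summable fun k => ‖((√(2 ^ (k + 1)) : ℝ) : ℂ) • Z k‖ ^ 2 := by
      have h2 : ∀ k, ‖((√(2 ^ (k + 1)) : ℝ) : ℂ) • Z k‖ ^ 2 = 2 ^ (k + 1) * ‖x k‖ ^ 2 := by
        intro k
        have h3 := hnorm k 1
        simp only [map_one, one_apply_eq_self] at h3
        rw [norm_smul, mul_pow, h3, Complex.norm_real, Real.norm_eq_abs, sq_abs,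
          Real.sq_sqrt (by positivity)]
      simp_rw [h2]
      -- The term with index `0` carries no geometric bound and is dropped.
      rw [← summable_nat_add_iff 1]
      refine Summable.of_nonneg_of_le (fun _ => by positivity) (fun k => ?_)
        ((summable_geometric_of_lt_one (r := (1 / 2 : ℝ)) (by norm_num) (by norm_num)).mul_left 2)
      have h4 := (hxb (k + 1) (by omega)).le
      calc (2 : ℝ) ^ (k + 1 + 1) * ‖x (k + 1)‖ ^ 2
          ≤ 2 ^ (k + 1 + 1) * ((1 / 2 : ℝ) ^ (k + 1)) ^ 2 := by gcongr
        _ = (2 * (1 / 2)) ^ (k + 1 + 1) * (1 / 2) ^ k := by rw [mul_pow]; ring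
        _ ≤ 2 * (1 / 2) ^ k := by
          have : (0 : ℝ) ≤ (1 / 2) ^ k := by positivity
          norm_num at this ⊢
    let W : Ell2 (Ell2 K) := Ell2.mk _ hsum
    obtain ⟨Z', hZ'⟩ := exists_vector_functional_of_dominated ((amplify K).comp ρ) σ
      (Ell2.flatten W) v fun b => by
      rw [← sq_le_sq₀ (norm_nonneg _) (norm_nonneg _)]
      have h5 : ‖((amplify K).comp ρ) b (Ell2.flatten W)‖ ^ 2 =
          ‖amplify (Ell2 K) (amplify K (ρ b)) W‖ ^ 2 := by
        rw [StarAlgHom.comp_apply, Ell2.amplify_flatten, Ell2.norm_flatten]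
      have h6 := (amplify (Ell2 K) (amplify K (ρ b)) W).hasSum_norm_sq
      have h7 : ∀ k, ‖(amplify (Ell2 K) (amplify K (ρ b)) W : ∀ _, Ell2 K) k‖ ^ 2 =
          2 ^ (k + 1) * ‖σ b (x k)‖ ^ 2 := by
        intro k
        rw [amplify_apply, Ell2.mk_apply, map_smul, norm_smul, mul_pow, hnorm, Complex.norm_real,
          Real.norm_eq_abs, sq_abs, Real.sq_sqrt (by positivity)]
      simp_rw [h7] at h6
      rw [h5]
      have h8 : Tendsto (fun n => ‖∑ k ∈ Finset.range (n + 1), σ b (x k)‖ ^ 2) atTop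
          (𝓝 (‖σ b v‖ ^ 2)) := by
        simp_rw [← map_sum]
        exact ((((σ b).continuous.tendsto v).comp hx).norm).pow 2
      refine le_of_tendsto_of_tendsto' h8 (h6.tendsto_sum_nat.comp (tendsto_add_atTop_nat 1)) fun n => ?_
      exact norm_sum_range_sq_le (n + 1) fun k => σ b (x k)
    exact ⟨Z', Z', hZ'⟩
  -- Polarization reduces arbitrary coefficients to diagonal ones.
  have hpol : ∀ b, ⟪u, σ b w⟫_ℂ = (1 / 4 : ℂ) * (⟪u + w, σ b (u + w)⟫_ℂ
      - ⟪u - w, σ b (u - w)⟫_ℂ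
      - Complex.I * ⟪u + Complex.I • w, σ b (u + Complex.I • w)⟫_ℂ
      + Complex.I * ⟪u - Complex.I • w, σ b (u - Complex.I • w)⟫_ℂ) := by
    intro b
    simp only [map_add, map_sub, map_smul, inner_add_left, inner_add_right, inner_sub_left,
      inner_sub_right, inner_smul_left, inner_smul_right, Complex.conj_I]
    ring_nf
    simp only [Complex.I_sq]
    ring
  simp_rw [hpol]
  exact ((((key _).sub (key _)).sub ((key _).const_mul _)).add ((key _).const_mul _)).const_mul _

end IsUltraweakFor

end UltraweakFunctional

/-! ### Normal maps -/

section Normal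

variable {H : Type u} [NormedAddCommGroup H] [InnerProductSpace ℂ H] [CompleteSpace H]

/-- The inclusion of a von Neumann algebra in `B(H)`. -/
def VonNeumannAlgebra.incl (A : VonNeumannAlgebra H) : A →⋆ₐ[ℂ] (H →L[ℂ] H) where
  toFun := Subtype.val
  map_one' := rfl
  map_mul' _ _ := rfl
  map_zero' := rfl
  map_add' _ _ := rfl
  commutes' _ := rfl
  map_star' _ := rfl

@[simp] theorem VonNeumannAlgebra.incl_apply (A : VonNeumannAlgebra H) (x : A) :
    A.incl x = (x : H →L[ℂ] H) := rfl

theorem isUltraweaklyContinuous_iff (A : VonNeumannAlgebra H) (f : A →ₗ[ℂ] ℂ) :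
    IsUltraweaklyContinuous A f ↔ IsUltraweakFor A.incl f := by
  constructor
  · rintro ⟨ξ, η, hξ, hη, h⟩
    exact ⟨Ell2.mk ξ hξ, Ell2.mk η hη, fun b => by rw [h, inner_amplify]; rfl⟩
  · rintro ⟨ξ, η, h⟩
    exact ⟨ξ, η, ξ.hasSum_norm_sq.summable, η.hasSum_norm_sq.summable,
      fun b => by rw [h, inner_amplify]; rfl⟩

theorem IsNormalMap.isUltraweakFor_comp {A : VonNeumannAlgebra H} {τ : Module.End ℂ A}
    (hτ : IsNormalMap A τ) (x y : H) :
    IsUltraweakFor A.incl fun a => ⟪x, (τ a : H →L[ℂ] H) y⟫_ℂ := by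
  let f : A →ₗ[ℂ] ℂ := (innerSL ℂ x).toLinearMap ∘ₗ
    (ContinuousLinearMap.apply ℂ H y).toLinearMap ∘ₗ A.incl.toAlgHom.toLinearMap
  have := hτ f ((isUltraweaklyContinuous_iff A f).2 (IsUltraweakFor.inner x y))
  exact (isUltraweaklyContinuous_iff A _).1 this

/-- A unital `*`-endomorphism is normal if its matrix coefficients at a total set of vectors are
ultraweakly continuous. -/
theorem isNormalMap_of_dense_span (B : VonNeumannAlgebra H) (θ : B →⋆ₐ[ℂ] B) {s : Set H}
    (hs : Dense (Submodule.span ℂ s : Set H))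
    (h : ∀ u ∈ s, ∀ w ∈ s, IsUltraweakFor B.incl fun b => ⟪u, (θ b : H →L[ℂ] H) w⟫_ℂ) :
    IsNormalMap B (θ : B →ₗ[ℂ] B) := by
  -- A general ultraweakly continuous functional is a single matrix coefficient of the
  -- amplification, so the density argument is applied to the amplified representation.
  let t : Set (Ell2 H) := {x | ∃ i, ∃ u ∈ s, x = lp.single 2 i u}
  have ht : Dense (Submodule.span ℂ t : Set (Ell2 H)) := by
    have h1 : ∀ i (u : H), (lp.single 2 i u : Ell2 H) ∈ (Submodule.span ℂ t).topologicalClosure := by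
      intro i
      let E := lp.singleContinuousLinearMap ℂ (fun _ : ℕ => H) 2 i
      have h2 : (Submodule.span ℂ s).topologicalClosure ≤
          (Submodule.span ℂ t).topologicalClosure.comap E.toLinearMap := by
        refine Submodule.topologicalClosure_minimal _ (Submodule.span_le.2 fun u hu => ?_)
          ((Submodule.isClosed_topologicalClosure _).preimage E.continuous)
        exact Submodule.le_topologicalClosure _ (Submodule.subset_span ⟨i, u, hu, rfl⟩)
      intro u
      exact h2 (hs u)
    intro x
    have h3 := lp.hasSum_single (p := 2) (by simp) x
    have h4 : x ∈ (Submodule.span ℂ t).topologicalClosure :=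
      (Submodule.isClosed_topologicalClosure (Submodule.span ℂ t)).mem_of_tendsto h3
        (Eventually.of_forall fun F => Submodule.sum_mem _ fun i _ => h1 i _)
    exact h4
  intro f hf
  rw [isUltraweaklyContinuous_iff] at hf ⊢
  obtain ⟨ξ, η, hf⟩ := hf
  have := IsUltraweakFor.of_dense_span (ρ := B.incl) (((amplify H).comp B.incl).comp θ) ht (by
    rintro _ ⟨i, u, hu, rfl⟩ _ ⟨j, w, hw, rfl⟩
    have h1 : ∀ b, ⟪(lp.single 2 i u : Ell2 H), (((amplify H).comp B.incl).comp θ) b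
        (lp.single 2 j w)⟫_ℂ = if j = i then ⟪u, (θ b : H →L[ℂ] H) w⟫_ℂ else 0 := by
      intro b
      rw [lp.inner_single_left]
      by_cases hij : j = i
      · subst hij
        simp
      · simp [hij, Ne.symm hij]
    simp_rw [h1]
    by_cases hij : j = i
    · simpa [hij] using h u hu w hw
    · simpa [hij] using IsUltraweakFor.zero) ξ η
  obtain ⟨ξ', η', h2⟩ := this
  exact ⟨ξ', η', fun b => (hf _).trans (h2 b)⟩

end Normal

/-! ### Positive operator matrices -/

section VectorPositive

variable {H : Type*} [NormedAddCommGroup H] [InnerProductSpace ℂ H]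

/-- A finite matrix of operators is positive as an operator on the direct sum. -/
def IsVectorPositive {ι : Type*} [Fintype ι] (M : ι → ι → (H →L[ℂ] H)) : Prop :=
  ∀ h : ι → H, 0 ≤ ∑ i, ∑ j, ⟪h i, M i j (h j)⟫_ℂ

/-- A matrix of operators, as an operator on the direct sum. -/
def matrixOp {n : ℕ} (M : Fin n → Fin n → (H →L[ℂ] H)) :
    PiLp 2 (fun _ : Fin n => H) →L[ℂ] PiLp 2 (fun _ : Fin n => H) :=
  (PiLp.continuousLinearEquiv 2 ℂ (fun _ : Fin n => H)).symm.toContinuousLinearMap ∘L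
    ContinuousLinearMap.pi fun i => ∑ j, M i j ∘L PiLp.proj 2 (fun _ : Fin n => H) j

@[simp] theorem matrixOp_apply {n : ℕ} (M : Fin n → Fin n → (H →L[ℂ] H))
    (x : PiLp 2 (fun _ : Fin n => H)) (i : Fin n) : matrixOp M x i = ∑ j, M i j (x j) := by
  simp [matrixOp]

theorem inner_matrixOp {n : ℕ} (M : Fin n → Fin n → (H →L[ℂ] H))
    (x y : PiLp 2 (fun _ : Fin n => H)) :
    ⟪x, matrixOp M y⟫_ℂ = ∑ i, ∑ j, ⟪x i, M i j (y j)⟫_ℂ := by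
  simp [PiLp.inner_apply, inner_sum]

theorem isVectorPositive_iff_matrixOp_nonneg {n : ℕ} (M : Fin n → Fin n → (H →L[ℂ] H)) :
    IsVectorPositive M ↔ 0 ≤ matrixOp M := by
  rw [ContinuousLinearMap.nonneg_iff_isPositive, ContinuousLinearMap.isPositive_iff_complex]
  constructor
  · intro h x
    have h1 : 0 ≤ ⟪x, matrixOp M x⟫_ℂ := by
      rw [inner_matrixOp]
      exact h fun i => x i
    rw [← inner_conj_symm] at h1
    have h2 := RCLike.nonneg_iff.1 h1
    simp only [RCLike.conj_re, RCLike.conj_im, neg_eq_zero] at h2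
    refine ⟨?_, h2.1⟩
    exact RCLike.conj_eq_iff_re.1 (RCLike.conj_eq_iff_im.2 h2.2)
  · intro h x
    obtain ⟨h1, h2⟩ := h (WithLp.toLp 2 x)
    have h3 := inner_matrixOp M (WithLp.toLp 2 x) (WithLp.toLp 2 x)
    simp only at h3
    rw [← h3, ← inner_conj_symm, ← h1]
    simpa using h2

end VectorPositive

/-! ### Complete positivity in terms of vectors -/

section CompletelyPositive

variable {H : Type u} [NormedAddCommGroup H] [InnerProductSpace ℂ H] [CompleteSpace H]

/-- The action of matrices over a von Neumann algebra on a direct sum of copies of `H`. -/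
def matrixRep (A : VonNeumannAlgebra H) (n : ℕ) :
    CStarMatrix (Fin n) (Fin n) A →⋆ₐ[ℂ]
      (PiLp 2 (fun _ : Fin n => H) →L[ℂ] PiLp 2 (fun _ : Fin n => H)) where
  toFun M := matrixOp fun i j => A.incl (M i j)
  map_one' := by
    ext x i
    simp only [CStarMatrix.one_apply, apply_ite A.incl]
    rw [matrixOp_apply, Finset.sum_eq_single i (fun j _ hj => by simp [hj.symm]) (by simp)]
    simp
  map_mul' M N := by
    ext x i
    simp only [CStarMatrix.mul_apply, map_sum, matrixOp_apply, map_mul, mul_apply_eq_comp,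
      sum_apply]
    exact Finset.sum_comm
  map_zero' := by ext; simp
  map_add' M N := by
    ext x i
    simp [Finset.sum_add_distrib]
  commutes' c := by
    ext x i
    simp only [CStarMatrix.algebraMap_apply, apply_ite A.incl]
    rw [matrixOp_apply, Finset.sum_eq_single i (fun j _ hj => by simp [hj.symm]) (by simp)]
    simp
  map_star' M := by
    rw [ContinuousLinearMap.star_eq_adjoint, ContinuousLinearMap.eq_adjoint_iff]
    intro x y
    rw [inner_matrixOp, ← inner_conj_symm, inner_matrixOp, map_sum, Finset.sum_comm]
    simp only [map_sum]
    refine Finset.sum_congr rfl fun i _ => ?_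
    refine Finset.sum_congr rfl fun j _ => ?_
    rw [CStarMatrix.star_apply, inner_conj_symm, map_star_inner_left]

theorem matrixRep_injective (A : VonNeumannAlgebra H) (n : ℕ) :
    Function.Injective (matrixRep A n) := by
  intro M N h
  ext i j x
  have h1 := congrArg (fun T => T (WithLp.toLp 2 (Pi.single j x)) i) h
  simpa [matrixRep, Pi.single_apply, apply_ite] using h1

/-- An injective `*`-homomorphism of C⋆-algebras preserves spectra, and positivity of a self-adjoint
element can be read off its spectrum. -/
theorem nonneg_of_map_nonneg {R S : Type*} [CStarAlgebra R] [PartialOrder R] [StarOrderedRing R]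
    [CStarAlgebra S] [PartialOrder S] [StarOrderedRing S] (φ : R →⋆ₐ[ℂ] S)
    (hφ : Function.Injective φ) {a : R} (h : 0 ≤ φ a) : 0 ≤ a := by
  have hsa : IsSelfAdjoint a := hφ (by rw [map_star]; exact (IsSelfAdjoint.of_nonneg h).star_eq)
  rw [StarOrderedRing.nonneg_iff_spectrum_nonneg (R := ℝ) a hsa]
  rw [StarOrderedRing.nonneg_iff_spectrum_nonneg (R := ℝ) _ (IsSelfAdjoint.of_nonneg h),
    hsa.map_spectrum_real φ hφ] at h
  exact h

/-- The matrix algebra acts faithfully on the direct sum of copies of `H`, so the abstract order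
that defines complete positivity is the operator order there. -/
theorem isVectorPositive_iff_nonneg (A : VonNeumannAlgebra H) (n : ℕ)
    (M : CStarMatrix (Fin n) (Fin n) A) :
    IsVectorPositive (fun i j => A.incl (M i j)) ↔ 0 ≤ M := by
  rw [isVectorPositive_iff_matrixOp_nonneg]
  change 0 ≤ matrixRep A n M ↔ _
  exact ⟨nonneg_of_map_nonneg _ (matrixRep_injective A n), map_nonneg (matrixRep A n)⟩

/-- Complete positivity, in terms of matrices that are positive operators. -/
def IsVectorCP (A : VonNeumannAlgebra H) (T : Module.End ℂ A) : Prop :=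
  ∀ (n : ℕ) (M : Fin n → Fin n → A), IsVectorPositive (fun i j => A.incl (M i j)) →
    IsVectorPositive (fun i j => A.incl (T (M i j)))

theorem CompletelyPositiveMap.isVectorCP {A : VonNeumannAlgebra H} (τ : A →CP A) :
    IsVectorCP A τ.toLinearMap := by
  intro n M hM
  have h1 := (isVectorPositive_iff_nonneg A n (CStarMatrix.ofMatrix M)).1 hM
  exact (isVectorPositive_iff_nonneg A n _).2 (τ.map_cstarMatrix_nonneg' n _ h1)

namespace IsVectorCP

variable {A : VonNeumannAlgebra H} {T : Module.End ℂ A}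

theorem pow (hT : IsVectorCP A T) (k : ℕ) : IsVectorCP A (T ^ k) := by
  induction k with
  | zero => exact fun n M h => h
  | succ k ih =>
    intro n M h
    rw [pow_succ']
    exact hT n _ (ih n M h)

theorem map_isVectorPositive (hT : IsVectorCP A T) {ι : Type*} [Fintype ι] (M : ι → ι → A)
    (h : IsVectorPositive (fun i j => A.incl (M i j))) :
    IsVectorPositive (fun i j => A.incl (T (M i j))) := by
  let e := (Fintype.equivFin ι).symm
  have reindex : ∀ f : ι → ι → ℂ, ∑ i, ∑ j, f (e i) (e j) = ∑ i, ∑ j, f i j := fun f => by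
    rw [← e.sum_comp]
    exact Finset.sum_congr rfl fun i _ => e.sum_comp (f (e i))
  intro x
  rw [← reindex]
  refine hT _ (fun i j => M (e i) (e j)) (fun y => ?_) (fun i => x (e i))
  have := h (fun i => y (e.symm i))
  rw [← reindex] at this
  simpa using this

end IsVectorCP

theorem IsNormalMap.pow {A : VonNeumannAlgebra H} {T : Module.End ℂ A} (hT : IsNormalMap A T)
    (k : ℕ) : IsNormalMap A (T ^ k) := by
  induction k with
  | zero => exact fun f hf => hf
  | succ k ih =>
    intro f hf
    have := hT _ (ih f hf)
    rwa [LinearMap.comp_assoc, ← Module.End.mul_eq_comp, ← pow_succ] at this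

end CompletelyPositive

/-! ### Operator-valued positive kernels -/

section KernelForm

variable {H : Type*} [NormedAddCommGroup H] [InnerProductSpace ℂ H]
  {I J I' J' : Type*}

/-- The sesquilinear form on finitely supported `H`-valued functions defined by a kernel. -/
def kernelForm (c : I → J → (H →L[ℂ] H)) : (I →₀ H) →ₗ⋆[ℂ] (J →₀ H) →ₗ[ℂ] ℂ :=
  LinearMap.mk₂'ₛₗ (starRingEnd ℂ) (RingHom.id ℂ)
    (fun g f => g.sum fun v x => f.sum fun w y => ⟪x, c v w y⟫_ℂ)
    (fun g g' f => Finsupp.sum_add_index' (by simp)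
      (by simp [Finsupp.sum_add]))
    (fun a g f => by
      rw [Finsupp.sum_smul_index' (by simp)]
      simp only [inner_smul_left, Finsupp.sum, Finset.mul_sum, smul_eq_mul])
    (fun g f f' => by
      simp_rw [← Finsupp.sum_add]
      refine Finsupp.sum_congr fun v _ => ?_
      exact Finsupp.sum_add_index' (by simp) (by simp))
    (fun a g f => by
      simp only [RingHom.id_apply, smul_eq_mul]
      rw [Finsupp.sum, Finsupp.sum, Finset.mul_sum]
      refine Finset.sum_congr rfl fun v _ => ?_
      rw [Finsupp.sum_smul_index' (by simp), Finsupp.sum, Finsupp.sum, Finset.mul_sum]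
      simp)

theorem kernelForm_apply (c : I → J → (H →L[ℂ] H)) (g : I →₀ H) (f : J →₀ H) :
    kernelForm c g f = g.sum fun v x => f.sum fun w y => ⟪x, c v w y⟫_ℂ := rfl

@[simp] theorem kernelForm_single (c : I → J → (H →L[ℂ] H)) (i : I) (j : J) (x y : H) :
    kernelForm c (Finsupp.single i x) (Finsupp.single j y) = ⟪x, c i j y⟫_ℂ := by
  simp [kernelForm_apply]

theorem kernelForm_mapDomain (c : I' → J' → (H →L[ℂ] H)) (r : I → I') (r' : J → J')
    (g : I →₀ H) (f : J →₀ H) :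
    kernelForm c (g.mapDomain r) (f.mapDomain r') = kernelForm (fun v w => c (r v) (r' w)) g f := by
  simp only [kernelForm_apply]
  rw [Finsupp.sum_mapDomain_index (by simp) (by simp [Finsupp.sum_add])]
  refine Finsupp.sum_congr fun v _ => ?_
  rw [Finsupp.sum_mapDomain_index (by simp) (by simp)]

/-- A kernel with operator values is positive. -/
def IsKernelPositive (c : I → I → (H →L[ℂ] H)) : Prop :=
  ∀ h : I →₀ H, 0 ≤ kernelForm c h h

/-- Positivity forces real diagonal values; applied to `g + f` and `g + i f`, this gives hermitian
symmetry. -/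
theorem IsKernelPositive.kernelForm_conj {c : I → I → (H →L[ℂ] H)} (hc : IsKernelPositive c)
    (g f : I →₀ H) : starRingEnd ℂ (kernelForm c g f) = kernelForm c f g := by
  have him : ∀ h : I →₀ H, (kernelForm c h h).im = 0 := fun h => (Complex.nonneg_iff.1 (hc h)).2.symm
  have h1 := him (g + f)
  have h2 := him (g + Complex.I • f)
  have h3 := him g
  have h4 := him f
  simp only [map_add, LinearMap.add_apply, map_smul, LinearMap.map_smulₛₗ, LinearMap.smul_apply,
    Complex.conj_I, smul_eq_mul, Complex.add_im, Complex.mul_im, Complex.I_re, Complex.I_im,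
    Complex.neg_re, Complex.neg_im, Complex.add_re, Complex.mul_re] at h1 h2
  apply Complex.ext
  · simp only [Complex.conj_re]
    linarith
  · simp only [Complex.conj_im]
    linarith

variable {K : Type*} [NormedAddCommGroup K] [InnerProductSpace ℂ K]

/-- The vector `∑ᵢ Zᵢ hᵢ`. -/
def kernelVec (Z : I → (H →L[ℂ] K)) : (I →₀ H) →ₗ[ℂ] K :=
  Finsupp.lsum ℂ fun i => (Z i).toLinearMap

theorem kernelVec_apply (Z : I → (H →L[ℂ] K)) (h : I →₀ H) :
    kernelVec Z h = h.sum fun i x => Z i x := rfl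

@[simp] theorem kernelVec_single (Z : I → (H →L[ℂ] K)) (i : I) (x : H) :
    kernelVec Z (Finsupp.single i x) = Z i x := by
  simp [kernelVec_apply]

/-- A block `2 × 2` kernel. -/
def blockKernel {E : Type*} (p b b' q : I → I → E) : I ⊕ I → I ⊕ I → E
  | .inl i, .inl j => p i j
  | .inl i, .inr j => b i j
  | .inr i, .inl j => b' i j
  | .inr i, .inr j => q i j

theorem kernelForm_block (p b b' q : I → I → (H →L[ℂ] H)) (g f : I →₀ H) :
    kernelForm (blockKernel p b b' q) (g.mapDomain .inl + f.mapDomain .inr)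
      (g.mapDomain .inl + f.mapDomain .inr) =
    kernelForm p g g + kernelForm b g f + (kernelForm b' f g + kernelForm q f f) := by
  simp only [map_add, LinearMap.add_apply, kernelForm_mapDomain, blockKernel]
  abel

variable [CompleteSpace H] [CompleteSpace K]

theorem kernelForm_adjoint_comp (Z : I → (H →L[ℂ] K)) (Y : J → (H →L[ℂ] K)) (b : K →L[ℂ] K)
    (g : I →₀ H) (f : J →₀ H) :
    kernelForm (fun i j => adjoint (Z i) ∘L b ∘L Y j) g f = ⟪kernelVec Z g, b (kernelVec Y f)⟫_ℂ := by
  simp only [kernelForm_apply, kernelVec_apply, map_finsuppSum, Finsupp.sum_inner, Finsupp.inner_sum,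
    ContinuousLinearMap.comp_apply, ContinuousLinearMap.adjoint_inner_right]
  exact Finsupp.sum_comm _ _ _

theorem IsKernelPositive.star_apply {c : I → I → (H →L[ℂ] H)} (hc : IsKernelPositive c)
    (i j : I) : star (c i j) = c j i := by
  ext x
  refine ext_inner_left ℂ fun y => ?_
  have := hc.kernelForm_conj (Finsupp.single i x) (Finsupp.single j y)
  simp only [kernelForm_single] at this
  rw [← this, inner_conj_symm, ContinuousLinearMap.star_eq_adjoint,
    ContinuousLinearMap.adjoint_inner_right]

/-- The new form at `h` is the old form at the function obtained by sending the mass `h i` to `a i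
(h i)` at the point `r i`. -/
theorem IsKernelPositive.comap {c : J → J → (H →L[ℂ] H)} (hc : IsKernelPositive c)
    (r : I → J) (a : I → (H →L[ℂ] H)) :
    IsKernelPositive fun i j => star (a i) * c (r i) (r j) * a j := by
  intro h
  let P : (I →₀ H) →ₗ[ℂ] (J →₀ H) :=
    Finsupp.lsum ℂ fun i => Finsupp.lsingle (r i) ∘ₗ (a i).toLinearMap
  have hP : P h = h.sum fun i x => Finsupp.single (r i) (a i x) := rfl
  have key : kernelForm (fun i j => star (a i) * c (r i) (r j) * a j) h h =
      kernelForm c (P h) (P h) := by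
    simp only [hP, Finsupp.sum, LinearMap.sum_apply, map_sum, kernelForm_single]
    rw [kernelForm_apply, Finset.sum_comm]
    simp [ContinuousLinearMap.star_eq_adjoint, ContinuousLinearMap.adjoint_inner_right, Finsupp.sum]
  rw [key]
  exact hc _

/-- The kernel of a positive `2 × 2` operator matrix is positive. -/
theorem isKernelPositive_block (Z : I → (H →L[ℂ] K)) (p b b' q : K →L[ℂ] K)
    (hpos : ∀ U W, 0 ≤ ⟪U, p U⟫_ℂ + ⟪U, b W⟫_ℂ + (⟪W, b' U⟫_ℂ + ⟪W, q W⟫_ℂ)) :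
    IsKernelPositive (blockKernel (fun i j => adjoint (Z i) ∘L p ∘L Z j)
      (fun i j => adjoint (Z i) ∘L b ∘L Z j) (fun i j => adjoint (Z i) ∘L b' ∘L Z j)
      (fun i j => adjoint (Z i) ∘L q ∘L Z j)) := by
  intro h
  obtain ⟨g, f, rfl⟩ : ∃ g f : I →₀ H, h = g.mapDomain .inl + f.mapDomain .inr := by
    induction h using Finsupp.induction_linear with
    | zero => exact ⟨0, 0, by simp⟩
    | add h h' ih ih' =>
      obtain ⟨g, f, rfl⟩ := ih
      obtain ⟨g', f', rfl⟩ := ih'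
      exact ⟨g + g', f + f', by simp only [Finsupp.mapDomain_add]; abel⟩
    | single i x =>
      rcases i with i | i
      · exact ⟨Finsupp.single i x, 0, by simp⟩
      · exact ⟨0, Finsupp.single i x, by simp⟩
  rw [kernelForm_block]
  simp only [kernelForm_adjoint_comp]
  exact hpos _ _

/-- This puts an arbitrary operator in the corner of a positive `2 × 2` matrix. Completely positive
maps preserve that positivity, which then yields compatibility with adjoints and norm bounds. -/
theorem block_norm_nonneg (b : K →L[ℂ] K) (U W : K) :
    0 ≤ ⟪U, ((‖b‖ : ℂ) • (1 : K →L[ℂ] K)) U⟫_ℂ + ⟪U, b W⟫_ℂ +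
      (⟪W, (star b) U⟫_ℂ + ⟪W, ((‖b‖ : ℂ) • (1 : K →L[ℂ] K)) W⟫_ℂ) := by
  have h1 : ⟪W, (star b) U⟫_ℂ = starRingEnd ℂ ⟪U, b W⟫_ℂ := by
    rw [ContinuousLinearMap.star_eq_adjoint, ContinuousLinearMap.adjoint_inner_right,
      inner_conj_symm]
  have h2 : ‖⟪U, b W⟫_ℂ‖ ≤ ‖U‖ * (‖b‖ * ‖W‖) :=
    (norm_inner_le_norm _ _).trans (by gcongr; exact b.le_opNorm W)
  have h3 := Complex.abs_re_le_norm ⟪U, b W⟫_ℂ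
  have h4 := (abs_le.1 h3).1
  have hU : ⟪U, U⟫_ℂ = ((‖U‖ ^ 2 : ℝ) : ℂ) := by simp
  have hW : ⟪W, W⟫_ℂ = ((‖W‖ ^ 2 : ℝ) : ℂ) := by simp
  simp only [smul_apply, one_apply_eq_self, inner_smul_right, h1, hU, hW]
  rw [Complex.nonneg_iff]
  constructor
  · simp only [Complex.add_re, Complex.re_ofReal_mul, Complex.ofReal_re, Complex.conj_re]
    nlinarith [mul_nonneg (norm_nonneg b) (sq_nonneg (‖U‖ - ‖W‖))]
  · simp only [Complex.add_im, Complex.im_ofReal_mul, Complex.ofReal_im, Complex.conj_im]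
    ring

/-- A sesquilinear form bounded in the norm of `K` is given by an operator. -/
theorem exists_operator_of_form {F : Type*} [AddCommGroup F] [Module ℂ F] (e : F →ₗ[ℂ] K)
    (he : DenseRange e) (φ : F →ₗ⋆[ℂ] F →ₗ[ℂ] ℂ) {C : ℝ} (hC : 0 ≤ C)
    (h : ∀ g f, 0 ≤ C * ‖e g‖ ^ 2 + 2 * (φ g f).re + C * ‖e f‖ ^ 2) :
    ∃ T : K →L[ℂ] K, ∀ g f, ⟪e g, T (e f)⟫_ℂ = φ g f := by
  have hreal : ∀ x a b : ℝ, 0 ≤ a → 0 ≤ b → (∀ t : ℝ, 0 < t → 2 * x ≤ t * a ^ 2 + t⁻¹ * b ^ 2) →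
      x ≤ a * b := by
    intro x a b ha hb hx
    have h1 : ∀ ε : ℝ, 0 < ε → x ≤ a * b + ε * (a + b) / 2 := by
      intro ε hε
      -- The optimal parameter is `b / a`; adding `ε` avoids the cases where `a` or `b` is zero.
      have h2 := hx ((b + ε) / (a + ε)) (by positivity)
      have h3 : (b + ε) / (a + ε) * a ^ 2 ≤ (b + ε) * a := by
        rw [div_mul_eq_mul_div, div_le_iff₀ (by positivity)]
        nlinarith [mul_nonneg ha hε.le, mul_nonneg (mul_nonneg ha hε.le) (add_nonneg hb hε.le)]
      have h4 : ((b + ε) / (a + ε))⁻¹ * b ^ 2 ≤ (a + ε) * b := by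
        rw [inv_div, div_mul_eq_mul_div, div_le_iff₀ (by positivity)]
        nlinarith [mul_nonneg hb hε.le, mul_nonneg (mul_nonneg hb hε.le) (add_nonneg ha hε.le)]
      nlinarith
    have h5 : Tendsto (fun ε : ℝ => a * b + ε * (a + b) / 2) (𝓝[>] 0) (𝓝 (a * b)) := by
      have : Continuous fun ε : ℝ => a * b + ε * (a + b) / 2 := by fun_prop
      simpa using (this.tendsto 0).mono_left nhdsWithin_le_nhds
    exact ge_of_tendsto h5 (by filter_upwards [self_mem_nhdsWithin] with ε hε using h1 ε hε)
  have hbd : ∀ g f, ‖φ g f‖ ≤ C * ‖e g‖ * ‖e f‖ := by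
    intro g f
    rcases eq_or_ne (φ g f) 0 with hz | hz
    · rw [hz, norm_zero]
      positivity
    have h1 := hreal ‖φ g f‖ (√C * ‖e g‖) (√C * ‖e f‖) (by positivity) (by positivity) fun t ht => by
      set z := φ g f
      have hz' : (‖z‖ : ℂ) ≠ 0 := by simpa using hz
      have hzz : starRingEnd ℂ z * z = (‖z‖ : ℂ) ^ 2 := by
        rw [mul_comm, Complex.mul_conj, Complex.normSq_eq_norm_sq]
        push_cast
        rfl
      -- The phase turns `φ g f` into `-‖φ g f‖`, and the factors `√t` and its inverse rescale the
      -- two norms while cancelling in the form.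
      have h2 := h ((√t : ℂ) • g) ((-(√t : ℂ)⁻¹ * (starRingEnd ℂ z / ‖z‖)) • f)
      have ht' : (√t : ℂ) ≠ 0 := by
        simpa using (Real.sqrt_pos.2 ht).ne'
      have h3 : φ ((√t : ℂ) • g) ((-(√t : ℂ)⁻¹ * (starRingEnd ℂ z / ‖z‖)) • f) = -(‖z‖ : ℂ) := by
        simp only [LinearMap.map_smulₛₗ, LinearMap.smul_apply, Complex.conj_ofReal, smul_eq_mul,
          RingHom.id_apply]
        change -(√t : ℂ)⁻¹ * (starRingEnd ℂ z / ‖z‖) * ((√t : ℂ) * z) = _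
        field_simp
        rw [hzz]
      have h4 : ‖-(√t : ℂ)⁻¹ * (starRingEnd ℂ z / ‖z‖)‖ ^ 2 = t⁻¹ := by
        have : ‖z‖ ≠ 0 := by simpa using hz
        simp [this, Real.sq_sqrt ht.le]
      rw [h3] at h2
      simp only [map_smul, norm_smul, mul_pow, h4, Complex.norm_real, Real.norm_eq_abs, sq_abs,
        Real.sq_sqrt ht.le, Complex.neg_re, Complex.ofReal_re] at h2
      simp only [mul_pow, Real.sq_sqrt hC]
      linarith
    calc ‖φ g f‖ ≤ √C * ‖e g‖ * (√C * ‖e f‖) := h1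
      _ = (√C * √C) * ‖e g‖ * ‖e f‖ := by ring
      _ = C * ‖e g‖ * ‖e f‖ := by rw [Real.mul_self_sqrt hC]
  have hr : ∀ g, ∃ r : K, (∀ f, ⟪r, e f⟫_ℂ = φ g f) ∧ ‖r‖ ≤ C * ‖e g‖ := by
    intro g
    let Φ : K →L[ℂ] ℂ := (φ g).extendOfNorm e
    refine ⟨(InnerProductSpace.toDual ℂ K).symm Φ, fun f => ?_, ?_⟩
    · rw [InnerProductSpace.toDual_symm_apply]
      exact LinearMap.extendOfNorm_eq he ⟨C * ‖e g‖, hbd g⟩ f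
    · rw [LinearIsometryEquiv.norm_map]
      exact LinearMap.opNorm_extendOfNorm_le he (by positivity) (hbd g)
  choose r hr hrn using hr
  let r' : F →ₗ[ℂ] K :=
    { toFun := r
      map_add' := fun g g' => he.eq_of_inner_left ℂ fun f => by
        rw [inner_add_left, hr, hr, hr, map_add, LinearMap.add_apply]
      map_smul' := fun a g => he.eq_of_inner_left ℂ fun f => by
        rw [RingHom.id_apply, inner_smul_left, hr, hr, LinearMap.map_smulₛₗ]
        rfl }
  refine ⟨adjoint (r'.extendOfNorm e), fun g f => ?_⟩
  rw [ContinuousLinearMap.adjoint_inner_right, LinearMap.extendOfNorm_eq he ⟨C, hrn⟩]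
  exact hr g f

end KernelForm

/-! ### The Gram kernel of a minimal dilation -/

section DilationKernel

variable {H : Type u} [NormedAddCommGroup H] [InnerProductSpace ℂ H] [CompleteSpace H]
  {A : VonNeumannAlgebra H} {τ : Module.End ℂ A}

/-- Only the finite submatrix on the support of a test function matters. -/
theorem IsVectorCP.map_isKernelPositive (hτ : IsVectorCP A τ) {I : Type*} {M : I → I → A}
    (hM : IsKernelPositive fun i j => A.incl (M i j)) :
    IsKernelPositive fun i j => A.incl (τ (M i j)) := by
  classical
  intro h
  have key : ∀ c : I → I → (H →L[ℂ] H), kernelForm c h h =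
      ∑ i : h.support, ∑ j : h.support, ⟪h i, c i j (h j)⟫_ℂ := by
    intro c
    rw [kernelForm_apply, Finsupp.sum, ← Finset.sum_coe_sort]
    exact Finset.sum_congr rfl fun i _ => by rw [Finsupp.sum, ← Finset.sum_coe_sort]
  rw [key]
  refine hτ.map_isVectorPositive (ι := h.support) (fun i j => M i j) (fun x => ?_) fun i => h i
  have := hM (Finsupp.onFinset h.support (fun i => if hi : i ∈ h.support then x ⟨i, hi⟩ else 0)
    (fun i hi => by by_contra h0; simp [h0] at hi))
  rw [kernelForm_apply, Finsupp.onFinset_sum _ (by simp), ← Finset.sum_coe_sort] at this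
  convert this using 2 with i
  rw [Finsupp.onFinset_sum _ (by simp),
    ← Finset.sum_coe_sort h.support fun a => ⟪if hi : (i : I) ∈ h.support then x ⟨i, hi⟩ else 0,
      A.incl (M i a) (if hi : a ∈ h.support then x ⟨a, hi⟩ else 0)⟫_ℂ]
  refine Finset.sum_congr rfl fun j _ => ?_
  simp only [i.2, j.2, dif_pos, Subtype.coe_eta]

/-- Both `a` and `star a` are off-diagonal entries of a positive block matrix; its image under `τ`
is positive, hence hermitian. -/
theorem IsVectorCP.apply_star (hτ : IsVectorCP A τ) (a : A) : τ (star a) = star (τ a) := by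
  have h1 := isKernelPositive_block (I := Unit) (fun _ => (1 : H →L[ℂ] H))
    ((‖A.incl a‖ : ℂ) • 1) (A.incl a) (star (A.incl a)) ((‖A.incl a‖ : ℂ) • 1)
    (block_norm_nonneg _)
  have h2 : IsKernelPositive (fun i j => A.incl (blockKernel (I := Unit)
      (fun _ _ => (‖A.incl a‖ : ℂ) • (1 : A)) (fun _ _ => a) (fun _ _ => star a)
      (fun _ _ => (‖A.incl a‖ : ℂ) • (1 : A)) i j)) := by
    convert h1 using 3 with i j
    rcases i with i | i <;> rcases j with j | j <;>
      simp only [blockKernel, ← ContinuousLinearMap.star_eq_adjoint, star_one, map_smul, map_one,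
        map_star] <;> rfl
  have h3 := (hτ.map_isKernelPositive h2).star_apply (.inl ()) (.inr ())
  rw [← map_star] at h3
  exact (Subtype.ext h3).symm

variable (τ) in
/-- The kernel `(v, w) ↦ v₀* τ(v₁* τ(v₂* ⋯ w₂) w₁) w₀` with `N` nested applications of `τ`, where
lists are continued by `1`. -/
def iterKernel : ℕ → List A → List A → A
  | 0 => fun _ _ => 1
  | N + 1 => fun v w => star (v.headD 1) * τ (iterKernel N v.tail w.tail) * w.headD 1

variable (τ) in
/-- The kernel `⟪θⁿ(vₙ) ⋯ θ(v₁) v₀ h, θᵐ(wₘ) ⋯ θ(w₁) w₀ g⟫ = ⟪h, dilationKernel τ v w g⟫` of a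
minimal dilation. -/
def dilationKernel (v w : List A) : A := iterKernel τ (max v.length w.length) v w

theorem iterKernel_succ (N : ℕ) (v w : List A) : iterKernel τ (N + 1) v w =
    star (v.headD 1) * τ (iterKernel τ N v.tail w.tail) * w.headD 1 := rfl

/-- Once both lists are exhausted, a further level only contributes `τ 1 = 1`. Thus the nesting
depth is irrelevant as soon as it is large enough. -/
theorem iterKernel_succ_eq (h1 : τ 1 = 1) (N : ℕ) (v w : List A) (hv : v.length ≤ N)
    (hw : w.length ≤ N) : iterKernel τ (N + 1) v w = iterKernel τ N v w := by
  induction N generalizing v w with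
  | zero =>
    obtain rfl := List.length_eq_zero_iff.1 (Nat.le_zero.1 hv)
    obtain rfl := List.length_eq_zero_iff.1 (Nat.le_zero.1 hw)
    simp [iterKernel, h1]
  | succ N ih =>
    rw [iterKernel_succ, ih _ _ (by simp; omega) (by simp; omega), ← iterKernel_succ]

theorem dilationKernel_eq_iterKernel (h1 : τ 1 = 1) {N : ℕ} {v w : List A} (hv : v.length ≤ N)
    (hw : w.length ≤ N) : dilationKernel τ v w = iterKernel τ N v w := by
  have key : ∀ n, max v.length w.length ≤ n → iterKernel τ n v w = dilationKernel τ v w := by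
    intro n hn
    induction n, hn using Nat.le_induction with
    | base => rfl
    | succ n hn ih =>
      rw [← ih]
      exact iterKernel_succ_eq h1 n v w (le_trans (le_max_left _ _) hn)
        (le_trans (le_max_right _ _) hn)
  exact (key N (max_le hv hw)).symm

theorem dilationKernel_eq (h1 : τ 1 = 1) (v w : List A) :
    dilationKernel τ v w =
      star (v.headD 1) * τ (dilationKernel τ v.tail w.tail) * w.headD 1 := by
  have hv := le_max_left v.length w.length
  have hw := le_max_right v.length w.length
  rw [dilationKernel_eq_iterKernel h1 (hv.trans (Nat.le_succ _)) (hw.trans (Nat.le_succ _)),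
    iterKernel_succ, dilationKernel_eq_iterKernel h1 (N := max v.length w.length)
      (by rw [List.length_tail]; omega) (by rw [List.length_tail]; omega)]

@[simp] theorem dilationKernel_nil : dilationKernel τ [] [] = 1 := rfl

/-- The constant kernel `1` is positive. Each level applies the completely positive `τ` and then a
congruence by the heads of the lists. -/
theorem isKernelPositive_iterKernel (hτ : IsVectorCP A τ) (N : ℕ) :
    IsKernelPositive fun v w => A.incl (iterKernel τ N v w) := by
  induction N with
  | zero =>
    intro h
    have := kernelForm_adjoint_comp (fun _ : List A => (1 : H →L[ℂ] H)) (fun _ : List A => 1) 1 h h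
    simp only [← ContinuousLinearMap.star_eq_adjoint, star_one] at this
    simp only [iterKernel, map_one]
    refine le_of_le_of_eq ?_ this.symm
    simp only [one_apply_eq_self]
    rw [inner_self_eq_norm_sq_to_K]
    positivity
  | succ N ih =>
    have := (hτ.map_isKernelPositive ih).comap List.tail fun v => A.incl (v.headD 1)
    simpa only [iterKernel, map_mul, map_star] using this

theorem isKernelPositive_dilationKernel (hτ : IsVectorCP A τ) (h1 : τ 1 = 1) :
    IsKernelPositive fun v w => A.incl (dilationKernel τ v w) := by
  intro h
  -- A finitely supported function involves lists of bounded length, so one nesting depth serves for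
  -- all of them.
  let N := h.support.sup List.length
  have := isKernelPositive_iterKernel hτ N h
  convert this using 1
  rw [kernelForm_apply, kernelForm_apply]
  refine Finsupp.sum_congr fun v hv => Finsupp.sum_congr fun w hw => ?_
  rw [dilationKernel_eq_iterKernel h1 (Finset.le_sup (f := List.length) hv)
    (Finset.le_sup (f := List.length) hw)]

variable (A τ) in
/-- A Hilbert space spanned by vectors `X v h`, where `v` is a list of elements of `A` and `h` is
in `H`, with the inner products prescribed by the kernel of a dilation. -/
structure DilationSpace where
  K : Type u
  [normedAddCommGroup : NormedAddCommGroup K]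
  [innerProductSpace : InnerProductSpace ℂ K]
  [completeSpace : CompleteSpace K]
  X : List A → H →L[ℂ] K
  adjoint_comp : ∀ v w, adjoint (X v) ∘L X w = A.incl (dilationKernel τ v w)
  dense : DenseRange (kernelVec X)

/-- Kolmogorov decomposition: take the vector-valued reproducing kernel Hilbert space of the kernel,
with its kernel functions as generating maps. -/
theorem nonempty_dilationSpace (hτ : IsVectorCP A τ) (h1 : τ 1 = 1) :
    Nonempty (DilationSpace A τ) := by
  let M : Matrix (List A) (List A) (H →L[ℂ] H) := fun v w => A.incl (dilationKernel τ v w)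
  have hpos := isKernelPositive_dilationKernel hτ h1
  have hM : M.PosSemidef := by
    have h0 : M.PosSemidef ↔ M.IsHermitian ∧ ∀ h : List A →₀ H,
        0 ≤ RCLike.re (h.sum fun x w => h.sum fun x' w' => ⟪M x' x w, w'⟫_ℂ) :=
      (RKHS.posSemidef_tfae (K := M)).out 0 2
    refine h0.2 ⟨?_, fun h => ?_⟩
    · refine Matrix.ext fun v w => ?_
      exact hpos.star_apply w v
    · have h2 := (Complex.nonneg_iff.1 (hpos h)).1
      have h3 : (h.sum fun x w => h.sum fun x' w' => ⟪M x' x w, w'⟫_ℂ) =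
          starRingEnd ℂ (kernelForm (fun v w => A.incl (dilationKernel τ v w)) h h) := by
        rw [kernelForm_apply, Finsupp.sum_comm]
        simp only [Finsupp.sum, map_sum, inner_conj_symm]
        rfl
      rw [h3]
      simpa using h2
  have : Fact M.PosSemidef := ⟨hM⟩
  refine ⟨{ K := RKHS.OfKernel M, X := RKHS.kerFun (RKHS.OfKernel M), adjoint_comp := ?_, dense := ?_ }⟩
  · intro v w
    rw [← RKHS.kernel_apply, RKHS.OfKernel.kernel_ofKernel]
  · have := RKHS.kerFun_dense (RKHS.OfKernel M)
    intro x
    have hx : x ∈ (⊤ : Submodule ℂ (RKHS.OfKernel M)) := trivial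
    rw [← this] at hx
    refine closure_mono ?_ hx
    have hle : Submodule.span ℂ {y | ∃ v h, RKHS.kerFun (RKHS.OfKernel M) v h = y} ≤
        LinearMap.range (kernelVec (RKHS.kerFun (RKHS.OfKernel M))) := by
      rw [Submodule.span_le]
      rintro _ ⟨v, h, rfl⟩
      exact ⟨Finsupp.single v h, by simp⟩
    exact fun y hy => hle hy

end DilationKernel

/-! ### The shift defined by matrix coefficients -/

namespace DilationSpace

attribute [instance] normedAddCommGroup innerProductSpace completeSpace

variable {H : Type u} [NormedAddCommGroup H] [InnerProductSpace ℂ H] [CompleteSpace H]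
  {A : VonNeumannAlgebra H} {τ : Module.End ℂ A} (S : DilationSpace A τ)

theorem ext_left {Y Z : H →L[ℂ] S.K}
    (h : ∀ v, adjoint (S.X v) ∘L Y = adjoint (S.X v) ∘L Z) : Y = Z := by
  ext x
  refine S.dense.eq_of_inner_right ℂ fun g => ?_
  induction g using Finsupp.induction_linear with
  | zero => simp
  | add g g' ih ih' => rw [map_add, inner_add_left, inner_add_left, ih, ih']
  | single v y =>
    rw [kernelVec_single, ← ContinuousLinearMap.adjoint_inner_right,
      ← ContinuousLinearMap.adjoint_inner_right]
    exact congrArg (fun T : H →L[ℂ] H => ⟪y, T x⟫_ℂ) (h v)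

theorem ext_right {b c : S.K →L[ℂ] S.K} (h : ∀ w, b ∘L S.X w = c ∘L S.X w) : b = c := by
  refine ContinuousLinearMap.ext fun x => ?_
  refine congrFun (S.dense.equalizer b.continuous c.continuous (funext fun f => ?_)) x
  simp only [Function.comp_apply]
  induction f using Finsupp.induction_linear with
  | zero => simp
  | add g g' ih ih' => rw [map_add, map_add, map_add, ih, ih']
  | single v y =>
    rw [kernelVec_single]
    exact congrArg (fun T : H →L[ℂ] S.K => T y) (h v)

/-- The operators whose matrix coefficients belong to `A`. -/
def coeffSpace : Submodule ℂ (S.K →L[ℂ] S.K) where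
  carrier := {b | ∀ v w, adjoint (S.X v) ∘L b ∘L S.X w ∈ A}
  add_mem' hb hc v w := by
    rw [ContinuousLinearMap.add_comp, ContinuousLinearMap.comp_add]
    exact add_mem (hb v w) (hc v w)
  zero_mem' v w := by
    rw [ContinuousLinearMap.zero_comp, ContinuousLinearMap.comp_zero]
    exact zero_mem A
  smul_mem' c b hb v w := by
    rw [ContinuousLinearMap.smul_comp, ContinuousLinearMap.comp_smul]
    exact SMulMemClass.smul_mem c (hb v w)

/-- The matrix coefficients of an operator. -/
def coeffOp (v w : List A) : (S.K →L[ℂ] S.K) →ₗ[ℂ] (H →L[ℂ] H) where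
  toFun b := adjoint (S.X v) ∘L b ∘L S.X w
  map_add' b c := by rw [ContinuousLinearMap.add_comp, ContinuousLinearMap.comp_add]
  map_smul' a b := by
    rw [ContinuousLinearMap.smul_comp, ContinuousLinearMap.comp_smul, RingHom.id_apply]

/-- The matrix coefficients of an operator in `S.coeffSpace`. -/
def coeff (v w : List A) : S.coeffSpace →ₗ[ℂ] A where
  toFun b := ⟨S.coeffOp v w b, b.2 v w⟩
  map_add' b c := Subtype.ext (map_add (S.coeffOp v w) b.1 c.1)
  map_smul' a b := Subtype.ext (map_smul (S.coeffOp v w) a b.1)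

theorem incl_coeff (v w : List A) (b : S.coeffSpace) :
    A.incl (S.coeff v w b) = adjoint (S.X v) ∘L b ∘L S.X w := rfl

theorem coeffOp_ext {b c : S.K →L[ℂ] S.K} (h : ∀ v w, S.coeffOp v w b = S.coeffOp v w c) : b = c :=
  S.ext_right fun w => S.ext_left fun v => h v w

theorem coeff_ext {b c : S.coeffSpace} (h : ∀ v w, S.coeff v w b = S.coeff v w c) : b = c :=
  Subtype.ext (S.coeffOp_ext fun v w => congrArg A.incl (h v w))

theorem adjoint_coeff (b : S.K →L[ℂ] S.K) (v w : List A) :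
    adjoint (S.X v) ∘L star b ∘L S.X w = star (adjoint (S.X w) ∘L b ∘L S.X v) := by
  simp only [ContinuousLinearMap.star_eq_adjoint, ContinuousLinearMap.adjoint_comp,
    ContinuousLinearMap.adjoint_adjoint, ContinuousLinearMap.comp_assoc]

theorem star_mem_coeffSpace {b : S.K →L[ℂ] S.K} (hb : b ∈ S.coeffSpace) :
    star b ∈ S.coeffSpace := fun v w => by
  rw [adjoint_coeff]
  exact star_mem (hb w v)

instance : Star S.coeffSpace := ⟨fun b => ⟨star b.1, S.star_mem_coeffSpace b.2⟩⟩

theorem coe_star (b : S.coeffSpace) : (star b).1 = star b.1 := rfl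

theorem coeff_star (b : S.coeffSpace) (v w : List A) :
    S.coeff v w (star b) = star (S.coeff w v b) :=
  Subtype.ext (S.adjoint_coeff b v w)

theorem one_mem_coeffSpace : 1 ∈ S.coeffSpace := fun v w => by
  have : adjoint (S.X v) ∘L 1 ∘L S.X w = A.incl (dilationKernel τ v w) := S.adjoint_comp v w
  rw [this]
  exact (dilationKernel τ v w).2

instance : One S.coeffSpace := ⟨⟨1, S.one_mem_coeffSpace⟩⟩

theorem coe_one : (1 : S.coeffSpace).1 = 1 := rfl

theorem coeff_one (v w : List A) :
    S.coeff v w 1 = dilationKernel τ v w :=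
  Subtype.ext (S.adjoint_comp v w)

/-- The matrix coefficients of `θ b` for the endomorphism `θ` of a dilation. -/
def shiftKernel (b : S.coeffSpace) (v w : List A) : A :=
  star (v.headD 1) * τ (S.coeff v.tail w.tail b) * w.headD 1

theorem shiftKernel_one (h1 : τ 1 = 1) (v w : List A) :
    S.shiftKernel 1 v w = dilationKernel τ v w := by
  rw [shiftKernel, coeff_one, ← dilationKernel_eq h1]

variable {S}

theorem isKernelPositive_shiftKernel (hτ : IsVectorCP A τ) {p b b' q : S.coeffSpace}
    (hpos : ∀ U W : S.K, 0 ≤ ⟪U, p.1 U⟫_ℂ + ⟪U, b.1 W⟫_ℂ + (⟪W, b'.1 U⟫_ℂ + ⟪W, q.1 W⟫_ℂ)) :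
    IsKernelPositive (blockKernel (fun v w => A.incl (S.shiftKernel p v w))
      (fun v w => A.incl (S.shiftKernel b v w)) (fun v w => A.incl (S.shiftKernel b' v w))
      (fun v w => A.incl (S.shiftKernel q v w))) := by
  have h1 := isKernelPositive_block S.X _ _ _ _ hpos
  have h2 : IsKernelPositive (fun i j => A.incl (blockKernel (fun v w => S.coeff v w p)
      (fun v w => S.coeff v w b) (fun v w => S.coeff v w b') (fun v w => S.coeff v w q) i j)) := by
    convert h1 using 3 with i j
    rcases i with i | i <;> rcases j with j | j <;> rfl
  have h3 := (hτ.map_isKernelPositive h2).comap (Sum.map List.tail List.tail)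
    (Sum.elim (fun v => A.incl (v.headD 1)) fun v => A.incl (v.headD 1))
  convert h3 using 3 with i j
  rcases i with i | i <;> rcases j with j | j <;> rfl

/-- The shifted kernel of `1` is the Gram kernel itself, since `τ 1 = 1`. Positivity of the shifted
block with diagonal `‖b‖` therefore bounds the form of `b` by `‖b‖` in the norm of `S.K`, and a
bounded form comes from an operator. -/
theorem exists_shift (hτ : IsVectorCP A τ) (h1 : τ 1 = 1) (b : S.coeffSpace) :
    ∃ c : S.K →L[ℂ] S.K, ∀ v w, adjoint (S.X v) ∘L c ∘L S.X w = A.incl (S.shiftKernel b v w) := by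
  let one : S.coeffSpace := 1
  have hB := isKernelPositive_shiftKernel hτ (p := (‖b.1‖ : ℂ) • one) (b := b)
    (b' := (star b)) (q := (‖b.1‖ : ℂ) • one) (block_norm_nonneg b.1)
  have hone : ∀ g f, kernelForm (fun v w => A.incl (S.shiftKernel ((‖b.1‖ : ℂ) • one) v w)) g f =
      ‖b.1‖ * ⟪kernelVec S.X g, kernelVec S.X f⟫_ℂ := by
    intro g f
    have := kernelForm_adjoint_comp S.X S.X ((‖b.1‖ : ℂ) • 1) g f
    rw [smul_apply, one_apply_eq_self, inner_smul_right] at this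
    rw [← this]
    congr! with v w
    rw [ContinuousLinearMap.smul_comp, ContinuousLinearMap.comp_smul]
    simp only [shiftKernel, map_smul, mul_smul_comm, smul_mul_assoc]
    congr 1
    exact (congrArg A.incl (S.shiftKernel_one h1 v w)).trans (S.adjoint_comp v w).symm
  obtain ⟨c, hc⟩ := exists_operator_of_form (kernelVec S.X) S.dense
    (kernelForm fun v w => A.incl (S.shiftKernel b v w)) (norm_nonneg b.1) fun g f => by
      have h2 := hB (g.mapDomain .inl + f.mapDomain .inr)
      have h3 := hB.kernelForm_conj (g.mapDomain .inl) (f.mapDomain .inr)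
      simp only [kernelForm_mapDomain, blockKernel] at h3
      rw [kernelForm_block, ← h3, hone, hone] at h2
      have h4 := (Complex.nonneg_iff.1 h2).1
      have hn : ∀ U : S.K, (⟪U, U⟫_ℂ).re = ‖U‖ ^ 2 := fun U => inner_self_eq_norm_sq (𝕜 := ℂ) U
      simp only [Complex.add_re, Complex.conj_re, Complex.re_ofReal_mul, hn] at h4
      linarith
  refine ⟨c, fun v w => ?_⟩
  ext y
  refine ext_inner_left ℂ fun x => ?_
  have := hc (Finsupp.single v x) (Finsupp.single w y)
  simpa only [kernelForm_single, kernelVec_single, ContinuousLinearMap.comp_apply,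
    ContinuousLinearMap.adjoint_inner_right] using this

variable (S) in
/-- The map `b ↦ θ b` for the endomorphism `θ` of a dilation. -/
def shift (hτ : IsVectorCP A τ) (h1 : τ 1 = 1) : S.coeffSpace →ₗ[ℂ] S.coeffSpace where
  toFun b := ⟨(exists_shift hτ h1 b).choose, fun v w => by
    rw [(exists_shift hτ h1 b).choose_spec]
    exact (S.shiftKernel b v w).2⟩
  map_add' b c := Subtype.ext (S.coeffOp_ext fun v w => by
    have h2 : ∀ d, S.coeffOp v w (exists_shift hτ h1 d).choose = A.incl (S.shiftKernel d v w) :=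
      fun d => (exists_shift hτ h1 d).choose_spec v w
    rw [h2, Submodule.coe_add, map_add, h2, h2, ← map_add]
    simp only [shiftKernel, map_add, mul_add, add_mul])
  map_smul' a b := Subtype.ext (S.coeffOp_ext fun v w => by
    have h2 : ∀ d, S.coeffOp v w (exists_shift hτ h1 d).choose = A.incl (S.shiftKernel d v w) :=
      fun d => (exists_shift hτ h1 d).choose_spec v w
    rw [h2, Submodule.coe_smul, map_smul, h2, ← map_smul]
    simp only [shiftKernel, map_smul, mul_smul_comm, smul_mul_assoc, RingHom.id_apply])

variable (hτ : IsVectorCP A τ) (h1 : τ 1 = 1)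

theorem coeff_shift (b : S.coeffSpace) (v w : List A) :
    S.coeff v w (S.shift hτ h1 b) = S.shiftKernel b v w :=
  Subtype.ext ((exists_shift hτ h1 b).choose_spec v w)

theorem shift_one : S.shift hτ h1 1 = 1 :=
  S.coeff_ext fun v w => by rw [coeff_shift, shiftKernel_one S h1, coeff_one]

theorem shiftKernel_star (hτ : IsVectorCP A τ) (b : S.coeffSpace) (v w : List A) :
    S.shiftKernel (star b) v w = star (S.shiftKernel b w v) := by
  rw [shiftKernel, shiftKernel, coeff_star, hτ.apply_star, star_mul, star_mul, star_star,
    mul_assoc]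

theorem shift_star (b : S.coeffSpace) :
    S.shift hτ h1 (star b) =
      star (S.shift hτ h1 b) :=
  S.coeff_ext fun v w => (coeff_shift hτ h1 _ v w).trans <| (shiftKernel_star hτ b v w).trans <|
    (congrArg star (coeff_shift hτ h1 b w v)).symm.trans (S.coeff_star (S.shift hτ h1 b) v w).symm

theorem inner_kernelVec_shift (b : S.coeffSpace) (g f : List A →₀ H) :
    ⟪kernelVec S.X g, (S.shift hτ h1 b).1 (kernelVec S.X f)⟫_ℂ =
      kernelForm (fun v w => A.incl (S.shiftKernel b v w)) g f := by
  rw [← kernelForm_adjoint_comp]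
  congr! with v w
  exact congrArg A.incl (coeff_shift hτ h1 b v w)

/-- Two-positivity of the shift: it holds on the dense span by positivity of the shifted kernels,
and in general by continuity. -/
theorem shift_block_nonneg {p b b' q : S.coeffSpace}
    (hpos : ∀ U W : S.K, 0 ≤ ⟪U, p.1 U⟫_ℂ + ⟪U, b.1 W⟫_ℂ + (⟪W, b'.1 U⟫_ℂ + ⟪W, q.1 W⟫_ℂ))
    (U W : S.K) : 0 ≤ ⟪U, (S.shift hτ h1 p).1 U⟫_ℂ + ⟪U, (S.shift hτ h1 b).1 W⟫_ℂ +
      (⟪W, (S.shift hτ h1 b').1 U⟫_ℂ + ⟪W, (S.shift hτ h1 q).1 W⟫_ℂ) := by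
  refine S.dense.induction_on₂ (p := fun U W => 0 ≤ ⟪U, (S.shift hτ h1 p).1 U⟫_ℂ +
    ⟪U, (S.shift hτ h1 b).1 W⟫_ℂ + (⟪W, (S.shift hτ h1 b').1 U⟫_ℂ + ⟪W, (S.shift hτ h1 q).1 W⟫_ℂ))
    (isClosed_le continuous_const (by fun_prop)) (fun g f => ?_) U W
  simp only [inner_kernelVec_shift]
  rw [← kernelForm_block]
  exact isKernelPositive_shiftKernel hτ hpos _

/-- The Schwarz inequality for completely positive maps. -/
theorem norm_shift_sq_le {c d : S.coeffSpace} (hd : d.1 = star c.1 * c.1) (w : S.K) :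
    ‖(S.shift hτ h1 c).1 w‖ ^ 2 ≤ ‖⟪w, (S.shift hτ h1 d).1 w⟫_ℂ‖ := by
  -- The block with rows `1, c` and `c*, c* c` is positive; its image is tested on the pair `-(θ c)
  -- w`, `w`.
  have h2 := shift_block_nonneg hτ h1 (p := 1) (b := c)
    (b' := star c) (q := d) (fun U W => by
      have : ⟪U, U⟫_ℂ + ⟪U, c.1 W⟫_ℂ + (⟪W, (star c.1) U⟫_ℂ + ⟪W, (star c.1 * c.1) W⟫_ℂ) =
          ⟪U + c.1 W, U + c.1 W⟫_ℂ := by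
        simp only [ContinuousLinearMap.star_eq_adjoint, mul_apply_eq_comp, inner_add_left,
          inner_add_right, ContinuousLinearMap.adjoint_inner_right]
        ring
      rw [hd]
      refine le_of_le_of_eq ?_ this.symm
      rw [inner_self_eq_norm_sq_to_K]
      positivity) (-((S.shift hτ h1 c).1 w)) w
  rw [shift_one, shift_star] at h2
  simp only [one_apply_eq_self, ContinuousLinearMap.star_eq_adjoint, coe_one, coe_star, map_neg, inner_neg_left, inner_neg_right,
    ContinuousLinearMap.adjoint_inner_right] at h2
  have hn : ∀ U : S.K, (⟪U, U⟫_ℂ).re = ‖U‖ ^ 2 := fun U => inner_self_eq_norm_sq (𝕜 := ℂ) U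
  have h3 := (Complex.nonneg_iff.1 h2).1
  have h4 := Complex.re_le_norm ⟪w, (S.shift hτ h1 d).1 w⟫_ℂ
  simp only [Complex.add_re, Complex.neg_re, hn] at h3
  linarith

end DilationSpace

theorem VonNeumannAlgebra.incl_injective {H : Type u} [NormedAddCommGroup H]
    [InnerProductSpace ℂ H] [CompleteSpace H] (A : VonNeumannAlgebra H) :
    Function.Injective A.incl := Subtype.val_injective

/-! ### The shift on operators preserving the algebraic span -/

namespace DilationSpace

variable {H : Type u} [NormedAddCommGroup H] [InnerProductSpace ℂ H] [CompleteSpace H]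
  {A : VonNeumannAlgebra H} {τ : Module.End ℂ A} (S : DilationSpace A τ)

/-- The coefficients of `b * c` reduce to finite linear combinations of those of `b`, as `c` keeps
the algebraic span of the generating maps. -/
theorem mul_mem_coeffSpace {b c : S.K →L[ℂ] S.K} (hb : b ∈ S.coeffSpace)
    (hc : ∀ y, c ∘L S.X y ∈ Submodule.span ℂ (Set.range S.X)) : b * c ∈ S.coeffSpace := by
  intro v w
  obtain ⟨f, hf⟩ := Finsupp.mem_span_range_iff_exists_finsupp.1 (hc w)
  have : adjoint (S.X v) ∘L (b * c) ∘L S.X w = f.sum fun z a => a • S.coeffOp v z b := by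
    change adjoint (S.X v) ∘L b ∘L (c ∘L S.X w) = _
    rw [← hf]
    ext x
    simp [Finsupp.sum, coeffOp]
  rw [this]
  exact sum_mem fun z _ => SMulMemClass.smul_mem _ (hb v z)

/-- The operators which map each `S.X y` to a finite linear combination of such maps, and whose
adjoints have the same property. -/
def finiteAlgebra : StarSubalgebra ℂ (S.K →L[ℂ] S.K) where
  carrier := {b | (∀ y, b ∘L S.X y ∈ Submodule.span ℂ (Set.range S.X)) ∧
    ∀ y, star b ∘L S.X y ∈ Submodule.span ℂ (Set.range S.X)}
  add_mem' hb hc := by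
    refine ⟨fun y => ?_, fun y => ?_⟩
    · rw [ContinuousLinearMap.add_comp]
      exact add_mem (hb.1 y) (hc.1 y)
    · rw [star_add, ContinuousLinearMap.add_comp]
      exact add_mem (hb.2 y) (hc.2 y)
  mul_mem' {b c} hb hc := by
    have key : ∀ b c : S.K →L[ℂ] S.K, (∀ y, b ∘L S.X y ∈ Submodule.span ℂ (Set.range S.X)) →
        (∀ y, c ∘L S.X y ∈ Submodule.span ℂ (Set.range S.X)) →
        ∀ y, (b * c) ∘L S.X y ∈ Submodule.span ℂ (Set.range S.X) := by
      intro b c hb hc y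
      obtain ⟨f, hf⟩ := Finsupp.mem_span_range_iff_exists_finsupp.1 (hc y)
      have : (b * c) ∘L S.X y = f.sum fun z a => a • b ∘L S.X z := by
        change b ∘L (c ∘L S.X y) = _
        rw [← hf]
        ext x
        simp [Finsupp.sum]
      rw [this]
      exact sum_mem fun z _ => Submodule.smul_mem _ _ (hb z)
    refine ⟨key b c hb.1 hc.1, ?_⟩
    rw [star_mul]
    exact key _ _ hc.2 hb.2
  algebraMap_mem' a := by
    have key : ∀ (a : ℂ) (y : List A), (algebraMap ℂ (S.K →L[ℂ] S.K) a) ∘L S.X y ∈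
        Submodule.span ℂ (Set.range S.X) := fun a y => by
      have : (algebraMap ℂ (S.K →L[ℂ] S.K) a) ∘L S.X y = a • S.X y := by
        ext x
        simp [Algebra.algebraMap_eq_smul_one]
      rw [this]
      exact Submodule.smul_mem _ _ (Submodule.subset_span ⟨y, rfl⟩)
    refine ⟨key a, ?_⟩
    rw [← algebraMap_star_comm]
    exact key _
  star_mem' {b} hb := ⟨hb.2, by rw [star_star]; exact hb.1⟩

theorem mem_coeffSpace_of_mem_finiteAlgebra {b : S.K →L[ℂ] S.K} (hb : b ∈ S.finiteAlgebra) :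
    b ∈ S.coeffSpace := by
  rw [← one_mul b]
  exact S.mul_mem_coeffSpace S.one_mem_coeffSpace hb.1

section Shift

variable (hτ : IsVectorCP A τ) (h1 : τ 1 = 1)

variable {S} in
-- In the intended model `X (a :: z) h = θ(X z) a h`, so `θ b` acts on a list by letting `b` act on
-- the tail and keeping the head.
theorem shift_comp {b : S.coeffSpace} {w : List A} {f : List A →₀ ℂ}
    (hf : b.1 ∘L S.X w.tail = f.sum fun z a => a • S.X z) :
    (S.shift hτ h1 b).1 ∘L S.X w = f.sum fun z a => a • S.X (w.headD 1 :: z) := by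
  refine S.ext_left fun v => ?_
  have h2 : S.coeff v.tail w.tail b = f.sum fun z a => a • dilationKernel τ v.tail z := by
    refine A.incl_injective ?_
    rw [incl_coeff, hf, map_finsuppSum]
    simp only [map_smul, ← S.adjoint_comp]
    ext x
    simp [Finsupp.sum]
  have h3 : adjoint (S.X v) ∘L (S.shift hτ h1 b).1 ∘L S.X w = A.incl (S.shiftKernel b v w) :=
    congrArg A.incl (coeff_shift hτ h1 b v w)
  have h4 : adjoint (S.X v) ∘L (f.sum fun z a => a • S.X (w.headD 1 :: z)) =
      f.sum fun z a => a • A.incl (dilationKernel τ v (w.headD 1 :: z)) := by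
    simp only [← S.adjoint_comp]
    ext x
    simp [Finsupp.sum]
  rw [h3, h4, shiftKernel, h2]
  simp only [dilationKernel_eq h1 v (_ :: _), Finsupp.sum, map_sum, Finset.mul_sum, Finset.sum_mul,
    map_smul, mul_smul_comm, smul_mul_assoc, List.tail_cons, List.headD_cons]

variable {S} in
theorem shift_comp_mem_span {b : S.coeffSpace}
    (hb : ∀ y, b.1 ∘L S.X y ∈ Submodule.span ℂ (Set.range S.X)) (w : List A) :
    (S.shift hτ h1 b).1 ∘L S.X w ∈ Submodule.span ℂ (Set.range S.X) := by
  obtain ⟨f, hf⟩ := Finsupp.mem_span_range_iff_exists_finsupp.1 (hb w.tail)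
  rw [shift_comp hτ h1 hf.symm]
  exact sum_mem fun z _ => Submodule.smul_mem _ _ (Submodule.subset_span ⟨_, rfl⟩)

variable {S} in
-- Only the right factor has to preserve the span: expand its action on the tail, keep the head, and
-- compare coefficients. This one-sided form is used later with a left factor from the bicommutant.
theorem shift_mul {b c d : S.coeffSpace} (hd : d.1 = b.1 * c.1)
    (hc : ∀ y, c.1 ∘L S.X y ∈ Submodule.span ℂ (Set.range S.X)) :
    (S.shift hτ h1 d).1 = (S.shift hτ h1 b).1 * (S.shift hτ h1 c).1 := by
  refine S.ext_right fun w => S.ext_left fun v => ?_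
  obtain ⟨f, hf⟩ := Finsupp.mem_span_range_iff_exists_finsupp.1 (hc w.tail)
  have h2 : S.coeff v.tail w.tail d = f.sum fun z a => a • S.coeff v.tail z b := by
    refine A.incl_injective ?_
    rw [incl_coeff, hd]
    change _ ∘L b.1 ∘L (c.1 ∘L _) = _
    rw [← hf, map_finsuppSum]
    simp only [map_smul, incl_coeff]
    ext x
    simp [Finsupp.sum]
  have h3 : ∀ (b : S.coeffSpace) w, adjoint (S.X v) ∘L (S.shift hτ h1 b).1 ∘L S.X w =
    A.incl (S.shiftKernel b v w) := fun b w => congrArg A.incl (coeff_shift hτ h1 b v w)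
  have h4 : adjoint (S.X v) ∘L ((S.shift hτ h1 b).1 * (S.shift hτ h1 c).1) ∘L S.X w =
      f.sum fun z a => a • A.incl (S.shiftKernel b v (w.headD 1 :: z)) := by
    change _ ∘L _ ∘L (_ ∘L _) = _
    rw [shift_comp hτ h1 hf.symm]
    simp only [← h3]
    ext x
    simp [Finsupp.sum]
  rw [h3, h4, shiftKernel, h2]
  simp only [shiftKernel, Finsupp.sum, map_sum, Finset.mul_sum, Finset.sum_mul,
    map_smul, mul_smul_comm, smul_mul_assoc, List.tail_cons, List.headD_cons]

variable {S} in
/-- The inclusion of the finite algebra. -/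
def finiteCoe : S.finiteAlgebra →ₗ[ℂ] S.coeffSpace where
  toFun b := ⟨b.1, S.mem_coeffSpace_of_mem_finiteAlgebra b.2⟩
  map_add' _ _ := rfl
  map_smul' _ _ := rfl

theorem finiteCoe_star (b : S.finiteAlgebra) : finiteCoe (star b) = star (finiteCoe b) := rfl

theorem shift_finiteCoe_mem (b : S.finiteAlgebra) :
    (S.shift hτ h1 (finiteCoe b)).1 ∈ S.finiteAlgebra := by
  refine ⟨shift_comp_mem_span hτ h1 b.2.1, ?_⟩
  rw [← coe_star, ← shift_star]
  exact shift_comp_mem_span hτ h1 b.2.2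

/-- The endomorphism of a dilation on the finite algebra, as a map. -/
def finiteShiftFun (b : S.finiteAlgebra) : S.finiteAlgebra :=
  ⟨(S.shift hτ h1 (finiteCoe b)).1, S.shift_finiteCoe_mem hτ h1 b⟩

theorem coe_finiteShiftFun (b : S.finiteAlgebra) :
    (S.finiteShiftFun hτ h1 b).1 = (S.shift hτ h1 (finiteCoe b)).1 := rfl

theorem finiteShiftFun_algebraMap (a : ℂ) :
    S.finiteShiftFun hτ h1 (algebraMap ℂ _ a) = algebraMap ℂ _ a := by
  have h2 : finiteCoe (algebraMap ℂ S.finiteAlgebra a) = a • 1 := by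
    rw [Algebra.algebraMap_eq_smul_one, map_smul]
    rfl
  refine Subtype.ext ?_
  rw [coe_finiteShiftFun, h2, map_smul, shift_one, Algebra.algebraMap_eq_smul_one]
  rfl

/-- The endomorphism of a dilation, on the finite algebra. -/
def finiteShift : S.finiteAlgebra →⋆ₐ[ℂ] S.finiteAlgebra where
  toFun := S.finiteShiftFun hτ h1
  map_one' := by simpa using S.finiteShiftFun_algebraMap hτ h1 1
  map_mul' b c := Subtype.ext (shift_mul hτ h1 rfl c.2.1)
  map_zero' := by simpa using S.finiteShiftFun_algebraMap hτ h1 0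
  map_add' b c := Subtype.ext (by
    rw [coe_finiteShiftFun, map_add, map_add]
    rfl)
  commutes' := S.finiteShiftFun_algebraMap hτ h1
  map_star' b := Subtype.ext (by
    rw [coe_finiteShiftFun, finiteCoe_star, shift_star]
    rfl)

end Shift

theorem X_cons_mul (h1 : τ 1 = 1) (a c : A) (w : List A) :
    S.X (a * c :: w) = S.X (a :: w) ∘L A.incl c := by
  refine S.ext_left fun v => ?_
  rw [S.adjoint_comp, ← ContinuousLinearMap.comp_assoc, S.adjoint_comp, dilationKernel_eq h1,
    dilationKernel_eq h1 v (a :: w)]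
  simp only [List.headD_cons, List.tail_cons, ← mul_assoc]
  rw [map_mul]
  rfl

theorem X_singleton (h1 : τ 1 = 1) (c : A) : S.X [c] = S.X [] ∘L A.incl c := by
  have : S.X [] = S.X [1] := S.ext_left fun v => by
    rw [S.adjoint_comp, S.adjoint_comp, dilationKernel_eq h1, dilationKernel_eq h1 v [1]]
    rfl
  rw [this, ← X_cons_mul S h1, one_mul]

/-- The embedding of `H`. -/
def V : H →ₗᵢ[ℂ] S.K where
  toLinearMap := (S.X []).toLinearMap
  norm_map' h := by
    have h2 : ⟪S.X [] h, S.X [] h⟫_ℂ = ⟪h, h⟫_ℂ := by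
      rw [← ContinuousLinearMap.adjoint_inner_right, ← ContinuousLinearMap.comp_apply,
        S.adjoint_comp]
      simp
    rw [@norm_eq_sqrt_re_inner ℂ _ _ _ _ h, ← h2]
    exact norm_eq_sqrt_re_inner (𝕜 := ℂ) _

theorem V_toContinuousLinearMap : S.V.toContinuousLinearMap = S.X [] := rfl

theorem extendOp_comp_X (h1 : τ 1 = 1) (a : A) (y : List A) :
    extendOp S.V (A.incl a) ∘L S.X y = S.X [a * dilationKernel τ [] y] := by
  rw [extendOp, V_toContinuousLinearMap, X_singleton S h1, map_mul, ← S.adjoint_comp]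
  rfl

theorem star_extendOp {K : Type u} [NormedAddCommGroup K] [InnerProductSpace ℂ K] [CompleteSpace K]
    (V : H →ₗᵢ[ℂ] K) (x : H →L[ℂ] H) : star (extendOp V x) = extendOp V (star x) := by
  simp [extendOp, ContinuousLinearMap.star_eq_adjoint, ContinuousLinearMap.adjoint_comp,
    ContinuousLinearMap.comp_assoc]

/-- The operator `p a p`, as an element of the finite algebra. -/
def base (h1 : τ 1 = 1) (a : A) : S.finiteAlgebra :=
  ⟨extendOp S.V (A.incl a), fun y => by
    rw [extendOp_comp_X S h1]
    exact Submodule.subset_span ⟨_, rfl⟩, fun y => by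
    rw [star_extendOp, ← map_star, extendOp_comp_X S h1]
    exact Submodule.subset_span ⟨_, rfl⟩⟩

variable (hτ : IsVectorCP A τ) (h1 : τ 1 = 1)

/-- A list of length `n` uses the powers `θ⁰, …, θⁿ⁻¹`, so multiplying by `θⁿ(a)` on the left
appends the next entry. -/
theorem finiteShift_iterate_base_comp_X (a : A) (n : ℕ) {w : List A} (hw : w.length = n) :
    ((S.finiteShift hτ h1)^[n] (S.base h1 a)).1 ∘L S.X w = S.X (w ++ [a]) := by
  induction n generalizing w with
  | zero =>
    rw [List.length_eq_zero_iff.1 hw]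
    refine (S.extendOp_comp_X h1 a []).trans ?_
    simp
  | succ n ih =>
    rw [Function.iterate_succ_apply']
    obtain ⟨x, w, rfl⟩ := List.exists_cons_of_length_eq_add_one hw
    refine (shift_comp hτ h1 (f := Finsupp.single (w ++ [a]) 1) ?_).trans ?_
    · exact (ih (by simpa using hw)).trans (by simp)
    · simp

theorem adjoint_V_finiteShift_iterate (a : A) (n : ℕ) :
    adjoint (S.X []) ∘L ((S.finiteShift hτ h1)^[n] (S.base h1 a)).1 ∘L S.X [] =
      A.incl ((τ ^ n) a) := by
  induction n with
  | zero =>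
    refine (congrArg (adjoint (S.X []) ∘L ·) (S.extendOp_comp_X h1 a [])).trans ?_
    simp only [S.adjoint_comp, pow_zero]
    rw [dilationKernel_eq h1]
    simp [h1]
  | succ n ih =>
    rw [Function.iterate_succ_apply', pow_succ', Module.End.mul_apply]
    refine (congrArg A.incl (coeff_shift hτ h1 (finiteCoe
      ((S.finiteShift hτ h1)^[n] (S.base h1 a))) [] [])).trans ?_
    have h2 : S.coeff [] [] (finiteCoe
      ((S.finiteShift hτ h1)^[n] (S.base h1 a))) = (τ ^ n) a := Subtype.ext ih
    simp [shiftKernel, h2]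

end DilationSpace

/-! ### Bicommutants and ultraweak continuity -/

section Bicommutant

variable {K : Type u} [NormedAddCommGroup K] [InnerProductSpace ℂ K] [CompleteSpace K]

/-- The bicommutant of a `*`-algebra of operators. -/
def StarSubalgebra.bicommutant (M : StarSubalgebra ℂ (K →L[ℂ] K)) : VonNeumannAlgebra K where
  toStarSubalgebra := StarSubalgebra.centralizer ℂ
    (StarSubalgebra.centralizer ℂ (M : Set (K →L[ℂ] K)) : Set (K →L[ℂ] K))
  centralizer_centralizer' := by
    change Set.centralizer (Set.centralizer (StarSubalgebra.centralizer ℂ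
      (StarSubalgebra.centralizer ℂ (M : Set (K →L[ℂ] K)) : Set (K →L[ℂ] K)) : Set (K →L[ℂ] K))) =
      (StarSubalgebra.centralizer ℂ
      (StarSubalgebra.centralizer ℂ (M : Set (K →L[ℂ] K)) : Set (K →L[ℂ] K)) : Set (K →L[ℂ] K))
    rw [StarSubalgebra.coe_centralizer_centralizer, Set.centralizer_centralizer_centralizer]

theorem StarSubalgebra.coe_bicommutant (M : StarSubalgebra ℂ (K →L[ℂ] K)) :
    (M.bicommutant : Set (K →L[ℂ] K)) = Set.centralizer (Set.centralizer (M : Set (K →L[ℂ] K))) := by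
  refine (StarSubalgebra.coe_centralizer_centralizer ℂ (M : Set (K →L[ℂ] K))).trans ?_
  rw [StarMemClass.star_coe_eq, Set.union_self]

theorem StarSubalgebra.le_bicommutant (M : StarSubalgebra ℂ (K →L[ℂ] K)) {b : K →L[ℂ] K}
    (hb : b ∈ M) : b ∈ M.bicommutant := by
  rw [← SetLike.mem_coe, coe_bicommutant]
  exact Set.subset_centralizer_centralizer hb

/-- The bicommutant of a set of operators is that of the `*`-algebra it generates. -/
theorem centralizer_adjoin {s : Set (K →L[ℂ] K)} (hs : star s = s) :
    Set.centralizer (StarAlgebra.adjoin ℂ s : Set (K →L[ℂ] K)) = Set.centralizer s := by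
  refine subset_antisymm (Set.centralizer_subset (StarAlgebra.subset_adjoin ℂ s)) ?_
  intro c hc
  have h2 : StarAlgebra.adjoin ℂ s ≤ StarSubalgebra.centralizer ℂ
      (StarSubalgebra.centralizer ℂ s : Set (K →L[ℂ] K)) :=
    StarAlgebra.adjoin_le_centralizer_centralizer ℂ s
  intro b hb
  have h3 := h2 hb
  rw [StarSubalgebra.mem_centralizer_iff] at h3
  refine (h3 c ?_).1.symm
  rw [StarSubalgebra.coe_centralizer, hs, Set.union_self]
  exact hc

variable {R : Type*} [Ring R] [Algebra ℂ R] [StarRing R]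

/-- An ultraweakly continuous functional which vanishes on a `*`-algebra vanishes on the
bicommutant. -/
theorem IsUltraweakFor.eq_zero {ρ : R →⋆ₐ[ℂ] (K →L[ℂ] K)} {f : R → ℂ} (hf : IsUltraweakFor ρ f)
    (M : StarSubalgebra ℂ (K →L[ℂ] K)) (hM : ∀ s ∈ M, ∃ r, ρ r = s ∧ f r = 0) {b : R}
    (hb : ρ b ∈ M.bicommutant) : f b = 0 := by
  obtain ⟨ξ, η, h⟩ := hf
  rw [h]
  refine inner_amplify_eq_zero_of_mem_bicommutant M ξ η (fun s hs => ?_) ?_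
  · obtain ⟨r, rfl, hr⟩ := hM s hs
    rw [← h, hr]
  · rwa [← SetLike.mem_coe, StarSubalgebra.coe_bicommutant] at hb

/-- Move `Z` and `Y` onto the representing square summable sequences. -/
theorem IsUltraweakFor.comp_compression {R' : Type*} [Ring R'] [Algebra ℂ R'] [StarRing R']
    {H : Type*} [NormedAddCommGroup H] [InnerProductSpace ℂ H] [CompleteSpace H]
    {ρ' : R' →⋆ₐ[ℂ] (H →L[ℂ] H)} {f : R' → ℂ} (hf : IsUltraweakFor ρ' f)
    (ρ : R →⋆ₐ[ℂ] (K →L[ℂ] K)) (Z Y : H →L[ℂ] K) (g : R → R')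
    (hg : ∀ b, ρ' (g b) = adjoint Z ∘L ρ b ∘L Y) : IsUltraweakFor ρ fun b => f (g b) := by
  obtain ⟨ξ, η, h⟩ := hf
  refine ⟨lp.mapCLM 2 (fun _ : ℕ => Z) (norm_nonneg Z) (fun _ => le_rfl) ξ,
    lp.mapCLM 2 (fun _ : ℕ => Y) (norm_nonneg Y) (fun _ => le_rfl) η, fun b => ?_⟩
  beta_reduce
  rw [h, inner_amplify, inner_amplify]
  refine tsum_congr fun n => ?_
  rw [hg, ContinuousLinearMap.comp_apply, ContinuousLinearMap.adjoint_inner_right]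
  rfl

theorem Ell2.exists_amplify_bound (ξ η : Ell2 K) : ∃ ζ : Ell2 K, ∀ T : K →L[ℂ] K,
    ‖amplify K T ξ‖ ≤ ‖amplify K T ζ‖ ∧ ‖amplify K T η‖ ≤ ‖amplify K T ζ‖ := by
  refine ⟨flatten (lp.single 2 0 ξ + lp.single 2 1 η), fun T => ?_⟩
  rw [amplify_flatten, norm_flatten]
  have h0 := lp.norm_apply_le_norm (p := 2) (by simp)
    (amplify (Ell2 K) (amplify K T) (lp.single 2 0 ξ + lp.single 2 1 η)) 0
  have h1 := lp.norm_apply_le_norm (p := 2) (by simp)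
    (amplify (Ell2 K) (amplify K T) (lp.single 2 0 ξ + lp.single 2 1 η)) 1
  rw [amplify_apply] at h0 h1
  exact ⟨by simpa using h0, by simpa using h1⟩

end Bicommutant

/-! ### Extension of the endomorphism to the generated von Neumann algebra -/

namespace DilationSpace

variable {H : Type u} [NormedAddCommGroup H] [InnerProductSpace ℂ H] [CompleteSpace H]
  {A : VonNeumannAlgebra H} {τ : Module.End ℂ A} (S : DilationSpace A τ)
  (hτ : IsVectorCP A τ) (h1 : τ 1 = 1)

/-- The generators of the algebra of the dilation. -/
def generators : Set S.finiteAlgebra := {z | ∃ n a, z = (S.finiteShift hτ h1)^[n] (S.base h1 a)}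

/-- The `*`-algebra generated by the `θⁿ(a)`. -/
def dilationAlgebra : StarSubalgebra ℂ (S.K →L[ℂ] S.K) :=
  (StarAlgebra.adjoin ℂ (S.generators hτ h1)).map S.finiteAlgebra.subtype

theorem finiteShift_mem_adjoin {c : S.finiteAlgebra}
    (hc : c ∈ StarAlgebra.adjoin ℂ (S.generators hτ h1)) :
    S.finiteShift hτ h1 c ∈ StarAlgebra.adjoin ℂ (S.generators hτ h1) := by
  have : StarAlgebra.adjoin ℂ (S.generators hτ h1) ≤
      (StarAlgebra.adjoin ℂ (S.generators hτ h1)).comap (S.finiteShift hτ h1) := by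
    refine StarAlgebra.adjoin_le ?_
    rintro _ ⟨n, a, rfl⟩
    exact StarAlgebra.subset_adjoin ℂ _ ⟨n + 1, a, (Function.iterate_succ_apply' _ n _).symm⟩
  exact this hc

theorem dilationAlgebra_le {b : S.K →L[ℂ] S.K} (hb : b ∈ S.dilationAlgebra hτ h1) :
    b ∈ S.finiteAlgebra := by
  obtain ⟨c, -, rfl⟩ := hb
  exact c.2

/-- The von Neumann algebra of the dilation. -/
abbrev B : VonNeumannAlgebra S.K := (S.dilationAlgebra hτ h1).bicommutant

/-- Commutation of a coefficient with an element of the commutant of `A` is the vanishing of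
ultraweakly continuous functionals of `b`. It holds on the dilation algebra and so passes to its
bicommutant. -/
theorem mem_coeffSpace_of_mem_B {b : S.K →L[ℂ] S.K} (hb : b ∈ S.B hτ h1) : b ∈ S.coeffSpace := by
  intro v w
  rw [← SetLike.mem_coe, ← A.centralizer_centralizer]
  intro c hc
  have hc' : ∀ a ∈ A, a * c = c * a := hc
  ext g
  refine ext_inner_left ℂ fun h => ?_
  have h2 : IsUltraweakFor (StarAlgHom.id ℂ (S.K →L[ℂ] S.K)) fun b =>
      ⟪S.X v (adjoint c h), b (S.X w g)⟫_ℂ - ⟪S.X v h, b (S.X w (c g))⟫_ℂ :=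
    (IsUltraweakFor.inner _ _).sub (IsUltraweakFor.inner _ _)
  have h3 : ∀ (b : S.K →L[ℂ] S.K) (h g : H), ⟪S.X v h, b (S.X w g)⟫_ℂ =
      ⟪h, (adjoint (S.X v) ∘L b ∘L S.X w) g⟫_ℂ := fun b h g => by
    simp [ContinuousLinearMap.adjoint_inner_right]
  have h4 := h2.eq_zero (S.dilationAlgebra hτ h1) (fun s hs => ⟨s, rfl, by
    rw [h3, h3, ContinuousLinearMap.adjoint_inner_left, sub_eq_zero]
    exact congrArg (fun T : H →L[ℂ] H => ⟪h, T g⟫_ℂ) (hc' _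
      (S.mem_coeffSpace_of_mem_finiteAlgebra (S.dilationAlgebra_le hτ h1 hs) v w)).symm⟩)
    (b := b) hb
  rw [h3, h3, ContinuousLinearMap.adjoint_inner_left, sub_eq_zero] at h4
  exact h4

/-- The inclusion of the algebra of the dilation. -/
def toCoeff : S.B hτ h1 →ₗ[ℂ] S.coeffSpace where
  toFun b := ⟨b.1, S.mem_coeffSpace_of_mem_B hτ h1 b.2⟩
  map_add' _ _ := rfl
  map_smul' _ _ := rfl

/-- The endomorphism of the dilation, as a map to operators. -/
def shiftOp (b : S.B hτ h1) : S.K →L[ℂ] S.K := (S.shift hτ h1 (S.toCoeff hτ h1 b)).1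

theorem shiftOp_add (b c : S.B hτ h1) :
    S.shiftOp hτ h1 (b + c) = S.shiftOp hτ h1 b + S.shiftOp hτ h1 c := by
  rw [shiftOp, map_add, map_add]
  rfl

theorem shiftOp_smul (a : ℂ) (b : S.B hτ h1) :
    S.shiftOp hτ h1 (a • b) = a • S.shiftOp hτ h1 b := by
  rw [shiftOp, map_smul, map_smul]
  rfl

theorem shiftOp_sub (b c : S.B hτ h1) :
    S.shiftOp hτ h1 (b - c) = S.shiftOp hτ h1 b - S.shiftOp hτ h1 c := by
  rw [shiftOp, map_sub, map_sub]
  rfl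

theorem shiftOp_one : S.shiftOp hτ h1 1 = 1 := by
  have : S.toCoeff hτ h1 1 = 1 := rfl
  rw [shiftOp, this, shift_one]
  rfl

theorem shiftOp_star (b : S.B hτ h1) : S.shiftOp hτ h1 (star b) = star (S.shiftOp hτ h1 b) := by
  have : S.toCoeff hτ h1 (star b) = star (S.toCoeff hτ h1 b) := rfl
  rw [shiftOp, this, shift_star]
  rfl

theorem shiftOp_of_mem_adjoin {c : S.finiteAlgebra} (b : S.B hτ h1) (hb : b.1 = c.1) :
    S.shiftOp hτ h1 b = (S.finiteShift hτ h1 c).1 := by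
  have : S.toCoeff hτ h1 b = finiteCoe c := Subtype.ext hb
  rw [shiftOp, this]
  rfl

/-- Normality of `τ` enters here: on generating vectors the coefficient is a vector functional of
`τ` applied to a compression of `b`. -/
theorem isUltraweakFor_shiftOp (hn : IsNormalMap A τ) (g f : List A →₀ H) : IsUltraweakFor (S.B hτ h1).incl fun b =>
    ⟪kernelVec S.X g, S.shiftOp hτ h1 b (kernelVec S.X f)⟫_ℂ := by
  induction g using Finsupp.induction_linear with
  | zero => simpa using IsUltraweakFor.zero
  | add g g' ih ih' => simpa [inner_add_left] using ih.add ih'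
  | single v x =>
    induction f using Finsupp.induction_linear with
    | zero => simpa using IsUltraweakFor.zero
    | add f f' ih ih' => simpa [inner_add_right] using ih.add ih'
    | single w y =>
      have h2 := (hn.isUltraweakFor_comp (A.incl (v.headD 1) x)
        (A.incl (w.headD 1) y)).comp_compression (S.B hτ h1).incl (S.X v.tail) (S.X w.tail)
        (fun b => S.coeff v.tail w.tail (S.toCoeff hτ h1 b)) fun b => rfl
      convert h2 using 2 with b
      rw [shiftOp, inner_kernelVec_shift, kernelForm_single, shiftKernel, map_mul, map_mul,
        map_star, ContinuousLinearMap.star_eq_adjoint]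
      simp only [mul_apply_eq_comp, ContinuousLinearMap.adjoint_inner_right]
      rfl

theorem norm_shiftOp_sq_le (b : S.B hτ h1) (w : S.K) :
    ‖S.shiftOp hτ h1 b w‖ ^ 2 ≤ ‖⟪w, S.shiftOp hτ h1 (star b * b) w⟫_ℂ‖ :=
  norm_shift_sq_le hτ h1 rfl w

/-- By the Schwarz inequality and normality, `‖θ(x) w‖ ≤ ‖(x ⊗ 1) ζ‖` with `ζ` independent of `x`.
Approximate `b` ultrastrongly at `ζ` by some `s` in the dilation algebra, where multiplicativity is
known; the defect is then `θ(c (b - s)) w - θ(c) θ(b - s) w`, which is small. -/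
theorem shiftOp_mul (hn : IsNormalMap A τ) (c b : S.B hτ h1) :
    S.shiftOp hτ h1 (c * b) = S.shiftOp hτ h1 c * S.shiftOp hτ h1 b := by
  refine ContinuousLinearMap.ext fun x => congrFun (S.dense.equalizer (ContinuousLinearMap.continuous _)
    (ContinuousLinearMap.continuous _) (funext fun f => ?_)) x
  set w := kernelVec S.X f with hw
  obtain ⟨ξ, η, hξη⟩ := S.isUltraweakFor_shiftOp hτ h1 hn f f
  obtain ⟨ζ, hζ⟩ := Ell2.exists_amplify_bound ξ η
  have key : ∀ x : S.B hτ h1, ‖S.shiftOp hτ h1 x w‖ ≤ ‖amplify S.K x.1 ζ‖ := by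
    intro x
    rw [← sq_le_sq₀ (norm_nonneg _) (norm_nonneg _)]
    refine (S.norm_shiftOp_sq_le hτ h1 x w).trans ?_
    have h2 : ⟪w, S.shiftOp hτ h1 (star x * x) w⟫_ℂ =
        ⟪amplify S.K x.1 ξ, amplify S.K x.1 η⟫_ℂ := by
      refine (hξη _).trans ?_
      have : (S.B hτ h1).incl (star x * x) = star x.1 * x.1 := rfl
      rw [this, map_mul, map_star, mul_apply_eq_comp, ContinuousLinearMap.star_eq_adjoint,
        ContinuousLinearMap.adjoint_inner_right]
    rw [h2, sq]
    refine (norm_inner_le_norm _ _).trans ?_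
    gcongr
    exacts [(hζ _).1, (hζ _).2]
  have hsmall : ∀ ε : ℝ, 0 < ε → ‖S.shiftOp hτ h1 (c * b) w -
      (S.shiftOp hτ h1 c * S.shiftOp hτ h1 b) w‖ ≤
        (‖amplify S.K c.1‖ + ‖S.shiftOp hτ h1 c‖) * ε := by
    intro ε hε
    obtain ⟨_, ⟨s, hs, rfl⟩, hlt⟩ := exists_norm_amplify_sub_lt (S.dilationAlgebra hτ h1) ζ
      (by have := b.2; rwa [← SetLike.mem_coe, StarSubalgebra.coe_bicommutant] at this) hε
    let s' : S.B hτ h1 := ⟨s.1, StarSubalgebra.le_bicommutant _ ⟨s, hs, rfl⟩⟩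
    have h2 : S.shiftOp hτ h1 (c * s') = S.shiftOp hτ h1 c * S.shiftOp hτ h1 s' :=
      shift_mul hτ h1 rfl s.2.1
    have h3 : S.shiftOp hτ h1 (c * b) w - (S.shiftOp hτ h1 c * S.shiftOp hτ h1 b) w =
        S.shiftOp hτ h1 (c * (b - s')) w - S.shiftOp hτ h1 c (S.shiftOp hτ h1 (b - s') w) := by
      rw [mul_sub, shiftOp_sub, shiftOp_sub, h2]
      simp
    have h4 : ‖amplify S.K (b - s').1 ζ‖ ≤ ε := hlt.le
    have h5 := (key (b - s')).trans h4
    have h6 : ‖S.shiftOp hτ h1 (c * (b - s')) w‖ ≤ ‖amplify S.K c.1‖ * ε := by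
      refine (key _).trans ?_
      have : (c * (b - s')).1 = c.1 * (b - s').1 := rfl
      rw [this, map_mul, mul_apply_eq_comp]
      refine (ContinuousLinearMap.le_opNorm _ _).trans ?_
      gcongr
    rw [h3, add_mul]
    refine (norm_sub_le _ _).trans (add_le_add h6 ?_)
    refine (ContinuousLinearMap.le_opNorm _ _).trans ?_
    gcongr
  have h0 : ‖S.shiftOp hτ h1 (c * b) w - (S.shiftOp hτ h1 c * S.shiftOp hτ h1 b) w‖ ≤ 0 := by
    have h2 : Tendsto (fun ε : ℝ => (‖amplify S.K c.1‖ + ‖S.shiftOp hτ h1 c‖) * ε) (𝓝[>] 0)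
        (𝓝 0) := by
      have : Continuous fun ε : ℝ => (‖amplify S.K c.1‖ + ‖S.shiftOp hτ h1 c‖) * ε := by fun_prop
      simpa using (this.tendsto 0).mono_left nhdsWithin_le_nhds
    exact ge_of_tendsto h2 (by filter_upwards [self_mem_nhdsWithin] with ε hε using hsmall ε hε)
  exact sub_eq_zero.1 (norm_le_zero_iff.1 h0)

variable (hn : IsNormalMap A τ)

/-- The endomorphism of the dilation, as a representation. -/
def shiftRep : S.B hτ h1 →⋆ₐ[ℂ] (S.K →L[ℂ] S.K) where
  toFun := S.shiftOp hτ h1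
  map_one' := S.shiftOp_one hτ h1
  map_mul' := S.shiftOp_mul hτ h1 hn
  map_zero' := by simpa using S.shiftOp_smul hτ h1 0 0
  map_add' := S.shiftOp_add hτ h1
  commutes' a := by
    rw [Algebra.algebraMap_eq_smul_one, Algebra.algebraMap_eq_smul_one, shiftOp_smul, shiftOp_one]
  map_star' := S.shiftOp_star hτ h1

theorem dense_span_X : Dense (Submodule.span ℂ {x | ∃ v h, x = S.X v h} : Set S.K) := by
  refine S.dense.mono ?_
  rintro _ ⟨f, rfl⟩
  rw [kernelVec_apply]
  exact sum_mem fun v _ => Submodule.subset_span ⟨v, _, rfl⟩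

theorem isUltraweakFor_shiftRep (u w : S.K) : IsUltraweakFor (S.B hτ h1).incl fun b =>
    ⟪u, S.shiftRep hτ h1 hn b w⟫_ℂ := by
  refine IsUltraweakFor.of_dense_span (S.shiftRep hτ h1 hn) S.dense_span_X ?_ u w
  rintro _ ⟨v, h, rfl⟩ _ ⟨w, g, rfl⟩
  simpa using! S.isUltraweakFor_shiftOp hτ h1 hn (Finsupp.single v h) (Finsupp.single w g)

/-- Commutation of `θ b` with the commutant is again an ultraweakly closed condition on `b`, and the
shift preserves the dilation algebra. -/
theorem shiftRep_mem_B (b : S.B hτ h1) : S.shiftRep hτ h1 hn b ∈ S.B hτ h1 := by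
  rw [← SetLike.mem_coe, StarSubalgebra.coe_bicommutant]
  intro c hc
  have hc' : ∀ s ∈ S.dilationAlgebra hτ h1, s * c = c * s := hc
  ext w
  refine ext_inner_left ℂ fun u => ?_
  have h2 := ((S.isUltraweakFor_shiftRep hτ h1 hn (adjoint c u) w).sub
    (S.isUltraweakFor_shiftRep hτ h1 hn u (c w))).eq_zero (S.dilationAlgebra hτ h1) (fun s hs => by
      obtain ⟨s, hs, rfl⟩ := hs
      refine ⟨⟨s.1, StarSubalgebra.le_bicommutant _ ⟨s, hs, rfl⟩⟩, rfl, ?_⟩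
      have h3 : S.shiftRep hτ h1 hn ⟨s.1, StarSubalgebra.le_bicommutant _ ⟨s, hs, rfl⟩⟩ =
        (S.finiteShift hτ h1 s).1 := S.shiftOp_of_mem_adjoin hτ h1 _ rfl
      have h4 := hc' _ ⟨_, S.finiteShift_mem_adjoin hτ h1 hs, rfl⟩
      rw [h3, ContinuousLinearMap.adjoint_inner_left, sub_eq_zero]
      exact congrArg (fun T : S.K →L[ℂ] S.K => ⟪u, T w⟫_ℂ) h4.symm) (b := b) b.2
  beta_reduce at h2
  rw [ContinuousLinearMap.adjoint_inner_left, sub_eq_zero] at h2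
  exact h2

/-- The endomorphism of the dilation. -/
def dilationEndo : S.B hτ h1 →⋆ₐ[ℂ] S.B hτ h1 where
  toFun b := ⟨S.shiftRep hτ h1 hn b, S.shiftRep_mem_B hτ h1 hn b⟩
  map_one' := Subtype.ext (map_one (S.shiftRep hτ h1 hn))
  map_mul' b c := Subtype.ext (map_mul (S.shiftRep hτ h1 hn) b c)
  map_zero' := Subtype.ext (map_zero (S.shiftRep hτ h1 hn))
  map_add' b c := Subtype.ext (map_add (S.shiftRep hτ h1 hn) b c)
  commutes' a := Subtype.ext (AlgHomClass.commutes (S.shiftRep hτ h1 hn) a)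
  map_star' b := Subtype.ext (map_star (S.shiftRep hτ h1 hn) b)

theorem extendOp_mem_B (a : A) : extendOp S.V (a : H →L[ℂ] H) ∈ S.B hτ h1 :=
  StarSubalgebra.le_bicommutant _ ⟨S.base h1 a, StarAlgebra.subset_adjoin ℂ _ ⟨0, a, rfl⟩, rfl⟩

theorem dilationEndo_iterate (n : ℕ) (a : A) :
    (((S.dilationEndo hτ h1 hn)^[n] ⟨extendOp S.V a, S.extendOp_mem_B hτ h1 a⟩ : S.B hτ h1) :
      S.K →L[ℂ] S.K) = ((S.finiteShift hτ h1)^[n] (S.base h1 a)).1 := by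
  induction n with
  | zero => rfl
  | succ n ih =>
    rw [Function.iterate_succ_apply', Function.iterate_succ_apply']
    exact S.shiftOp_of_mem_adjoin hτ h1 _ ih

theorem exists_prod_eq (v : List A) (h : H) : ∃ (n : ℕ) (x : ℕ → A) (g : H), S.X v h =
    (((List.range n).map fun j => (S.dilationEndo hτ h1 hn)^[n - j]
      ⟨extendOp S.V (x (n - j)), S.extendOp_mem_B hτ h1 (x (n - j))⟩).prod : S.B hτ h1).1
        (S.V g) := by
  rcases List.eq_nil_or_concat' v with rfl | ⟨l, a, rfl⟩
  · exact ⟨0, fun _ => 1, h, rfl⟩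
  let x : ℕ → A := fun j => (l ++ [a]).getD j 1
  have hx : l ++ [a] = (List.range (l.length + 1)).map x := by
    refine List.ext_getElem (by simp) fun i h2 h3 => ?_
    simp only [List.getElem_map, List.getElem_range]
    exact (List.getD_eq_getElem _ _ h2).symm
  -- The head of the list carries `θ⁰` and is absorbed in the vector of `H`, so a list of length `n
  -- + 1` gives the factors from `θⁿ` down to `θ`.
  refine ⟨l.length, x, A.incl (x 0) h, ?_⟩
  rw [hx]
  generalize l.length = n
  induction n with
  | zero =>
    change S.X [x 0] h = S.X [] (A.incl (x 0) h)
    rw [X_singleton S h1]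
    rfl
  | succ n ih =>
    have hl : ∀ F : ℕ → S.B hτ h1, ((List.range (n + 1)).map F).prod =
        F 0 * ((List.range n).map (F ∘ Nat.succ)).prod := fun F => by
      rw [List.range_succ_eq_map, List.map_cons, List.map_map, List.prod_cons]
    rw [List.range_succ (n := n + 1), List.map_append, hl]
    have h2 : ((fun j => (S.dilationEndo hτ h1 hn)^[n + 1 - j]
      ⟨extendOp S.V (x (n + 1 - j)), S.extendOp_mem_B hτ h1 (x (n + 1 - j))⟩) ∘ Nat.succ) =
      fun j => (S.dilationEndo hτ h1 hn)^[n - j]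
      ⟨extendOp S.V (x (n - j)), S.extendOp_mem_B hτ h1 (x (n - j))⟩ := by
      funext j
      simp only [Function.comp_apply, Nat.succ_eq_add_one, Nat.add_sub_add_right]
    rw [h2]
    have h3 := S.finiteShift_iterate_base_comp_X hτ h1 (x (n + 1)) (n + 1)
      (w := (List.range (n + 1)).map x) (by simp)
    rw [← S.dilationEndo_iterate hτ h1 hn] at h3
    refine (congrArg (fun T : H →L[ℂ] S.K => T h) h3).symm.trans ?_
    exact congrArg _ ih

end DilationSpace

/-! ### Existence of minimal dilations -/

theorem nonempty_minimalDilation {H : Type u} [NormedAddCommGroup H] [InnerProductSpace ℂ H]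
    [CompleteSpace H] {A : VonNeumannAlgebra H} {τ : Module.End ℂ A} (hτ : IsVectorCP A τ)
    (h1 : τ 1 = 1) (hn : IsNormalMap A τ) : Nonempty (MinimalDilation A τ) := by
  obtain ⟨S⟩ := nonempty_dilationSpace hτ h1
  refine ⟨{
    K := S.K
    V := S.V
    B := S.B hτ h1
    θ := S.dilationEndo hτ h1 hn
    normal := ?_
    extend_mem := S.extendOp_mem_B hτ h1
    compress_mem := fun z => S.mem_coeffSpace_of_mem_B hτ h1 z.2 [] []
    dilation := fun n x => ?_
    space_minimal := ?_
    algebra_minimal := ?_ }⟩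
  · exact isNormalMap_of_dense_span (S.B hτ h1) _ (s := Set.univ)
      (by simp) fun u _ w _ =>
        S.isUltraweakFor_shiftRep hτ h1 hn u w
  · rw [S.dilationEndo_iterate hτ h1 hn]
    exact (S.adjoint_V_finiteShift_iterate hτ h1 x n).symm
  · refine top_unique fun y _ => ?_
    refine closure_mono ?_ (S.dense_span_X y)
    refine Submodule.span_mono ?_
    rintro _ ⟨v, h, rfl⟩
    exact S.exists_prod_eq hτ h1 hn v h
  · have h2 : (S.dilationAlgebra hτ h1 : Set (S.K →L[ℂ] S.K)) = StarAlgebra.adjoin ℂ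
        {z | ∃ (n : ℕ) (x : A), z = (((S.dilationEndo hτ h1 hn)^[n]
          ⟨extendOp S.V x, S.extendOp_mem_B hτ h1 x⟩ : S.B hτ h1) : S.K →L[ℂ] S.K)} := by
      rw [DilationSpace.dilationAlgebra, StarAlgHom.map_adjoin]
      congr 2
      ext z
      simp only [S.dilationEndo_iterate hτ h1 hn]
      constructor
      · rintro ⟨_, ⟨n, a, rfl⟩, rfl⟩
        exact ⟨n, a, rfl⟩
      · rintro ⟨n, a, rfl⟩
        exact ⟨_, ⟨n, a, rfl⟩, rfl⟩
    rw [StarSubalgebra.coe_bicommutant, h2, centralizer_adjoin]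
    ext z
    rw [Set.mem_star]
    have h3 : ∀ (n : ℕ) (x : A), star (((S.dilationEndo hτ h1 hn)^[n]
        ⟨extendOp S.V x, S.extendOp_mem_B hτ h1 x⟩ : S.B hτ h1) : S.K →L[ℂ] S.K) =
        (((S.dilationEndo hτ h1 hn)^[n] ⟨extendOp S.V (star x : A),
          S.extendOp_mem_B hτ h1 (star x)⟩ : S.B hτ h1) : S.K →L[ℂ] S.K) := by
      intro n x
      induction n with
      | zero => exact DilationSpace.star_extendOp _ _
      | succ n ih =>
        rw [Function.iterate_succ_apply', Function.iterate_succ_apply']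
        refine (congrArg Subtype.val (map_star (S.dilationEndo hτ h1 hn) _)).symm.trans ?_
        exact congrArg (fun y => (S.dilationEndo hτ h1 hn y).1) (Subtype.ext ih)
    constructor
    · rintro ⟨n, x, h⟩
      exact ⟨n, star x, by rw [← h3, ← h, star_star]⟩
    · rintro ⟨n, x, rfl⟩
      exact ⟨n, star x, h3 n x⟩

/-! ### Weak operator limits -/

section WeakLimit

variable {K : Type*} [NormedAddCommGroup K] [InnerProductSpace ℂ K]

theorem norm_inner_apply_le {b : K →L[ℂ] K} {C : ℝ} (hb : ‖b‖ ≤ C) (u w : K) :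
    ‖⟪u, b w⟫_ℂ‖ ≤ C * (‖u‖ * ‖w‖) := by
  calc ‖⟪u, b w⟫_ℂ‖ ≤ ‖u‖ * (‖b‖ * ‖w‖) := (norm_inner_le_norm _ _).trans (by
        gcongr; exact b.le_opNorm w)
    _ ≤ ‖u‖ * (C * ‖w‖) := by gcongr
    _ = C * (‖u‖ * ‖w‖) := by ring

/-- Bounded sets of operators are relatively compact in the weak operator topology. -/
theorem exists_tendsto_inner [CompleteSpace K] {ι : Type*} (b : ι → K →L[ℂ] K) {C : ℝ}
    (hb : ∀ i, ‖b i‖ ≤ C) (F : Ultrafilter ι) : ∃ z : K →L[ℂ] K, ∀ u w,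
      Tendsto (fun i => ⟪u, b i w⟫_ℂ) F (𝓝 ⟪u, z w⟫_ℂ) := by
  have hC : 0 ≤ C := by
    obtain ⟨i, -⟩ := F.nonempty_of_mem univ_mem
    exact (norm_nonneg _).trans (hb i)
  have hlim : ∀ u w, ∃ c : ℂ, ‖c‖ ≤ C * (‖u‖ * ‖w‖) ∧
      Tendsto (fun i => ⟪u, b i w⟫_ℂ) F (𝓝 c) := by
    intro u w
    obtain ⟨c, hc, h⟩ := (isCompact_closedBall (0 : ℂ) (C * (‖u‖ * ‖w‖))).ultrafilter_le_nhds
      (F.map fun i => ⟪u, b i w⟫_ℂ) (by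
        rw [Ultrafilter.coe_map, le_principal_iff]
        refine mem_map.2 (Eventually.of_forall fun i => ?_)
        simpa using norm_inner_apply_le (hb i) u w)
    exact ⟨c, by simpa using hc, h⟩
  choose c hcn hc using hlim
  let φ : K →ₗ⋆[ℂ] K →ₗ[ℂ] ℂ := LinearMap.mk₂'ₛₗ (starRingEnd ℂ) (RingHom.id ℂ) c
    (fun u u' w => tendsto_nhds_unique (hc _ _) (by
      simpa [inner_add_left] using (hc u w).add (hc u' w)))
    (fun a u w => tendsto_nhds_unique (hc _ _) (by
      simpa [inner_smul_left, mul_comm] using (hc u w).const_mul (starRingEnd ℂ a)))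
    (fun u w w' => tendsto_nhds_unique (hc _ _) (by
      simpa [inner_add_right] using (hc u w).add (hc u w')))
    (fun a u w => tendsto_nhds_unique (hc _ _) (by
      simpa [inner_smul_right] using (hc u w).const_mul a))
  obtain ⟨z, hz⟩ := exists_operator_of_form (LinearMap.id : K →ₗ[ℂ] K)
    Function.surjective_id.denseRange φ hC fun u w => by
      have h2 : -(C * (‖u‖ * ‖w‖)) ≤ (φ u w).re :=
        (abs_le.1 ((Complex.abs_re_le_norm _).trans (hcn u w))).1
      simp only [LinearMap.id_apply]
      nlinarith [mul_nonneg hC (sq_nonneg (‖u‖ - ‖w‖))]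
  refine ⟨z, fun u w => ?_⟩
  have h2 : ⟪u, z w⟫_ℂ = c u w := hz u w
  rw [h2]
  exact hc u w

end WeakLimit

/-! ### Compression to a subspace and extension by zero -/

section Compression

variable {H : Type u} [NormedAddCommGroup H] [InnerProductSpace ℂ H] [CompleteSpace H]
  {K : Type u} [NormedAddCommGroup K] [InnerProductSpace ℂ K] [CompleteSpace K] (V : H →ₗᵢ[ℂ] K)

theorem adjoint_apply_apply (h : H) : adjoint V.toContinuousLinearMap (V h) = h :=
  congrArg (fun T : H →L[ℂ] H => T h) V.adjoint_comp_self

theorem extendOp_apply (x : H →L[ℂ] H) (v : K) :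
    extendOp V x v = V (x (adjoint V.toContinuousLinearMap v)) := rfl

theorem compressOp_apply (z : K →L[ℂ] K) (h : H) :
    compressOp V z h = adjoint V.toContinuousLinearMap (z (V h)) := rfl

theorem compressOp_extendOp (x : H →L[ℂ] H) : compressOp V (extendOp V x) = x := by
  ext h
  rw [compressOp_apply, extendOp_apply, adjoint_apply_apply, adjoint_apply_apply]

theorem extendOp_compressOp (z : K →L[ℂ] K) :
    extendOp V (compressOp V z) = extendOp V 1 * z * extendOp V 1 := rfl

theorem extendOp_mul (x y : H →L[ℂ] H) : extendOp V (x * y) = extendOp V x * extendOp V y := by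
  ext v
  simp only [mul_apply_eq_comp, extendOp_apply, adjoint_apply_apply]

theorem norm_adjoint_le : ‖adjoint V.toContinuousLinearMap‖ ≤ 1 := by
  rw [LinearIsometryEquiv.norm_map]
  exact V.norm_toContinuousLinearMap_le

theorem norm_extendOp_le (x : H →L[ℂ] H) : ‖extendOp V x‖ ≤ ‖x‖ := by
  calc ‖extendOp V x‖ ≤ ‖V.toContinuousLinearMap‖ * (‖x‖ * ‖adjoint V.toContinuousLinearMap‖) :=
        (ContinuousLinearMap.opNorm_comp_le _ _).trans (by
          gcongr; exact ContinuousLinearMap.opNorm_comp_le _ _)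
    _ ≤ 1 * (‖x‖ * 1) := by
      gcongr
      exacts [V.norm_toContinuousLinearMap_le, norm_adjoint_le V]
    _ = ‖x‖ := by ring

theorem norm_compressOp_le (z : K →L[ℂ] K) : ‖compressOp V z‖ ≤ ‖z‖ := by
  calc ‖compressOp V z‖ ≤ ‖adjoint V.toContinuousLinearMap‖ * (‖z‖ * ‖V.toContinuousLinearMap‖) :=
        (ContinuousLinearMap.opNorm_comp_le _ _).trans (by
          gcongr; exact ContinuousLinearMap.opNorm_comp_le _ _)
    _ ≤ 1 * (‖z‖ * 1) := by
      gcongr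
      exacts [norm_adjoint_le V, V.norm_toContinuousLinearMap_le]
    _ = ‖z‖ := by ring

end Compression

/-! ### The projections `θⁿ(p)` and their strong convergence to the identity -/

namespace MinimalDilation

variable {H : Type u} [NormedAddCommGroup H] [InnerProductSpace ℂ H] [CompleteSpace H]
  {A : VonNeumannAlgebra H} {τ : Module.End ℂ A} (D : MinimalDilation A τ)

/-- The compression map, as a bounded linear map. -/
def compressL : D.B →L[ℂ] A :=
  LinearMap.mkContinuous
    { toFun := D.compress
      map_add' := fun z w => Subtype.ext (by
        change compressOp D.V (z.1 + w.1) = compressOp D.V z.1 + compressOp D.V w.1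
        rw [compressOp, ContinuousLinearMap.add_comp, ContinuousLinearMap.comp_add]
        rfl)
      map_smul' := fun a z => Subtype.ext (by
        change compressOp D.V (a • z.1) = a • compressOp D.V z.1
        rw [compressOp, ContinuousLinearMap.smul_comp, ContinuousLinearMap.comp_smul]
        rfl) } 1 fun z => by
    rw [one_mul]
    exact norm_compressOp_le D.V z.1

theorem compressL_apply (z : D.B) : D.compressL z = D.compress z := rfl

theorem norm_compress_le (z : D.B) : ‖D.compress z‖ ≤ ‖z‖ := norm_compressOp_le D.V z.1

theorem compress_star (z : D.B) : D.compress (star z) = star (D.compress z) := by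
  refine Subtype.ext ?_
  change compressOp D.V (star z.1) = star (compressOp D.V z.1)
  simp [compressOp, ContinuousLinearMap.star_eq_adjoint, ContinuousLinearMap.adjoint_comp,
    ContinuousLinearMap.comp_assoc]

theorem inner_compress (z : D.B) (h g : H) :
    ⟪h, (D.compress z).1 g⟫_ℂ = ⟪D.V h, z.1 (D.V g)⟫_ℂ := by
  have h2 : (D.compress z).1 g = adjoint D.V.toContinuousLinearMap (z.1 (D.V g)) := rfl
  rw [h2, ContinuousLinearMap.adjoint_inner_right]
  rfl

/-- The operator `p x p`, as an element of the algebra of the dilation. -/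
def emb : A →ₗ[ℂ] D.B where
  toFun x := ⟨extendOp D.V x, D.extend_mem x⟩
  map_add' x y := Subtype.ext (by
    change extendOp D.V (x.1 + y.1) = extendOp D.V x.1 + extendOp D.V y.1
    rw [extendOp, ContinuousLinearMap.add_comp, ContinuousLinearMap.comp_add]
    rfl)
  map_smul' a x := Subtype.ext (by
    change extendOp D.V (a • x.1) = a • extendOp D.V x.1
    rw [extendOp, ContinuousLinearMap.smul_comp, ContinuousLinearMap.comp_smul]
    rfl)

theorem emb_mul (x y : A) : D.emb (x * y) = D.emb x * D.emb y :=
  Subtype.ext (extendOp_mul D.V x.1 y.1)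

theorem emb_star (x : A) : D.emb (star x) = star (D.emb x) :=
  Subtype.ext (DilationSpace.star_extendOp D.V x.1).symm

theorem norm_emb_le (x : A) : ‖D.emb x‖ ≤ ‖x‖ := norm_extendOp_le D.V x.1

theorem compress_emb (x : A) : D.compress (D.emb x) = x :=
  Subtype.ext (compressOp_extendOp D.V x.1)

theorem emb_compress (z : D.B) : D.emb (D.compress z) = D.emb 1 * z * D.emb 1 :=
  Subtype.ext (extendOp_compressOp D.V z.1)

/-- The powers of `θ`. -/
def iter : ℕ → D.B →⋆ₐ[ℂ] D.B
  | 0 => StarAlgHom.id ℂ D.B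
  | n + 1 => D.θ.comp (iter n)

theorem iter_zero (z : D.B) : D.iter 0 z = z := rfl

theorem iter_succ (n : ℕ) (z : D.B) : D.iter (n + 1) z = D.θ (D.iter n z) := rfl

theorem iter_eq (n : ℕ) (z : D.B) : D.iter n z = D.θ^[n] z := by
  induction n with
  | zero => rfl
  | succ n ih => rw [iter_succ, ih, Function.iterate_succ_apply']

theorem iter_add (m n : ℕ) (z : D.B) : D.iter (m + n) z = D.iter m (D.iter n z) := by
  simp only [iter_eq, Function.iterate_add_apply]

theorem norm_iter_le (n : ℕ) (z : D.B) : ‖D.iter n z‖ ≤ ‖z‖ :=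
  NonUnitalStarAlgHom.norm_apply_le (D.iter n) z

theorem compress_iter_emb (n : ℕ) (x : A) : D.compress (D.iter n (D.emb x)) = (τ ^ n) x := by
  rw [iter_eq]
  exact Subtype.ext (D.dilation n x).symm

theorem norm_map_le (D : MinimalDilation A τ) (x : A) : ‖τ x‖ ≤ ‖x‖ := by
  have h2 := D.compress_iter_emb 1 x
  rw [pow_one] at h2
  rw [← h2]
  exact (D.norm_compress_le _).trans ((D.norm_iter_le _ _).trans (D.norm_emb_le x))

/-- The increasing sequence of projections `θⁿ(p)`. -/
def proj (n : ℕ) : D.B := D.iter n (D.emb 1)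

theorem proj_add (m n : ℕ) : D.iter m (D.proj n) = D.proj (m + n) := by
  rw [proj, proj, iter_add]

theorem star_proj (n : ℕ) : star (D.proj n) = D.proj n := by
  rw [proj, ← map_star, ← emb_star, star_one]

theorem proj_mul_self (n : ℕ) : D.proj n * D.proj n = D.proj n := by
  rw [proj, ← map_mul, ← emb_mul, one_mul]

theorem inner_proj_right (n : ℕ) (u w : D.K) :
    ⟪u, (D.proj n).1 w⟫_ℂ = ⟪(D.proj n).1 u, w⟫_ℂ := by
  have h2 : adjoint (D.proj n).1 = (D.proj n).1 := congrArg Subtype.val (D.star_proj n)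
  rw [← ContinuousLinearMap.adjoint_inner_right, h2]

theorem norm_proj_apply_sq (n : ℕ) (u : D.K) :
    ((‖(D.proj n).1 u‖ ^ 2 : ℝ) : ℂ) = ⟪u, (D.proj n).1 u⟫_ℂ := by
  have h2 : (D.proj n).1 ((D.proj n).1 u) = (D.proj n).1 u :=
    congrArg (fun T : D.B => T.1 u) (D.proj_mul_self n)
  rw [← h2, inner_proj_right, h2, inner_self_eq_norm_sq_to_K]
  norm_cast

theorem norm_proj_apply_le (n : ℕ) (u : D.K) : ‖(D.proj n).1 u‖ ≤ ‖u‖ := by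
  have h2 := D.norm_proj_apply_sq n u
  have h3 : ‖(D.proj n).1 u‖ ^ 2 ≤ ‖u‖ * ‖(D.proj n).1 u‖ := by
    have h4 := norm_inner_le_norm (𝕜 := ℂ) u ((D.proj n).1 u)
    rw [← h2, Complex.norm_real, Real.norm_of_nonneg (by positivity)] at h4
    exact h4
  nlinarith [norm_nonneg ((D.proj n).1 u), norm_nonneg u]

theorem proj_apply_eq_of_inner {n : ℕ} {u : D.K} (h : ⟪u, (D.proj n).1 u⟫_ℂ = ⟪u, u⟫_ℂ) :
    (D.proj n).1 u = u := by
  have h2 : ⟪(D.proj n).1 u, (D.proj n).1 u⟫_ℂ = ⟪u, u⟫_ℂ := by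
    rw [← h, ← inner_proj_right]
    exact congrArg (fun T : D.B => ⟪u, T.1 u⟫_ℂ) (D.proj_mul_self n)
  rw [← sub_eq_zero, ← inner_self_eq_zero (𝕜 := ℂ)]
  simp only [inner_sub_left, inner_sub_right]
  rw [h2, h, ← inner_proj_right, h]
  ring

theorem pow_apply_one {M : Type*} [AddCommGroup M] [Module ℂ M] {τ : Module.End ℂ M} {x : M}
    (h : τ x = x) (n : ℕ) : (τ ^ n) x = x := by
  induction n with
  | zero => rfl
  | succ n ih => rw [pow_succ, Module.End.mul_apply, h, ih]

/-- The compression of `θⁿ(p)` is `τⁿ(1) = 1`, and a projection that preserves `⟪u, u⟫` fixes `u`.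
-/
theorem proj_apply_V (h1 : τ 1 = 1) (n : ℕ) (h : H) : (D.proj n).1 (D.V h) = D.V h := by
  refine D.proj_apply_eq_of_inner ?_
  rw [← inner_compress, proj, compress_iter_emb, pow_apply_one h1, LinearIsometry.inner_map_map]
  rfl

theorem proj_mul_emb (h1 : τ 1 = 1) (n : ℕ) (x : A) : D.proj n * D.emb x = D.emb x :=
  Subtype.ext (ContinuousLinearMap.ext fun _ => D.proj_apply_V h1 n _)

theorem proj_mul_iter_emb (h1 : τ 1 = 1) {n m : ℕ} (hnm : n ≤ m) (x : A) :
    D.proj m * D.iter n (D.emb x) = D.iter n (D.emb x) := by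
  obtain ⟨j, rfl⟩ := Nat.exists_eq_add_of_le hnm
  rw [← proj_add, ← map_mul, proj_mul_emb D h1]

theorem compress_proj_mul (h1 : τ 1 = 1) (n : ℕ) (z : D.B) :
    D.compress (D.proj n * z * D.proj n) = D.compress z := by
  refine Subtype.ext (ContinuousLinearMap.ext fun g => ext_inner_left ℂ fun h => ?_)
  rw [inner_compress, inner_compress]
  have : (D.proj n * z * D.proj n).1 (D.V g) = (D.proj n).1 (z.1 ((D.proj n).1 (D.V g))) := rfl
  rw [this, proj_apply_V D h1, inner_proj_right, proj_apply_V D h1]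

theorem iter_emb_compress (n : ℕ) (z : D.B) :
    D.iter n (D.emb (D.compress z)) = D.proj n * D.iter n z * D.proj n := by
  rw [emb_compress, map_mul, map_mul]
  rfl

/-- The dilation property only concerns elements of `p B p`. It extends to all of `B` because
replacing `z` by `p z p` changes `θⁿ(z)` to its corner by `θⁿ(p) ≥ p`, which has the same
compression. -/
theorem compress_iter (h1 : τ 1 = 1) (n : ℕ) (z : D.B) :
    D.compress (D.iter n z) = (τ ^ n) (D.compress z) := by
  rw [← compress_iter_emb D, iter_emb_compress, compress_proj_mul D h1]

theorem compress_θ (h1 : τ 1 = 1) (z : D.B) : D.compress (D.θ z) = τ (D.compress z) := by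
  simpa using! D.compress_iter h1 1 z

/-- The vectors which belong to the range of some projection `θⁿ(p)`. -/
def stableSpace : Submodule ℂ D.K where
  carrier := {v | ∃ n, ∀ m, n ≤ m → (D.proj m).1 v = v}
  add_mem' := by
    rintro v w ⟨n, hn⟩ ⟨n', hn'⟩
    refine ⟨max n n', fun m hm => ?_⟩
    rw [map_add, hn m (le_trans (le_max_left _ _) hm), hn' m (le_trans (le_max_right _ _) hm)]
  zero_mem' := ⟨0, fun m _ => map_zero _⟩
  smul_mem' := by
    rintro a v ⟨n, hn⟩
    exact ⟨n, fun m hm => by rw [map_smul, hn m hm]⟩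

/-- The leftmost factor `θⁿ(xₙ)` of a generating vector is fixed by left multiplication by `θᵐ(p)`
for `m ≥ n`; with no factors, the vector lies in `H`. -/
theorem dense_stableSpace (h1 : τ 1 = 1) : Dense (D.stableSpace : Set D.K) := by
  intro y
  have hy : y ∈ (⊤ : Submodule ℂ D.K) := trivial
  rw [← D.space_minimal] at hy
  refine closure_mono ?_ hy
  change _ ≤ D.stableSpace
  rw [Submodule.span_le]
  rintro _ ⟨n, x, h, rfl⟩
  refine ⟨n, fun m hm => ?_⟩
  cases n with
  | zero => exact D.proj_apply_V h1 m h
  | succ n =>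
    rw [List.range_succ_eq_map, List.map_cons, List.prod_cons, Nat.sub_zero]
    have h2 := D.proj_mul_iter_emb h1 hm (x (n + 1))
    rw [iter_eq] at h2
    have h3 : ∀ r : D.B, (D.proj m).1 ((D.θ^[n + 1] (D.emb (x (n + 1))) * r).1 (D.V h)) =
        (D.θ^[n + 1] (D.emb (x (n + 1))) * r).1 (D.V h) := fun r =>
      congrArg (fun T : D.B => (T * r).1 (D.V h)) h2
    exact h3 _

theorem tendsto_proj_apply (h1 : τ 1 = 1) (v : D.K) : Tendsto (fun n => (D.proj n).1 v) atTop (𝓝 v) := by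
  rw [Metric.tendsto_atTop]
  intro ε hε
  obtain ⟨w, hw, n, hn⟩ := Metric.dense_iff.1 (D.dense_stableSpace h1) v (ε / 2) (by positivity)
  refine ⟨n, fun m hm => ?_⟩
  rw [Metric.mem_ball', dist_eq_norm] at hw
  have h2 : (D.proj m).1 v - v = (D.proj m).1 (v - w) - (v - w) := by
    rw [map_sub, hn m hm]
    abel
  rw [dist_eq_norm, h2]
  calc _ ≤ ‖(D.proj m).1 (v - w)‖ + ‖v - w‖ := norm_sub_le _ _
    _ ≤ ‖v - w‖ + ‖v - w‖ := by gcongr; exact D.norm_proj_apply_le m _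
    _ < ε := by linarith

end MinimalDilation

/-! ### Peripheral eigenvectors of a linear map -/

section PeripheralSpace

variable {M : Type u} [NormedAddCommGroup M] [NormedSpace ℂ M] {G : Subgroup Circle}
  {τ : Module.End ℂ M}

theorem pow_apply_of_eigenvector {x : M} {l : ℂ} (h : τ x = l • x) (n : ℕ) :
    (τ ^ n) x = l ^ n • x := by
  induction n with
  | zero => simp
  | succ n ih => rw [pow_succ, Module.End.mul_apply, h, map_smul, ih, smul_smul, pow_succ']

theorem mem_peripheralSpan {x : M} {l : Circle} (hl : l ∈ G) (h : τ x = (l : ℂ) • x) :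
    x ∈ peripheralSpan G τ := Submodule.subset_span ⟨l, hl, h⟩

theorem mem_peripheralSpace {x : M} {l : Circle} (hl : l ∈ G) (h : τ x = (l : ℂ) • x) :
    x ∈ peripheralSpace G τ := Submodule.le_topologicalClosure _ (mem_peripheralSpan hl h)

theorem peripheralSpace_mono {G' : Subgroup Circle} (h : G ≤ G') :
    peripheralSpace G τ ≤ peripheralSpace G' τ := by
  refine Submodule.topologicalClosure_mono (Submodule.span_mono ?_)
  rintro x ⟨l, hl, hx⟩
  exact ⟨l, h hl, hx⟩

theorem exists_sum_of_mem_peripheralSpan {x : M} (hx : x ∈ peripheralSpan G τ) :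
    ∃ (n : ℕ) (l : Fin n → Circle) (y : Fin n → M),
      (∀ i, τ (y i) = (l i : ℂ) • y i) ∧ x = ∑ i, y i := by
  obtain ⟨n, f, g, rfl⟩ := Submodule.mem_span_set'.1 hx
  choose l hl using fun i => (g i).2
  exact ⟨n, l, fun i => f i • (g i).1, fun i => by rw [map_smul, (hl i).2, smul_comm], rfl⟩

theorem isClosed_peripheralSpace : IsClosed (peripheralSpace G τ : Set M) :=
  Submodule.isClosed_topologicalClosure _

theorem peripheralSpace_le {S : Submodule ℂ M} (hS : IsClosed (S : Set M))
    (h : ∀ x, ∀ l ∈ G, τ x = ((l : Circle) : ℂ) • x → x ∈ S) : peripheralSpace G τ ≤ S := by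
  refine Submodule.topologicalClosure_minimal _ (Submodule.span_le.2 ?_) hS
  rintro x ⟨l, hl, hx⟩
  exact h x l hl hx

/-- Bounded linear maps which agree on peripheral eigenvectors are equal. -/
theorem peripheralSpace_ext {E : Type*} [NormedAddCommGroup E] [NormedSpace ℂ E]
    {f g : peripheralSpace G τ →L[ℂ] E}
    (h : ∀ (x : M) (l : Circle) (hl : l ∈ G) (hx : τ x = (l : ℂ) • x),
      f ⟨x, mem_peripheralSpace hl hx⟩ = g ⟨x, mem_peripheralSpace hl hx⟩) : f = g := by
  let S : Submodule ℂ M := (LinearMap.ker (f - g).toLinearMap).map (peripheralSpace G τ).subtype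
  have hS : IsClosed (S : Set M) :=
    (isClosed_peripheralSpace.isClosedEmbedding_subtypeVal).isClosedMap _ (f - g).isClosed_ker
  have hle : peripheralSpace G τ ≤ S := peripheralSpace_le hS fun x l hl hx =>
    ⟨⟨x, mem_peripheralSpace hl hx⟩, by
      change f _ - g _ = 0
      rw [h x l hl hx, sub_self], rfl⟩
  ext x
  obtain ⟨y, hy, hyx⟩ := hle x.2
  obtain rfl : y = x := Subtype.ext hyx
  exact sub_eq_zero.1 hy

end PeripheralSpace

/-! ### Lifting of eigenvectors and the isometry of the compression -/

namespace MinimalDilation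

variable {H : Type u} [NormedAddCommGroup H] [InnerProductSpace ℂ H] [CompleteSpace H]
  {A : VonNeumannAlgebra H} {τ : Module.End ℂ A} (D : MinimalDilation A τ)

theorem iter_eigenvector {z : D.B} {l : ℂ} (h : D.θ z = l • z) (n : ℕ) :
    D.iter n z = l ^ n • z := by
  induction n with
  | zero => rw [iter_zero, pow_zero, one_smul]
  | succ n ih => rw [iter_succ, ih, map_smul, h, smul_smul, pow_succ]

theorem inner_proj_mul (n : ℕ) (z : D.B) (u w : D.K) :
    ⟪u, (D.proj n * z * D.proj n).1 w⟫_ℂ = ⟪(D.proj n).1 u, z.1 ((D.proj n).1 w)⟫_ℂ := by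
  rw [← inner_proj_right]
  rfl

theorem tendsto_inner_proj (h1 : τ 1 = 1) (z : D.B) (u w : D.K) :
    Tendsto (fun n => ⟪u, (D.proj n * z * D.proj n).1 w⟫_ℂ) atTop (𝓝 ⟪u, z.1 w⟫_ℂ) := by
  simp_rw [inner_proj_mul]
  exact (D.tendsto_proj_apply h1 u).inner
    ((z.1.continuous.tendsto w).comp (D.tendsto_proj_apply h1 w))

theorem ext_proj (h1 : τ 1 = 1) {z w : D.B} (h : ∀ n, D.proj (n + 1) * z * D.proj (n + 1) =
    D.proj (n + 1) * w * D.proj (n + 1)) : z = w := by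
  refine Subtype.ext (ContinuousLinearMap.ext fun v => ext_inner_left ℂ fun u => ?_)
  refine tendsto_nhds_unique ((D.tendsto_inner_proj h1 z u v).comp (tendsto_add_atTop_nat 1)) ?_
  simp only [Function.comp_def, h]
  exact (D.tendsto_inner_proj h1 w u v).comp (tendsto_add_atTop_nat 1)

theorem proj_mul_eigenvector {z : D.B} {l : Circle} (h : D.θ z = (l : ℂ) • z) (n : ℕ) :
    D.proj n * z * D.proj n = ((l : ℂ)⁻¹ ^ n) • D.iter n (D.emb (D.compress z)) := by
  rw [iter_emb_compress, D.iter_eigenvector h, mul_smul_comm, smul_mul_assoc, smul_smul, ← mul_pow,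
    inv_mul_cancel₀ l.coe_ne_zero, one_pow, one_smul]

/-- A peripheral eigenvector of `τ` is the compression of an eigenvector of `θ`. -/
theorem exists_eigenvector (h1 : τ 1 = 1) {x : A} {l : Circle} (hx : τ x = (l : ℂ) • x) :
    ∃ z : D.B, D.θ z = (l : ℂ) • z ∧ D.compress z = x := by
  let y : ℕ → D.B := fun n => ((l : ℂ)⁻¹ ^ n) • D.iter n (D.emb x)
  -- The candidates are compatible: each is the corner of all later ones, because compressing
  -- `θʲ(x)` gives `τʲ(x) = lʲ x`.
  have hy : ∀ {m n}, m ≤ n → D.proj m * y n * D.proj m = y m := by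
    intro m n hmn
    obtain ⟨j, rfl⟩ := Nat.exists_eq_add_of_le hmn
    have h2 := D.iter_emb_compress m (D.iter j (D.emb x))
    rw [compress_iter_emb, pow_apply_of_eigenvector hx, map_smul, map_smul, ← iter_add] at h2
    simp only [y]
    rw [mul_smul_comm, smul_mul_assoc, ← h2, smul_smul, pow_add, mul_assoc, ← mul_pow,
      inv_mul_cancel₀ l.coe_ne_zero, one_pow, mul_one]
  have hyn : ∀ n, ‖(y n).1‖ ≤ ‖x‖ := by
    intro n
    change ‖y n‖ ≤ _
    rw [norm_smul, norm_pow, norm_inv, Circle.norm_coe, inv_one, one_pow, one_mul]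
    exact (D.norm_iter_le _ _).trans (D.norm_emb_le x)
  obtain ⟨z, hz⟩ := exists_tendsto_inner (fun n => (y n).1) hyn (hyperfilter ℕ)
  have hzB : z ∈ D.B := by
    rw [← SetLike.mem_coe, ← D.B.centralizer_centralizer]
    intro c hc
    have hc' : ∀ b ∈ D.B, b * c = c * b := hc
    refine ContinuousLinearMap.ext fun w => ext_inner_left ℂ fun u => ?_
    change ⟪u, c (z w)⟫_ℂ = ⟪u, z (c w)⟫_ℂ
    refine tendsto_nhds_unique ?_ (hz u (c w))
    rw [← ContinuousLinearMap.adjoint_inner_left]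
    refine (hz (adjoint c u) w).congr fun n => ?_
    rw [ContinuousLinearMap.adjoint_inner_left]
    exact congrArg (fun T : D.K →L[ℂ] D.K => ⟪u, T w⟫_ℂ) (hc' _ (y n).2).symm
  let z' : D.B := ⟨z, hzB⟩
  have hzy : ∀ m, D.proj m * z' * D.proj m = y m := by
    intro m
    refine Subtype.ext (ContinuousLinearMap.ext fun w => ext_inner_left ℂ fun u => ?_)
    rw [inner_proj_mul]
    refine tendsto_nhds_unique (hz _ _) ?_
    refine tendsto_const_nhds.congr' ?_
    refine Nat.hyperfilter_le_atTop ?_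
    filter_upwards [eventually_ge_atTop m] with n hn
    rw [← inner_proj_mul, hy hn]
  -- Corners of index `n + 1` suffice for equality, and these are images under `θ` of the corners of
  -- index `n`.
  refine ⟨z', D.ext_proj h1 fun n => ?_, ?_⟩
  · have h2 : D.θ (D.proj n) = D.proj (n + 1) := rfl
    rw [mul_smul_comm, smul_mul_assoc, hzy, ← h2, ← map_mul, ← map_mul, hzy]
    simp only [y]
    rw [map_smul, iter_succ, smul_smul, pow_succ', ← mul_assoc, mul_inv_cancel₀ l.coe_ne_zero,
      one_mul]
  · have h2 := D.compress_proj_mul h1 0 z'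
    rw [hzy] at h2
    rw [← h2]
    simp only [y, pow_zero, one_smul, iter_zero]
    exact D.compress_emb x

/-- The `m`-th corner of `z = ∑ yᵢ` is `θᵐ` of `∑ lᵢ⁻ᵐ T yᵢ`. Since `1` is a cluster point of the
powers of `(lᵢ)` in the compact torus, these sums return arbitrarily close to `T z`, while the
corners tend weakly to `z`. -/
theorem norm_le_norm_compress_of_mem_span (h1 : τ 1 = 1) {z : D.B} (hz : z ∈ peripheralSpan ⊤ D.endo) :
    ‖z‖ ≤ ‖D.compress z‖ := by
  obtain ⟨n, l, y, hy, rfl⟩ := exists_sum_of_mem_peripheralSpan hz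
  let g : (Fin n → Circle) → A := fun c => ∑ i, ((c i)⁻¹ : ℂ) • D.compress (y i)
  have hg : Continuous g := by
    simp only [g, ← Circle.coe_inv]
    fun_prop
  have hg1 : g 1 = D.compress (∑ i, y i) := by
    simp only [g, Pi.one_apply, Circle.coe_one, inv_one, one_smul]
    exact (map_sum D.compressL y Finset.univ).symm
  have hproj : ∀ m, D.proj m * (∑ i, y i) * D.proj m = D.iter m (D.emb (g (l ^ m))) := by
    intro m
    simp only [g, Finset.mul_sum, Finset.sum_mul, map_sum, map_smul]
    refine Finset.sum_congr rfl fun i _ => ?_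
    rw [D.proj_mul_eigenvector (hy i)]
    simp
  obtain ⟨U, hU, hUl⟩ := mapClusterPt_iff_ultrafilter.1 (mapClusterPt_one_atTop_pow l)
  have hbd : ∀ u w : D.K, ‖⟪u, (∑ i, y i : D.B).1 w⟫_ℂ‖ ≤ ‖D.compress (∑ i, y i)‖ * (‖u‖ * ‖w‖) := by
    intro u w
    refine le_of_tendsto_of_tendsto' (((D.tendsto_inner_proj h1 (∑ i, y i) u w).mono_left hU).norm)
      ((((hg.tendsto 1).comp hUl).norm).mul_const (‖u‖ * ‖w‖) |>.trans ?_) fun m => ?_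
    · rw [hg1]
    · rw [hproj]
      exact norm_inner_apply_le ((D.norm_iter_le m _).trans (D.norm_emb_le _)) u w
  refine ContinuousLinearMap.opNorm_le_bound _ (norm_nonneg _) fun w => ?_
  have h2 := hbd ((∑ i, y i : D.B).1 w) w
  rw [inner_self_eq_norm_sq_to_K, norm_pow] at h2
  simp only [RCLike.norm_ofReal, abs_norm] at h2
  rcases (norm_nonneg ((∑ i, y i : D.B).1 w)).eq_or_lt with h0 | h0
  · exact h0.symm.le.trans (by positivity)
  · have h3 : ‖(∑ i, y i : D.B).1 w‖ ≤ ‖D.compress (∑ i, y i)‖ * ‖w‖ := by nlinarith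
    exact h3

theorem norm_compress_of_mem (h1 : τ 1 = 1) {z : D.B} (hz : z ∈ peripheralSpace ⊤ D.endo) :
    ‖D.compress z‖ = ‖z‖ := by
  refine le_antisymm (D.norm_compress_le z) ?_
  have hcl : IsClosed {z : D.B | ‖z‖ ≤ ‖D.compress z‖} :=
    isClosed_le continuous_norm D.compressL.continuous.norm
  exact closure_minimal (fun z hz => D.norm_le_norm_compress_of_mem_span h1 hz) hcl hz

theorem compress_mem_peripheralSpace (h1 : τ 1 = 1) {G : Subgroup Circle} {z : D.B}
    (hz : z ∈ peripheralSpace G D.endo) : D.compress z ∈ peripheralSpace G τ := by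
  have h2 : peripheralSpace G D.endo ≤ (peripheralSpace G τ).comap D.compressL.toLinearMap :=
    peripheralSpace_le (isClosed_peripheralSpace.preimage D.compressL.continuous)
      fun z l hl hz => mem_peripheralSpace hl (by
        change τ (D.compressL z) = _ • D.compressL z
        rw [← map_smul, ← hz, compressL_apply, compressL_apply, ← compress_θ D h1]
        rfl)
  exact h2 hz

/-- The compression map on the peripheral space of `θ`, as an isometry. -/
def compressIsometry (h1 : τ 1 = 1) : peripheralSpace ⊤ D.endo →ₗᵢ[ℂ] A where
  toLinearMap := D.compressL.toLinearMap ∘ₗ (peripheralSpace ⊤ D.endo).subtype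
  norm_map' z := D.norm_compress_of_mem h1 z.2

/-- An isometry of a complete space has closed range, so for surjectivity it suffices to reach the
eigenvectors. -/
theorem bijOn_compress (h1 : τ 1 = 1) : Set.BijOn D.compress (peripheralSpace ⊤ D.endo : Set D.B)
    (peripheralSpace ⊤ τ : Set A) := by
  refine ⟨fun z hz => D.compress_mem_peripheralSpace h1 hz, fun z hz w hw h => ?_, ?_⟩
  · exact congrArg Subtype.val ((D.compressIsometry h1).injective (a₁ := ⟨z, hz⟩) (a₂ := ⟨w, hw⟩) h)
  · have hcomplete : CompleteSpace (peripheralSpace ⊤ D.endo) :=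
      isClosed_peripheralSpace.completeSpace_coe
    have h2 : peripheralSpace ⊤ τ ≤ LinearMap.range (D.compressIsometry h1).toLinearMap := by
      refine peripheralSpace_le ?_ fun x l hl hx => ?_
      · exact (D.compressIsometry h1).isometry.isClosedEmbedding.isClosed_range
      · obtain ⟨z, hz, rfl⟩ := D.exists_eigenvector h1 hx
        exact ⟨⟨z, mem_peripheralSpace hl hz⟩, rfl⟩
    intro x hx
    obtain ⟨z, rfl⟩ := h2 hx
    exact ⟨z.1, z.2, rfl⟩

theorem compressesIsometrically (h1 : τ 1 = 1) : D.CompressesIsometrically :=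
  ⟨D.bijOn_compress h1, fun _ hz => D.norm_compress_of_mem h1 hz⟩

theorem lift_mem (h1 : τ 1 = 1) {x : A} (hx : x ∈ peripheralSpace ⊤ τ) : D.lift x ∈ peripheralSpace ⊤ D.endo :=
  Function.invFunOn_mem ((D.bijOn_compress h1).surjOn hx)

theorem compress_lift (h1 : τ 1 = 1) {x : A} (hx : x ∈ peripheralSpace ⊤ τ) : D.compress (D.lift x) = x :=
  Function.invFunOn_eq ((D.bijOn_compress h1).surjOn hx)

theorem lift_compress (h1 : τ 1 = 1) {z : D.B} (hz : z ∈ peripheralSpace ⊤ D.endo) : D.lift (D.compress z) = z :=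
  have hx := D.compress_mem_peripheralSpace h1 hz
  (D.bijOn_compress h1).injOn (D.lift_mem h1 hx) hz (D.compress_lift h1 hx)

/-- The map `T⁻¹` on the peripheral space of `τ`. -/
def liftL (h1 : τ 1 = 1) : peripheralSpace ⊤ τ →L[ℂ] D.B :=
  LinearMap.mkContinuous
    { toFun := fun x => D.lift x
      map_add' := fun x y => by
        have h2 := D.lift_compress h1 (add_mem (D.lift_mem h1 x.2) (D.lift_mem h1 y.2))
        rwa [← compressL_apply, map_add, compressL_apply, compressL_apply, D.compress_lift h1 x.2,
          D.compress_lift h1 y.2] at h2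
      map_smul' := fun a x => by
        have h2 := D.lift_compress h1 (Submodule.smul_mem _ a (D.lift_mem h1 x.2))
        rwa [← compressL_apply, map_smul, compressL_apply, D.compress_lift h1 x.2] at h2 } 1
    fun x => by
      have h2 := D.norm_compress_of_mem h1 (D.lift_mem h1 x.2)
      rw [D.compress_lift h1 x.2] at h2
      rw [one_mul]
      exact h2.symm.le

end MinimalDilation

/-! ### Peripheral spaces of powers -/

section Powers

variable {M : Type u} [NormedAddCommGroup M] [NormedSpace ℂ M] {τ : Module.End ℂ M} {k : ℕ}

theorem pow_apply_of_mem_cyclicGroup {G : Subgroup Circle} {x : M} {l : Circle}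
    (hx : τ x = (l : ℂ) • x) (hl : l ^ k ∈ G) : x ∈ peripheralSpan G (τ ^ k) :=
  mem_peripheralSpan hl (by rw [pow_apply_of_eigenvector hx, Circle.coe_pow])

/-- Applying `c⁻¹ τ` shifts the summation index, and the assumption makes the terms of index `0` and
`k` equal. -/
theorem map_sum_inv_pow_smul {x : M} {c : ℂ} (hc : c ≠ 0) (hx : (τ ^ k) x = c ^ k • x) :
    τ (∑ i ∈ Finset.range k, c⁻¹ ^ i • (τ ^ i) x) =
      c • ∑ i ∈ Finset.range k, c⁻¹ ^ i • (τ ^ i) x := by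
  have h2 : τ (∑ i ∈ Finset.range k, c⁻¹ ^ i • (τ ^ i) x) =
      c • ∑ i ∈ Finset.range k, c⁻¹ ^ (i + 1) • (τ ^ (i + 1)) x := by
    rw [map_sum, Finset.smul_sum]
    refine Finset.sum_congr rfl fun i _ => ?_
    rw [map_smul, pow_succ' τ, Module.End.mul_apply, smul_smul, pow_succ' c⁻¹, ← mul_assoc,
      mul_inv_cancel₀ hc, one_mul]
  have h3 : ∑ i ∈ Finset.range k, c⁻¹ ^ (i + 1) • (τ ^ (i + 1)) x =
      ∑ i ∈ Finset.range k, c⁻¹ ^ i • (τ ^ i) x := by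
    have h4 := Finset.sum_range_succ (fun i => c⁻¹ ^ i • (τ ^ i) x) k
    rw [Finset.sum_range_succ', hx, smul_smul, ← mul_pow, inv_mul_cancel₀ hc] at h4
    simpa using h4
  rw [h2, h3]

/-- Averaging over the orbit gives eigenvectors for each `l * w ^ j`; by orthogonality of the
characters of the cyclic group of order `k`, they add up to `k • x`. -/
theorem mem_peripheralSpan_of_pow {G : Subgroup Circle} {w : Circle}
    (hw : IsPrimitiveRoot w k) (hk : k ≠ 0) {x : M} {l : Circle}
    (hx : (τ ^ k) x = ((l ^ k : Circle) : ℂ) • x) (hG : ∀ j, l * w ^ j ∈ G) :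
    x ∈ peripheralSpan G τ := by
  let y : ℕ → M := fun j => ∑ i ∈ Finset.range k, (((l * w ^ j : Circle) : ℂ)⁻¹) ^ i • (τ ^ i) x
  have hy : ∀ j, y j ∈ peripheralSpan G τ := fun j => by
    refine mem_peripheralSpan (hG j) (map_sum_inv_pow_smul (Circle.coe_ne_zero _) ?_)
    rw [hx, ← Circle.coe_pow, mul_pow, ← pow_mul, mul_comm j k, pow_mul, hw.pow_eq_one, one_pow,
      mul_one]
  have hsum : ∀ i ∈ Finset.range k, ∑ j ∈ Finset.range k, (((l * w ^ j : Circle) : ℂ)⁻¹) ^ i =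
      if i = 0 then (k : ℂ) else 0 := by
    intro i hi
    split_ifs with h0
    · simp [h0]
    · have h2 : ∀ j, (((l * w ^ j : Circle) : ℂ)⁻¹) ^ i =
          (l : ℂ)⁻¹ ^ i * (((w ^ i : Circle) : ℂ)⁻¹) ^ j := fun j => by
        push_cast
        simp only [mul_inv, mul_pow, inv_pow, ← pow_mul, mul_comm i j]
      simp only [h2, ← Finset.mul_sum]
      refine mul_eq_zero_of_right _ ?_
      have h3 := geom_sum_mul (((w ^ i : Circle) : ℂ)⁻¹) k
      have h4 : (((w ^ i : Circle) : ℂ)⁻¹) ^ k = 1 := by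
        rw [inv_pow, ← Circle.coe_pow, ← pow_mul, mul_comm, pow_mul, hw.pow_eq_one, one_pow,
          Circle.coe_one, inv_one]
      rw [h4, sub_self] at h3
      refine (mul_eq_zero.1 h3).resolve_right fun h5 => ?_
      rw [sub_eq_zero, inv_eq_one, Circle.coe_eq_one] at h5
      exact hw.pow_ne_one_of_pos_of_lt h0 (Finset.mem_range.1 hi) h5
  have hx' : x = (k : ℂ)⁻¹ • ∑ j ∈ Finset.range k, y j := by
    simp only [y]
    rw [Finset.sum_comm]
    simp only [← Finset.sum_smul]
    rw [Finset.sum_congr rfl fun i hi => by rw [hsum i hi]]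
    simp only [ite_smul, zero_smul, Finset.sum_ite_eq', Finset.mem_range, Nat.pos_of_ne_zero hk,
      if_true, pow_zero, Module.End.one_apply]
    rw [smul_smul, inv_mul_cancel₀ (by exact_mod_cast hk), one_smul]
  rw [hx']
  exact Submodule.smul_mem _ _ (sum_mem fun j _ => hy j)

theorem isPrimitiveRoot_circleExp (hk : k ≠ 0) :
    IsPrimitiveRoot (Circle.exp (2 * Real.pi / k)) k := by
  have h2 := Complex.isPrimitiveRoot_exp k hk
  refine IsPrimitiveRoot.of_map_of_injective (f := Circle.coeHom) ?_ Circle.coe_injective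
  convert h2 using 1
  change ((Circle.exp (2 * Real.pi / k) : Circle) : ℂ) = _
  rw [Circle.coe_exp]
  push_cast
  congr 1
  ring

theorem Circle.exists_pow_eq (hk : k ≠ 0) (m : Circle) : ∃ l : Circle, l ^ k = m := by
  refine ⟨Circle.exp (Complex.arg m / k), ?_⟩
  rw [← Circle.exp_nsmul, nsmul_eq_mul, mul_div_cancel₀ _ (by exact_mod_cast hk), Circle.exp_arg]

theorem peripheralSpace_top_pow (hk : k ≠ 0) :
    peripheralSpace ⊤ (τ ^ k) = peripheralSpace ⊤ τ := by
  refine congrArg Submodule.topologicalClosure (le_antisymm ?_ ?_) <;>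
    refine Submodule.span_le.2 ?_ <;> rintro x ⟨l, -, hx⟩
  · obtain ⟨l, rfl⟩ := Circle.exists_pow_eq hk l
    exact mem_peripheralSpan_of_pow (isPrimitiveRoot_circleExp hk) hk hx fun _ => trivial
  · exact pow_apply_of_mem_cyclicGroup hx trivial

theorem peripheralSpace_bot_pow (hk : k ≠ 0) :
    peripheralSpace ⊥ (τ ^ k) = peripheralSpace (cyclicGroup k) τ := by
  have hw := isPrimitiveRoot_circleExp hk
  refine congrArg Submodule.topologicalClosure (le_antisymm ?_ ?_) <;>
    refine Submodule.span_le.2 ?_ <;> rintro x ⟨l, hl, hx⟩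
  · rw [Subgroup.mem_bot.1 hl] at hx
    -- For fixed points of `τ ^ k`, only the powers of `w` itself occur as eigenvalues.
    refine mem_peripheralSpan_of_pow hw hk (l := 1) (by rw [one_pow, hx]) fun j => ?_
    rw [one_mul]
    exact pow_mem (Subgroup.mem_zpowers _) j
  · obtain ⟨n, rfl⟩ := Subgroup.mem_zpowers_iff.1 hl
    refine pow_apply_of_mem_cyclicGroup hx ?_
    rw [Subgroup.mem_bot, ← zpow_natCast, zpow_comm, zpow_natCast, hw.pow_eq_one, one_zpow]

end Powers

/-! ### Independence of the product and the von Neumann algebra of fixed points -/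

namespace MinimalDilation

variable {H : Type u} [NormedAddCommGroup H] [InnerProductSpace ℂ H] [CompleteSpace H]
  {A : VonNeumannAlgebra H} {τ : Module.End ℂ A} (D : MinimalDilation A τ)

theorem mul_compress (h1 : τ 1 = 1) {z w : D.B} (hz : z ∈ peripheralSpace ⊤ D.endo)
    (hw : w ∈ peripheralSpace ⊤ D.endo) : D.mul (D.compress z) (D.compress w) =
      D.compress (z * w) := by
  rw [mul, D.lift_compress h1 hz, D.lift_compress h1 hw]

/-- The product of peripheral eigenvectors is determined by `τ`. -/
theorem tendsto_inner_mul (h1 : τ 1 = 1) {x y : A} {l m : Circle} (hx : τ x = (l : ℂ) • x)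
    (hy : τ y = (m : ℂ) • y) (h g : H) :
    Tendsto (fun n => ⟪h, (((l : ℂ)⁻¹ ^ n * (m : ℂ)⁻¹ ^ n) • A.incl ((τ ^ n) (x * y))) g⟫_ℂ) atTop
      (𝓝 ⟪h, A.incl (D.mul x y) g⟫_ℂ) := by
  obtain ⟨z, hz, rfl⟩ := D.exists_eigenvector h1 hx
  obtain ⟨w, hw, rfl⟩ := D.exists_eigenvector h1 hy
  rw [D.mul_compress h1 (mem_peripheralSpace (l := l) trivial hz)
    (mem_peripheralSpace (l := m) trivial hw)]
  -- The normalized iterate is the compression of the product of two corners. The outer projections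
  -- act trivially on `H`, so only the `θⁿ(p)` between `z` and `w` remains, and it tends strongly to
  -- `1`.
  have h2 : ∀ n, ((l : ℂ)⁻¹ ^ n * (m : ℂ)⁻¹ ^ n) • (τ ^ n) (D.compress z * D.compress w) =
      D.compress (D.proj n * z * D.proj n * (D.proj n * w * D.proj n)) := by
    intro n
    rw [D.proj_mul_eigenvector hz, D.proj_mul_eigenvector hw, smul_mul_smul_comm, ← map_mul,
      ← emb_mul, ← D.compress_iter_emb]
    exact (map_smul D.compressL _ _).symm
  have h3 : ∀ n, ⟪h, (((l : ℂ)⁻¹ ^ n * (m : ℂ)⁻¹ ^ n) •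
      A.incl ((τ ^ n) (D.compress z * D.compress w))) g⟫_ℂ =
      ⟪D.V h, z.1 ((D.proj n).1 (w.1 (D.V g)))⟫_ℂ := by
    intro n
    have h4 : D.proj n * z * D.proj n * (D.proj n * w * D.proj n) =
        D.proj n * (z * (D.proj n * (w * D.proj n))) := by
      simp only [mul_assoc]
      rw [← mul_assoc (D.proj n) (D.proj n), proj_mul_self]
    rw [← map_smul, h2, h4]
    refine (D.inner_compress _ _ _).trans ?_
    change ⟪D.V h, (D.proj n).1 (z.1 ((D.proj n).1 (w.1 ((D.proj n).1 (D.V g)))))⟫_ℂ = _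
    rw [D.inner_proj_right, D.proj_apply_V h1, D.proj_apply_V h1]
  simp only [h3]
  have h5 : ⟪h, A.incl (D.compress (z * w)) g⟫_ℂ = ⟪D.V h, z.1 (w.1 (D.V g))⟫_ℂ :=
    D.inner_compress _ _ _
  rw [h5]
  exact tendsto_const_nhds.inner
    ((z.1.continuous.tendsto _).comp (D.tendsto_proj_apply h1 (w.1 (D.V g))))

/-- Left multiplication in the peripheral Poisson boundary. -/
def mulLeftL (h1 : τ 1 = 1) (x : A) : peripheralSpace ⊤ τ →L[ℂ] A :=
  D.compressL ∘L ContinuousLinearMap.mul ℂ D.B (D.lift x) ∘L D.liftL h1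

/-- Right multiplication in the peripheral Poisson boundary. -/
def mulRightL (h1 : τ 1 = 1) (y : A) : peripheralSpace ⊤ τ →L[ℂ] A :=
  D.compressL ∘L (ContinuousLinearMap.mul ℂ D.B).flip (D.lift y) ∘L D.liftL h1

variable {k : ℕ}

theorem mul_pow_eq (h1 : τ 1 = 1) (hk : k ≠ 0) (D' : MinimalDilation A (τ ^ k)) {x y : A}
    (hx : x ∈ peripheralSpace ⊤ τ) (hy : y ∈ peripheralSpace ⊤ τ) : D'.mul x y = D.mul x y := by
  have h1' : (τ ^ k) 1 = 1 := pow_apply_one h1 k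
  have hle : ∀ x : peripheralSpace ⊤ τ, (x : A) ∈ peripheralSpace ⊤ (τ ^ k) := fun x => by
    rw [peripheralSpace_top_pow hk]
    exact x.2
  let ι : peripheralSpace ⊤ τ →L[ℂ] peripheralSpace ⊤ (τ ^ k) :=
    (peripheralSpace ⊤ τ).subtypeL.codRestrict _ hle
  have key : ∀ (x y : A) (l m : Circle), τ x = (l : ℂ) • x → τ y = (m : ℂ) • y →
      D'.mul x y = D.mul x y := by
    intro x y l m hx hy
    refine A.incl_injective (ContinuousLinearMap.ext fun g => ext_inner_left ℂ fun h => ?_)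
    have hpow : ∀ {x : A} {l : Circle}, τ x = (l : ℂ) • x → (τ ^ k) x = ((l ^ k : Circle) : ℂ) • x :=
      fun hx => by rw [pow_apply_of_eigenvector hx, Circle.coe_pow]
    refine tendsto_nhds_unique (D'.tendsto_inner_mul h1' (hpow hx) (hpow hy) h g) ?_
    -- Along the indices `k * n`, the sequence for `τ` is the one for `τ ^ k`.
    have h2 := (D.tendsto_inner_mul h1 hx hy h g).comp
      (tendsto_id.const_mul_atTop' (Nat.pos_of_ne_zero hk))
    refine h2.congr fun n => ?_
    simp only [Function.comp_apply, id_eq, pow_mul, Circle.coe_pow, inv_pow]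
  -- Equality extends from eigenvectors to the closed span one variable at a time.
  have key2 : ∀ (x : A) (l : Circle), τ x = (l : ℂ) • x → ∀ y ∈ peripheralSpace ⊤ τ,
      D'.mul x y = D.mul x y := by
    intro x l hx y hy
    have h2 : D'.mulLeftL h1' x ∘L ι = D.mulLeftL h1 x :=
      peripheralSpace_ext fun y m _ hy => key x y l m hx hy
    exact congrArg (fun f : peripheralSpace ⊤ τ →L[ℂ] A => f ⟨y, hy⟩) h2
  have h2 : D'.mulRightL h1' y ∘L ι = D.mulRightL h1 y :=
    peripheralSpace_ext fun x l _ hx => key2 x l hx y hy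
  exact congrArg (fun f : peripheralSpace ⊤ τ →L[ℂ] A => f ⟨x, hx⟩) h2

/-- The fixed points of `θ`, as a `*`-algebra. -/
def fixedStarSubalgebra : StarSubalgebra ℂ (D.K →L[ℂ] D.K) where
  carrier := {b | ∃ z : D.B, D.θ z = z ∧ z.1 = b}
  mul_mem' := by
    rintro _ _ ⟨z, hz, rfl⟩ ⟨w, hw, rfl⟩
    exact ⟨z * w, by rw [map_mul, hz, hw], rfl⟩
  add_mem' := by
    rintro _ _ ⟨z, hz, rfl⟩ ⟨w, hw, rfl⟩
    exact ⟨z + w, by rw [map_add, hz, hw], rfl⟩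
  algebraMap_mem' a := ⟨algebraMap ℂ D.B a, AlgHomClass.commutes D.θ a, rfl⟩
  star_mem' := by
    rintro _ ⟨z, hz, rfl⟩
    exact ⟨star z, by rw [map_star, hz], rfl⟩

/-- The fixed points of `θ`, as a von Neumann algebra. -/
def fixedAlgebra : VonNeumannAlgebra D.K where
  toStarSubalgebra := D.fixedStarSubalgebra
  centralizer_centralizer' := by
    refine subset_antisymm (fun b hb => ?_) Set.subset_centralizer_centralizer
    have hbB : b ∈ D.B := by
      rw [← SetLike.mem_coe, ← D.B.centralizer_centralizer]
      refine Set.centralizer_subset (Set.centralizer_subset ?_) hb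
      rintro _ ⟨z, -, rfl⟩
      exact z.2
    refine ⟨⟨b, hbB⟩, Subtype.ext (ContinuousLinearMap.ext fun w => ext_inner_left ℂ fun u => ?_), rfl⟩
    -- Normality of `θ` makes its fixed-point equation ultraweakly continuous, so it persists on the
    -- bicommutant of the fixed points.
    have h2 : IsUltraweakFor D.B.incl fun b => ⟪u, (D.θ b).1 w⟫_ℂ - ⟪u, D.B.incl b w⟫_ℂ :=
      (D.normal.isUltraweakFor_comp u w).sub (IsUltraweakFor.inner u w)
    have h3 := h2.eq_zero D.fixedStarSubalgebra (b := ⟨b, hbB⟩) (by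
      rintro _ ⟨z, hz, rfl⟩
      refine ⟨z, rfl, ?_⟩
      rw [hz]
      exact sub_self _) (by
      rw [← SetLike.mem_coe, StarSubalgebra.coe_bicommutant]
      exact hb)
    exact sub_eq_zero.1 h3

/-- No closure is needed for the trivial group: the dilation shows that `τ` is contractive, so its
fixed points already form a closed subspace. -/
theorem mem_peripheralSpace_bot {x : A} (D : MinimalDilation A τ) :
    x ∈ peripheralSpace ⊥ τ ↔ τ x = x := by
  constructor
  · intro hx
    let T : A →L[ℂ] A := τ.mkContinuous 1 fun x => by
      rw [one_mul]
      exact D.norm_map_le x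
    have h2 : peripheralSpace ⊥ τ ≤ LinearMap.ker (T - ContinuousLinearMap.id ℂ A).toLinearMap := by
      refine peripheralSpace_le (T - ContinuousLinearMap.id ℂ A).isClosed_ker fun x l hl hx => ?_
      rw [Subgroup.mem_bot.1 hl, Circle.coe_one, one_smul] at hx
      exact sub_eq_zero.2 hx
    exact sub_eq_zero.1 (h2 hx)
  · intro hx
    exact mem_peripheralSpace (l := 1) (Subgroup.mem_bot.2 rfl) (by simpa using hx)

theorem θ_lift (h1 : τ 1 = 1) {x : A} (hx : τ x = x) : D.θ (D.lift x) = D.lift x := by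
  obtain ⟨z, hz, rfl⟩ := D.exists_eigenvector h1 (l := 1) (by simpa using hx)
  rw [D.lift_compress h1 (mem_peripheralSpace (l := 1) trivial hz)]
  simpa using hz

theorem mem_peripheralSpace_of_fixed {z : D.B} (hz : D.θ z = z) :
    z ∈ peripheralSpace ⊤ D.endo :=
  mem_peripheralSpace (l := 1) trivial (by simpa using! hz)

/-- The lifting of the Poisson boundary to the fixed points of `θ`. -/
def fixedEquiv (h1 : τ 1 = 1) : peripheralSpace ⊥ τ ≃ₗᵢ[ℂ] D.fixedAlgebra where
  toFun x := ⟨(D.lift x).1, D.lift x, D.θ_lift h1 (D.mem_peripheralSpace_bot.1 x.2), rfl⟩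
  invFun b := ⟨D.compress ⟨b.1, by obtain ⟨z, -, hz⟩ := b.2; rw [← hz]; exact z.2⟩, by
    obtain ⟨_, z, hz, rfl⟩ := b
    rw [D.mem_peripheralSpace_bot, ← compress_θ D h1]
    exact congrArg D.compress hz⟩
  left_inv x := Subtype.ext (D.compress_lift h1 (peripheralSpace_mono bot_le x.2))
  right_inv b := by
    obtain ⟨_, z, hz, rfl⟩ := b
    have h2 : D.lift (D.compress z) = z := D.lift_compress h1 (D.mem_peripheralSpace_of_fixed hz)
    have h3 : (D.lift (D.compress z)).1 = z.1 := by rw [h2]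
    exact Subtype.ext h3
  map_add' x y := by
    have h2 : D.lift (x + y : A) = D.lift x + D.lift y := map_add (D.liftL h1)
      ⟨x, peripheralSpace_mono bot_le x.2⟩ ⟨y, peripheralSpace_mono bot_le y.2⟩
    have h3 : (D.lift (x + y : A)).1 = (D.lift x).1 + (D.lift y).1 := by rw [h2]; rfl
    exact Subtype.ext h3
  map_smul' a x := by
    have h2 : D.lift (a • (x : A)) = a • D.lift x := map_smul (D.liftL h1) a
      ⟨x, peripheralSpace_mono bot_le x.2⟩
    have h3 : (D.lift (a • (x : A))).1 = a • (D.lift x).1 := by rw [h2]; rfl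
    exact Subtype.ext h3
  norm_map' x := by
    have hx : (x : A) ∈ peripheralSpace ⊤ τ := peripheralSpace_mono bot_le x.2
    have h2 := D.norm_compress_of_mem h1 (D.lift_mem h1 hx)
    rw [D.compress_lift h1 hx] at h2
    exact h2.symm

/-- The Poisson boundary is a von Neumann algebra. -/
theorem isVonNeumannWithProduct (h1 : τ 1 = 1) :
    IsVonNeumannWithProduct (peripheralSpace ⊥ τ) D.mul := by
  have hfix : ∀ x : peripheralSpace ⊥ τ, D.θ (D.lift x) = D.lift x :=
    fun x => D.θ_lift h1 (D.mem_peripheralSpace_bot.1 x.2)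
  have hmem : ∀ z : D.B, D.θ z = z → D.compress z ∈ peripheralSpace ⊥ τ := fun z hz => by
    rw [D.mem_peripheralSpace_bot, ← compress_θ D h1, hz]
  have hlift : ∀ z : D.B, D.θ z = z → D.lift (D.compress z) = z := fun z hz =>
    D.lift_compress h1 (D.mem_peripheralSpace_of_fixed hz)
  have hcl : ∀ x : peripheralSpace ⊥ τ, D.compress (D.lift x) = x := fun x =>
    D.compress_lift h1 (peripheralSpace_mono bot_le x.2)
  refine ⟨D.K, inferInstance, inferInstance, inferInstance, D.fixedAlgebra, D.fixedEquiv h1,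
    fun x y => ?_, fun x => ?_, ?_⟩
  · have hz : D.θ (D.lift x * D.lift y) = D.lift x * D.lift y := by rw [map_mul, hfix, hfix]
    have h3 : (D.lift (D.mul x y)).1 = (D.lift x).1 * (D.lift y).1 := by
      rw [mul, hlift _ hz]
      rfl
    exact ⟨hmem _ hz, Subtype.ext h3⟩
  · have hz : D.θ (star (D.lift x)) = star (D.lift x) := by rw [map_star, hfix]
    have hx : D.compress (star (D.lift x)) = star (x : A) := by rw [compress_star, hcl]
    have h3 : (D.lift (star (x : A))).1 = star (D.lift x).1 := by
      rw [← hx, hlift _ hz]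
      rfl
    exact ⟨hx ▸ hmem _ hz, Subtype.ext h3⟩
  · have hz : D.θ 1 = 1 := map_one D.θ
    have hx : D.compress 1 = 1 := Subtype.ext D.V.adjoint_comp_self
    have h3 : (D.lift 1).1 = 1 := by
      rw [← hx, hlift _ hz]
      rfl
    exact ⟨hx ▸ hmem _ hz, Subtype.ext h3⟩

end MinimalDilation

end

/-! ### The theorem -/

theorem theorem4p3 {H : Type u} [NormedAddCommGroup H] [InnerProductSpace ℂ H] [CompleteSpace H]
    (A : VonNeumannAlgebra H) (τ : A →CP A) (hτ_normal : IsNormalMap A τ.toLinearMap)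
    (hτ_unital : τ 1 = 1) (k : ℕ) (hk : 1 ≤ k) :
    -- the minimal dilations that define the products exist
    Nonempty (MinimalDilation A τ.toLinearMap) ∧
    Nonempty (MinimalDilation A (τ.toLinearMap ^ k)) ∧
    ∀ (D : MinimalDilation A τ.toLinearMap) (D' : MinimalDilation A (τ.toLinearMap ^ k)),
      -- so that the products of the two boundaries are well defined
      D.CompressesIsometrically ∧ D'.CompressesIsometrically ∧
      -- the peripheral Poisson boundaries of `τ ^ k` and of `τ` agree
      peripheralSpace ⊤ (τ.toLinearMap ^ k) = peripheralSpace ⊤ τ.toLinearMap ∧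
      (∀ x ∈ peripheralSpace ⊤ τ.toLinearMap, ∀ y ∈ peripheralSpace ⊤ τ.toLinearMap,
        D'.mul x y = D.mul x y) ∧
      -- the Poisson boundary of `τ ^ k` is the `k`-cyclic Poisson boundary of `τ`
      peripheralSpace ⊥ (τ.toLinearMap ^ k) = peripheralSpace (cyclicGroup k) τ.toLinearMap ∧
      (∀ x ∈ peripheralSpace (cyclicGroup k) τ.toLinearMap,
        ∀ y ∈ peripheralSpace (cyclicGroup k) τ.toLinearMap, D'.mul x y = D.mul x y) ∧
      -- and the latter is a von Neumann algebra
      IsVonNeumannWithProduct (peripheralSpace (cyclicGroup k) τ.toLinearMap) D.mul := by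
  have hk0 : k ≠ 0 := Nat.one_le_iff_ne_zero.1 hk
  have h1 : τ.toLinearMap 1 = 1 := hτ_unital
  have h1' : (τ.toLinearMap ^ k) 1 = 1 := MinimalDilation.pow_apply_one h1 k
  have hcp := CompletelyPositiveMap.isVectorCP τ
  have hbot := peripheralSpace_bot_pow (τ := τ.toLinearMap) hk0
  have hle : ∀ x ∈ peripheralSpace (cyclicGroup k) τ.toLinearMap,
      x ∈ peripheralSpace ⊤ τ.toLinearMap := fun x hx => peripheralSpace_mono le_top hx
  refine ⟨nonempty_minimalDilation hcp h1 hτ_normal,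
    nonempty_minimalDilation (hcp.pow k) h1' (hτ_normal.pow k), fun D D' => ?_⟩
  refine ⟨D.compressesIsometrically h1, D'.compressesIsometrically h1', peripheralSpace_top_pow hk0,
    fun x hx y hy => D.mul_pow_eq h1 hk0 D' hx hy, hbot,
    fun x hx y hy => D.mul_pow_eq h1 hk0 D' (hle x hx) (hle y hy), ?_⟩
  have hmul : ∀ x y : peripheralSpace (cyclicGroup k) τ.toLinearMap,
      D'.mul (x : A) y = D.mul (x : A) y :=
    fun x y => D.mul_pow_eq h1 hk0 D' (hle x x.2) (hle y y.2)
  -- The von Neumann structure comes from the fixed points of the dilation of `τ ^ k`; equality of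
  -- the spaces and of the products transfers it to the cyclic boundary with the product from `D`.
  have hvN := D'.isVonNeumannWithProduct h1'
  rw [hbot] at hvN
  obtain ⟨L, i₁, i₂, i₃, N, φ, hφ, hstar, hone⟩ := hvN
  exact ⟨L, i₁, i₂, i₃, N, φ, fun x y => hmul x y ▸ hφ x y, hstar, hone⟩
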